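/- **Setting.** Let a unit carry characteristics $d$ with law $P$, including an auxiliary vector $x$ and a real integrable study variable $y$. Let $\Theta\subset\mathbb R^{p_0+q}$ be open, $\theta=(\theta_1,\theta_2)$ with $\theta_1\in\mathbb R^{p_0}$, $\theta_2\in\mathbb R^{q}$, and let $\mu(x;\theta)$ and the working variance function $V_0$ be known, with $\theta\mapsto\mu(x;\theta)$ twice continuously differentiable on $\Theta$, and $V_0$ positive and continuously differentiable at all values $\mu(x;\theta)$, $\theta\in\Theta$. Suppose $E(Y\mid x)=\mu(x;\theta_0)$ for some $\theta_0\in\Theta$. Put $u(\theta;y)=(y-\mu)\{V_0(\mu)\}^{-1}\partial\mu/\partial\theta$ with $\mu=\mu(x;\theta)$, $I(\theta;y)=-\partial u(\theta;y)/\partial\theta^{T}$ and $\mathcal I(\theta)=E\{I(\theta;Y)\}$. For a block matrix $M$ write $M_{22\cdot1}=M_{22}-M_{21}M_{11}^{-1}M_{12}$. For each $N$, a finite population of $N$ independent units is drawn from $P$, and a sample $A$ of (random) size $n$ is drawn from it by Poisson sampling: given the population, unit $i$ is included independently with known probability $\pi_i=\pi_{N,i}(d_i)$, which may depend on the unit's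 own characteristics. Let $w_i=\pi_i^{-1}$, let $n_0=E\sum_{i=1}^N\pi_i$ be the expected sample size, and $$\hat S_w(\theta)=N^{-1}\sum_{i\in A}w_iu(\theta;y_i).$$ **Regularity conditions.** For some neighbourhood $\mathcal B\subset\Theta$ of $\theta_0$: (i) $\sup_{\theta\in\mathcal B}E\|u(\theta;Y)\|^6<\infty$; (ii) $n_0\,\mathrm{var}\{\hat S_w(\theta)\}\to\Sigma_S(\theta)$ with $\Sigma_S(\theta)$ positive definite, for all $\theta\in\mathcal B$, the variance being with respect to both the super-population model and the sampling; (iii) the entries of $I(\theta;Y)$, $\theta\in\mathcal B$, are dominated in absolute value by one integrable function of the unit, and $\mathcal I(\theta_0)$ is invertible; (iv) as $N\to\infty$, $n_0\to\infty$ and $n_0/N\to0$, and $C_1\le Nn_0^{-1}\pi_i\le C_2$ almost surely for all $N$ and $i\le N$, for two positive constants $C_1,C_2$. **Bootstrap.** Given $A$, let $(N_i^*)_{i\in A}$ be multinomial with $N$ trials and success probabilities $w_i/\sum_{j\in A}w_j$; given these, let $m_i^*\sim\mathrm{Bin}(N_i^*,\pi_i)$ be independent, $w_i^*=w_im_i^*$,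 and $$\hat S_w^*(\theta)=N^{-1}\sum_{i\in A}w_i^*u(\theta;y_i)=\begin{pmatrix}\hat S_{w1}^*(\theta)\\ \hat S_{w2}^*(\theta)\end{pmatrix},\qquad \hat I_w^*(\theta)=N^{-1}\sum_{i\in A}w_i^*I(\theta;y_i).$$ Let $\hat\theta=(\hat\theta_1,\hat\theta_2)$ be, with probability tending to one, the unique solution in $\Theta$ of $\hat S_w(\theta)=0$. Let $\hat\theta_1^{*(0)}$ be, with conditional probability given $A$ tending to one in probability, the unique solution of $\hat S_{w1}^*(\theta_1,\hat\theta_2)=0$ among the $\theta_1$ with $(\theta_1,\hat\theta_2)\in\Theta$. Put $\hat\theta^{*(0)}=(\hat\theta_1^{*(0)},\hat\theta_2)$ and $$X_{QS}^{2*}(\hat\theta_2)=\hat S_{w2}^*(\hat\theta^{*(0)})^{T}\{\hat I_{w22\cdot1}^*(\hat\theta^{*(0)})\}^{-1}\hat S_{w2}^*(\hat\theta^{*(0)}).$$ **Theorem.** Let $\Sigma_\theta=\mathcal I(\theta_0)^{-1}\Sigma_S(\theta_0)\{\mathcal I(\theta_0)^{-1}\}^{T}$ (the asymptotic variance of $\sqrt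 n(\hat\theta-\theta_0)$), with lower right $q\times q$ block $\Sigma_{\theta,22}$. The eigenvalues of $\Sigma_{\theta,22}\,\mathcal I_{22\cdot1}(\theta_0)$, counted with algebraic multiplicity, are real and positive, $c_1\ge\dots\ge c_q>0$, and, conditionally on $A$, $$n\,X_{QS}^{2*}(\hat\theta_2)\longrightarrow\mathcal G_1=\sum_{i=1}^q c_iZ_i^2\quad\text{in distribution as }N\to\infty,$$ where $Z_1,\dots,Z_q$ are independent standard normal variables. That is, for every bounded continuous $f:\mathbb R\to\mathbb R$, the conditional expectation of $f(nX_{QS}^{2*}(\hat\theta_2))$ given $A$ (under the bootstrap distribution) converges in probability to $E f(\mathcal G_1)$. -/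

import Mathlib

open MeasureTheory ProbabilityTheory Filter Topology
open scoped Matrix BoundedContinuousFunction

noncomputable section

namespace SurveyBootstrap

/-- The parameter space `ℝ^(p₀+q)`, with the partition `θ = (θ₁, θ₂)`,
`θ₁ ∈ ℝ^p₀` and `θ₂ ∈ ℝ^q`, and the Euclidean norm. -/
abbrev Param (p₀ q : ℕ) : Type := EuclideanSpace ℝ (Fin p₀ ⊕ Fin q)

/-- The vector `(θ₁, θ₂)`. -/
def joinParam {p₀ q : ℕ} (t₁ : Fin p₀ → ℝ) (t₂ : Fin q → ℝ) : Param p₀ q :=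
  WithLp.toLp 2 (Sum.elim t₁ t₂)

/-- The second component `θ₂` of `θ = (θ₁, θ₂)`. -/
def sndParam {p₀ q : ℕ} (t : Param p₀ q) : Fin q → ℝ := fun j => t (Sum.inr j)

/-- The Schur complement `M₂₂ - M₂₁ M₁₁⁻¹ M₁₂`. -/
def schur {p₀ q : ℕ} (M : Matrix (Fin p₀ ⊕ Fin q) (Fin p₀ ⊕ Fin q) ℝ) :
    Matrix (Fin q) (Fin q) ℝ :=
  M.toBlocks₂₂ - M.toBlocks₂₁ * M.toBlocks₁₁⁻¹ * M.toBlocks₁₂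

/-- The data of a super-population regression model. A unit has characteristics in `U`, with
law `P`; it carries the auxiliary vector `x` and the study variable `y`, and possibly further
characteristics that only matter for the sampling design. -/
structure Model (U X : Type*) [MeasurableSpace U] (p₀ q : ℕ) where
  /-- law of the characteristics of a unit in the super-population -/
  P : Measure U
  /-- auxiliary variables -/
  x : U → X
  /-- study variable -/
  y : U → ℝ
  /-- conditional mean function `μ(x; θ)` -/
  μ : X → Param p₀ q → ℝ
  /-- working variance function -/
  V₀ : ℝ → ℝ
  /-- parameter space -/
  Θ : Set (Param p₀ q)

/-- A sampling design for each population size `N`: the first-order inclusion probability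
`π N i d` of the `i`-th unit, when that unit has characteristics `d`. -/
abbrev Design (U : Type*) : Type _ := ∀ N : ℕ, Fin N → U → unitInterval

/-- An outcome of "generate the population, then draw the sample": for every unit its
characteristics and whether it is in the sample. -/
abbrev Outcome (U : Type*) (N : ℕ) : Type _ := Fin N → U × Bool

/-- The sample `A`. -/
def sample {U : Type*} {N : ℕ} (s : Outcome U N) : Finset (Fin N) :=
  Finset.univ.filter fun i => (s i).2 = true

section Sampling

variable {U : Type*} [MeasurableSpace U]

/-- The joint law of population and sample: the units are independent with law `P`, and, given
the population, the units are selected independently with their inclusion probabilities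
(Poisson sampling). -/
def samplingLaw (P : Measure U) (π : Design U) (N : ℕ) : Measure (Outcome U N) :=
  Measure.pi fun i => P.bind fun d => bernoulliMeasure (d, true) (d, false) (π N i d)

/-- The expected sample size `n₀ = ∑ π_i` (in expectation, should the inclusion probabilities
depend on the characteristics of the units). -/
def expectedSize (P : Measure U) (π : Design U) (N : ℕ) : ℝ :=
  ∑ i : Fin N, ∫ d, (π N i d : ℝ) ∂P

/-- The inclusion probability of unit `i` in the realised population. -/
def inclProb (π : Design U) {N : ℕ} (s : Outcome U N) (i : Fin N) : unitInterval :=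
  π N i (s i).1

/-- The sampling weight `w_i = π_i⁻¹`. -/
def weight (π : Design U) {N : ℕ} (s : Outcome U N) (i : Fin N) : ℝ :=
  (inclProb π s i : ℝ)⁻¹

/-- The multinomial probability `N! / ∏ k_i! * ∏ p_i ^ k_i` of the counts `k` on `A`,
where `p_i = w_i / ∑_{j ∈ A} w_j`. -/
def multinomialMass (π : Design U) {N : ℕ} (s : Outcome U N) (k : Fin N → ℕ) : ℝ :=
  (Nat.multinomial (sample s) k : ℝ) *
    ∏ i ∈ sample s, (weight π s i / ∑ j ∈ sample s, weight π s j) ^ k i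

/-- The bootstrap distribution, given the sample, of the bootstrap counts `(m_i*)`:
`(N_i*)_{i ∈ A}` is multinomial with `N` trials and success probabilities proportional to `w_i`,
and, given these, the `m_i*` are independent, `m_i*` being binomial with `N_i*` trials and success
probability `π_i`. (Units outside of `A` have `N_i* = m_i* = 0`.) -/
def bootLaw (π : Design U) {N : ℕ} (s : Outcome U N) : Measure (Fin N → ℕ) :=
  ∑ k ∈ (sample s).piAntidiag N,
    ENNReal.ofReal (multinomialMass π s k) •
      Measure.pi fun i => binomial (k i) (inclProb π s i)

/-- The bootstrap weight `w_i* = w_i m_i*`. -/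
def bootWeight (π : Design U) {N : ℕ} (s : Outcome U N) (m : Fin N → ℕ) (i : Fin N) : ℝ :=
  weight π s i * m i

end Sampling

namespace Model

variable {U X : Type*} [MeasurableSpace U] {p₀ q : ℕ} (M : Model U X p₀ q)

/-- The quasi-score function `u(θ; y) = (y - μ) V₀(μ)⁻¹ ∂μ/∂θ`. -/
def score (t : Param p₀ q) (d : U) : Param p₀ q :=
  ((M.y d - M.μ (M.x d) t) * (M.V₀ (M.μ (M.x d) t))⁻¹) • gradient (M.μ (M.x d)) t

/-- `I(θ; y) = - ∂u(θ; y)/∂θᵀ`. -/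
def info (t : Param p₀ q) (d : U) : Matrix (Fin p₀ ⊕ Fin q) (Fin p₀ ⊕ Fin q) ℝ :=
  Matrix.of fun j k =>
    -(fderiv ℝ (fun r => M.score r d j) t (EuclideanSpace.single k (1 : ℝ)))

/-- `𝓘(θ) = E{I(θ; Y)}`. -/
def expInfo (t : Param p₀ q) : Matrix (Fin p₀ ⊕ Fin q) (Fin p₀ ⊕ Fin q) ℝ :=
  Matrix.of fun j k => ∫ d, M.info t d j k ∂M.P

/-- The weighted quasi-score `N⁻¹ ∑_{i ∈ A} v_i u(θ; y_i)` with weights `v`. -/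
def wScore {N : ℕ} (s : Outcome U N) (v : Fin N → ℝ) (t : Param p₀ q) : Param p₀ q :=
  (N : ℝ)⁻¹ • ∑ i ∈ sample s, v i • M.score t (s i).1

/-- The weighted information `N⁻¹ ∑_{i ∈ A} v_i I(θ; y_i)` with weights `v`. -/
def wInfo {N : ℕ} (s : Outcome U N) (v : Fin N → ℝ) (t : Param p₀ q) :
    Matrix (Fin p₀ ⊕ Fin q) (Fin p₀ ⊕ Fin q) ℝ :=
  (N : ℝ)⁻¹ • ∑ i ∈ sample s, v i • M.info t (s i).1

/-- The quasi-score statistic `S₂(θ)ᵀ {I₂₂.₁(θ)}⁻¹ S₂(θ)`, with weights `v`. -/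
def quasiScoreStat {N : ℕ} (s : Outcome U N) (v : Fin N → ℝ) (t : Param p₀ q) : ℝ :=
  sndParam (M.wScore s v t) ⬝ᵥ ((schur (M.wInfo s v t))⁻¹ *ᵥ sndParam (M.wScore s v t))

/-- `θhat` is the solution of the weighted quasi-score equation `Ŝ_w(θ) = 0` in `Θ`. -/
def IsSolution (π : Design U) {N : ℕ} (s : Outcome U N) (θhat : Param p₀ q) : Prop :=
  θhat ∈ M.Θ ∧ M.wScore s (weight π s) θhat = 0 ∧
    ∀ t ∈ M.Θ, M.wScore s (weight π s) t = 0 → t = θhat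

/-- `r` is the solution of the bootstrap equation `Ŝ_{w1}*(θ₁, t₂) = 0` (in the set of all `θ₁`
such that `(θ₁, t₂)` belongs to `Θ`). -/
def IsBootSolution (π : Design U) {N : ℕ} (s : Outcome U N) (m : Fin N → ℕ) (t₂ : Fin q → ℝ)
    (r : Fin p₀ → ℝ) : Prop :=
  joinParam r t₂ ∈ M.Θ ∧
    (∀ j : Fin p₀, M.wScore s (bootWeight π s m) (joinParam r t₂) (Sum.inl j) = 0) ∧
    ∀ t₁ : Fin p₀ → ℝ, joinParam t₁ t₂ ∈ M.Θ →
      (∀ j : Fin p₀, M.wScore s (bootWeight π s m) (joinParam t₁ t₂) (Sum.inl j) = 0) → t₁ = r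

end Model

/-- The law of `∑ c_i Z_i²`, for independent standard normal variables `Z_i`. -/
def weightedChiSq {q : ℕ} (c : Fin q → ℝ) : Measure ℝ :=
  (Measure.pi fun _ : Fin q => gaussianReal 0 1).map fun z => ∑ i, c i * z i ^ 2

/-- Conditional convergence in distribution, in probability: the conditional laws of `T N s`
under `κ N s`, given `s`, converge weakly to `G`, in probability with respect to the
law `Pr N` of `s`. -/
def TendstoInDistributionGiven {Ω α : ℕ → Type*} [∀ N, MeasurableSpace (Ω N)]
    [∀ N, MeasurableSpace (α N)] (Pr : ∀ N, Measure (Ω N)) (κ : ∀ N, Ω N → Measure (α N))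
    (T : ∀ N, Ω N → α N → ℝ) (G : Measure ℝ) : Prop :=
  ∀ f : ℝ →ᵇ ℝ, ∀ ε : ℝ, 0 < ε →
    Tendsto (fun N => Pr N {s | ε ≤ |(∫ m, f (T N s m) ∂(κ N s)) - ∫ z, f z ∂G|}) atTop (𝓝 0)

end SurveyBootstrap

end

/-! Convergence in probability is expressed as convergence along a filter: `sampleFilter` consists
of the events of probability tending to one, and `bootFilter` iterates the construction, so that its
events have conditional bootstrap probability tending to one in probability. The filters use outer
measure, so the estimators need not be measurable.

Bootstrap law. Because `w_i π_i = 1`, binomial thinning undoes the unequal multinomial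
probabilities. With `W = ∑_{j ∈ A} w_j`, the generating function of the counts is `(1 + W⁻¹ ∑_{i ∈
A} (z_i - 1))^N` (`integral_prod_pow_bootLaw'`). It is close to that of independent Poisson counts
of mean `N / W`, and `N / W → 1` in probability. Laplace transforms then give laws of large numbers
for integrable functions, for the sampling weights and the bootstrap weights alike
(`tendsto_wMean_weight`, `tendsto_wMean_bootWeight`). Characteristic functions give a conditional
central limit theorem for `√n₀ (Ŝ_w*(θ₀) - Ŝ_w(θ₀))`, with limit `N(0, Σ_S(θ₀))`
(`tendsto_integral_scaledBoot`). Its variance is identified because the weighted squares estimate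
exactly the quantity `n₀ var Ŝ_w` whose limit is given.

Linearization. Domination and continuity of `I(θ; Y)` make the weighted informations uniformly close
to `A = 𝓘(θ₀)` on a small ball, so both scores are nearly affine there with linear part `-A`. A
contraction argument produces roots inside the ball, and uniqueness identifies them with the given
estimators; consistency is thus derived. With `L = (-A₂₁ A₁₁⁻¹, 1)`, which kills the image under `A`
of the first block, the score `Ŝ_{w2}*` at the restricted bootstrap estimator is `L (Ŝ_w*(θ₀) -
Ŝ_w(θ₀))` up to a negligible error (`exists_constrained_root_expansion`).

Limit. The statistic is therefore asymptotically `(L Z)ᵀ A₂₂.₁⁻¹ (L Z)` with `Z` Gaussian of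
covariance `Σ_S(θ₀)`. The conditional mean model makes `A` positive semidefinite, and invertibility
makes it positive definite. Simultaneous diagonalization of `A₂₂.₁⁻¹` and `L Σ_S Lᵀ` turns the form
into `∑ c_i Z_i²`, and `A₂₂.₁⁻¹ L Σ_S Lᵀ` equals `Σ_{θ,22} A₂₂.₁` (`exists_weights_map_scoreForm`).
-/

noncomputable section

namespace SurveyBootstrap

/-! ### Convergence in probability as convergence along a filter -/

section HighProb

variable {ι : Type*} {α : ι → Type*} [∀ i, MeasurableSpace (α i)]

/-- The filter of the sets whose complement has outer measure tending to zero along `l`.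
Convergence along it is convergence in probability. -/
def highProb (l : Filter ι) (ν : ∀ i, Measure (α i)) : Filter (Σ i, α i) where
  sets := {T | Tendsto (fun i => ν i {a | (⟨i, a⟩ : Σ i, α i) ∉ T}) l (𝓝 0)}
  univ_sets := by simp [tendsto_const_nhds]
  sets_of_superset := by
    intro S T hS hST
    refine tendsto_of_tendsto_of_tendsto_of_le_of_le tendsto_const_nhds hS (fun _ => zero_le) ?_
    exact fun i => measure_mono fun a ha hS => ha (hST hS)
  inter_sets := by
    intro S T hS hT
    have h := Tendsto.add hS hT
    rw [add_zero] at h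
    refine tendsto_of_tendsto_of_tendsto_of_le_of_le tendsto_const_nhds h (fun _ => zero_le) ?_
    intro i
    refine (measure_mono ?_).trans (measure_union_le _ _)
    intro a ha
    by_contra hc
    simp only [Set.mem_union, Set.mem_ofPred_eq, not_or, not_not] at hc
    exact ha hc

variable {l : Filter ι} {ν : ∀ i, Measure (α i)}

lemma eventually_highProb {p : (Σ i, α i) → Prop} :
    (∀ᶠ x in highProb l ν, p x) ↔ Tendsto (fun i => ν i {a | ¬ p ⟨i, a⟩}) l (𝓝 0) := Iff.rfl

/-- Over an index in the given event the exceptional fibre is empty, so statements about the index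
pass to the total space. -/
lemma tendsto_fst_highProb : Tendsto Sigma.fst (highProb l ν) l := by
  intro S hS
  change Tendsto _ _ _
  refine tendsto_nhds_of_eventually_eq ?_
  filter_upwards [hS] with i hi
  simp [hi]

lemma highProb_mono {l' : Filter ι} (h : l ≤ l') : highProb l ν ≤ highProb l' ν :=
  fun _ hT => Tendsto.mono_left hT h

lemma eventually_highProb_of_ae {p : (Σ i, α i) → Prop}
    (h : ∀ᶠ i in l, ∀ᵐ a ∂ν i, p ⟨i, a⟩) : ∀ᶠ x in highProb l ν, p x := by
  rw [eventually_highProb]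
  refine tendsto_nhds_of_eventually_eq ?_
  filter_upwards [h] with i hi using hi

/-- Convergence may be checked on the sets where a tight family is bounded. -/
lemma tendsto_highProb_of_tight {E γ : Type*} [NormedAddCommGroup E] {Y : (Σ i, α i) → E}
    {X : (Σ i, α i) → γ} {g : Filter γ}
    (hY : ∀ ε : ENNReal, 0 < ε → ∃ K : ℝ, ∀ᶠ i in l, ν i {a | K < ‖Y ⟨i, a⟩‖} ≤ ε)
    (hX : ∀ K : ℝ, Tendsto X (highProb l ν ⊓ 𝓟 {x | ‖Y x‖ ≤ K}) g) :
    Tendsto X (highProb l ν) g := by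
  intro S hS
  change Tendsto _ _ _
  rw [ENNReal.tendsto_nhds_zero]
  intro ε hε
  obtain ⟨K, hK⟩ := hY (ε / 2) (ENNReal.half_pos hε.ne')
  have h1 := hX K hS
  rw [mem_map, mem_inf_principal] at h1
  have h2 := ENNReal.tendsto_nhds_zero.1 (show Tendsto _ _ _ from h1) (ε / 2)
    (ENNReal.half_pos hε.ne')
  filter_upwards [hK, h2] with i hi1 hi2
  calc _ ≤ ν i ({a | K < ‖Y ⟨i, a⟩‖} ∪ _) := measure_mono ?_
    _ ≤ _ := measure_union_le _ _
    _ ≤ ε / 2 + ε / 2 := add_le_add hi1 hi2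
    _ = ε := ENNReal.add_halves ε
  intro a ha
  by_cases h : K < ‖Y ⟨i, a⟩‖
  · exact Or.inl h
  · refine Or.inr ?_
    simp only [Set.mem_ofPred_eq, Set.mem_preimage, Classical.not_imp]
    exact ⟨not_lt.1 h, ha⟩

/-- Convergence to zero in mean implies convergence to zero in probability. -/
lemma tendsto_highProb_of_integral {X : (Σ i, α i) → ℝ} (h0 : ∀ x, 0 ≤ X x)
    (hi : ∀ᶠ i in l, Integrable (fun a => X ⟨i, a⟩) (ν i))
    (h : Tendsto (fun i => ∫ a, X ⟨i, a⟩ ∂ν i) l (𝓝 0)) : Tendsto X (highProb l ν) (𝓝 0) := by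
  rw [Metric.tendsto_nhds]
  intro ε hε
  rw [eventually_highProb]
  have h1 : Tendsto (fun i => ENNReal.ofReal (∫ a, X ⟨i, a⟩ ∂ν i) / ENNReal.ofReal ε) l (𝓝 0) := by
    have := (ENNReal.continuous_ofReal.tendsto _).comp h
    rw [ENNReal.ofReal_zero] at this
    have h2 := ENNReal.Tendsto.div_const (b := ENNReal.ofReal ε) this
      (Or.inr (by simpa using hε))
    simpa using h2
  refine tendsto_of_tendsto_of_tendsto_of_le_of_le' tendsto_const_nhds h1
    (Eventually.of_forall fun _ => zero_le) ?_
  filter_upwards [hi] with i hi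
  rw [ofReal_integral_eq_lintegral_ofReal hi (Eventually.of_forall fun a => h0 _)]
  refine le_trans (measure_mono ?_)
    (meas_ge_le_lintegral_div hi.aestronglyMeasurable.aemeasurable.ennreal_ofReal
      (by simpa using hε) ENNReal.ofReal_ne_top)
  intro a ha
  simp only [Set.mem_ofPred_eq, Real.dist_eq, sub_zero, not_lt] at ha ⊢
  rw [abs_of_nonneg (h0 _)] at ha
  exact ENNReal.ofReal_le_ofReal ha

/-- Bounded convergence in probability implies convergence in mean. -/
lemma tendsto_integral_of_highProb {X : (Σ i, α i) → ℝ} {C : ℝ} (hC : ∀ x, |X x| ≤ C)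
    (hν : ∀ᶠ i in l, IsProbabilityMeasure (ν i))
    (hm : ∀ᶠ i in l, AEStronglyMeasurable (fun a => X ⟨i, a⟩) (ν i))
    (h : Tendsto X (highProb l ν) (𝓝 0)) : Tendsto (fun i => ∫ a, X ⟨i, a⟩ ∂ν i) l (𝓝 0) := by
  rw [Metric.tendsto_nhds]
  intro ε hε
  have h1 : ∀ᶠ x in highProb l ν, |X x| ≤ ε / 4 := by
    filter_upwards [Metric.tendsto_nhds.1 h (ε / 4) (by positivity)] with x hx
    rw [Real.dist_eq, sub_zero] at hx
    exact hx.le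
  rw [eventually_highProb] at h1
  -- The mass is chosen so that the exceptional set contributes at most `ε / 4`; the summand `1`
  -- keeps the denominator positive.
  have h2 : ∀ᶠ i in l, ν i {a | ¬ |X ⟨i, a⟩| ≤ ε / 4} ≤ ENNReal.ofReal (ε / (4 * (|C| + 1))) :=
    ENNReal.tendsto_nhds_zero.1 h1 _ (by simp; positivity)
  filter_upwards [h2, hν, hm] with i h2 h3 hm
  rw [Real.dist_eq, sub_zero]
  set T := {a | ¬ |X ⟨i, a⟩| ≤ ε / 4}
  have hTm : NullMeasurableSet T (ν i) :=
    (nullMeasurableSet_le (hm.norm.aemeasurable) aemeasurable_const).compl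
  have hint : Integrable (fun a => T.indicator (fun _ => C) a + ε / 4) (ν i) :=
    (((integrable_const C).indicator₀ hTm)).add (integrable_const _)
  have hbound : ∫ a, |X ⟨i, a⟩| ∂ν i ≤ ∫ a, (T.indicator (fun _ => C) a + ε / 4) ∂ν i := by
    refine integral_mono_of_nonneg (Eventually.of_forall fun _ => abs_nonneg _) hint ?_
    refine Eventually.of_forall fun a => ?_
    by_cases ha : a ∈ T
    · simp only [ha, Set.indicator_of_mem]
      have := hC ⟨i, a⟩
      linarith
    · simp only [ha, not_false_eq_true, Set.indicator_of_notMem, zero_add]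
      simpa [T] using ha
  have hT : (ν i).real T ≤ ε / (4 * (|C| + 1)) :=
    ENNReal.toReal_le_of_le_ofReal (by positivity) h2
  have h5 : (ν i).real T * C ≤ ε / 4 := by
    calc (ν i).real T * C ≤ (ν i).real T * (|C| + 1) := by
          gcongr
          linarith [le_abs_self C]
      _ ≤ ε / (4 * (|C| + 1)) * (|C| + 1) := by gcongr
      _ = ε / 4 := by field_simp
  calc |∫ a, X ⟨i, a⟩ ∂ν i| ≤ ∫ a, |X ⟨i, a⟩| ∂ν i := abs_integral_le_integral_abs
    _ ≤ _ := hbound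
    _ = (ν i).real T * C + ε / 4 := by
      rw [integral_add ((integrable_const C).indicator₀ hTm) (integrable_const _),
        integral_indicator₀ hTm]
      simp
    _ < ε := by linarith

/-- A nonnegative variable converges in probability to a constant as soon as its Laplace
transform converges to that of the constant at the two points `1` and `2`. -/
lemma tendsto_highProb_of_laplace {X : (Σ i, α i) → ℝ} {c : ℝ}
    (hX : ∀ᶠ i in l, ∀ᵐ a ∂ν i, 0 ≤ X ⟨i, a⟩)
    (hν : ∀ᶠ i in l, IsProbabilityMeasure (ν i))
    (hm : ∀ᶠ i in l, AEStronglyMeasurable (fun a => X ⟨i, a⟩) (ν i))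
    (h : ∀ t : ℝ, 0 < t →
      Tendsto (fun i => ∫ a, Real.exp (-(t * X ⟨i, a⟩)) ∂ν i) l (𝓝 (Real.exp (-(t * c))))) :
    Tendsto X (highProb l ν) (𝓝 c) := by
  have hint : ∀ᶠ i in l, ∀ t : ℝ, 0 < t →
      Integrable (fun a => Real.exp (-(t * X ⟨i, a⟩))) (ν i) := by
    filter_upwards [hX, hν, hm] with i h0 h1 h2 t ht
    refine Integrable.of_bound (C := 1)
      (Real.continuous_exp.comp_aestronglyMeasurable (h2.const_mul t).neg) ?_
    filter_upwards [h0] with a ha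
    rw [Real.norm_eq_abs, Real.abs_exp, Real.exp_le_one_iff]
    have := mul_nonneg ht.le ha
    linarith
  -- Expanding the square leaves only the transforms at `2` and `1`, and their limits cancel: `exp
  -- (-X)` tends to `exp (-c)` in mean square. The logarithm then recovers `X`.
  have h1 : Tendsto (fun x => (Real.exp (-X x) - Real.exp (-c)) ^ 2) (highProb l ν) (𝓝 0) := by
    have heq : ∀ x, (Real.exp (-X x) - Real.exp (-c)) ^ 2 =
        Real.exp (-(2 * X x)) - 2 * Real.exp (-c) * Real.exp (-(1 * X x)) + Real.exp (-c) ^ 2 := by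
      intro x
      rw [show -(2 * X x) = -X x + -X x by ring, Real.exp_add, one_mul]
      ring
    refine tendsto_highProb_of_integral (fun x => sq_nonneg _) ?_ ?_
    · filter_upwards [hint, hν] with i hi _
      simp_rw [heq]
      exact ((hi 2 two_pos).sub ((hi 1 one_pos).const_mul _)).add (integrable_const _)
    · have h2 := (((h 2 two_pos).sub ((h 1 one_pos).const_mul (2 * Real.exp (-c)))).add_const
        (Real.exp (-c) ^ 2))
      have h3 : Real.exp (-(2 * c)) - 2 * Real.exp (-c) * Real.exp (-(1 * c)) + Real.exp (-c) ^ 2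
          = 0 := by
        rw [show -(2 * c) = -c + -c by ring, Real.exp_add, one_mul]
        ring
      rw [h3] at h2
      refine h2.congr' ?_
      filter_upwards [hint, hν] with i hi _
      simp_rw [heq]
      rw [integral_add ((hi 2 two_pos).sub' ((hi 1 one_pos).const_mul _)) (integrable_const _),
        integral_sub (hi 2 two_pos) ((hi 1 one_pos).const_mul _), integral_const_mul]
      simp
  have h2 : Tendsto (fun x => Real.exp (-X x)) (highProb l ν) (𝓝 (Real.exp (-c))) := by
    rw [tendsto_iff_norm_sub_tendsto_zero]
    have := (Real.continuous_sqrt.tendsto 0).comp h1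
    rw [Real.sqrt_zero] at this
    refine this.congr fun x => ?_
    simp [Real.sqrt_sq_eq_abs]
  have h3 := ((Real.continuousAt_log (Real.exp_pos (-c)).ne').tendsto.comp h2).neg
  simpa [Function.comp_def] using h3

end HighProb

/-! ### Reduction of filter limits to sequences -/

/-- Convergence along a filter may be checked on sequences, if it is implied by the convergence
of a statistic with values in a first countable space. -/
lemma tendsto_of_statistic {α β γ : Type*} [TopologicalSpace β] [FirstCountableTopology β]
    {F : Filter α} {Φ : α → β} {b : β} {Ψ : α → γ} {g : Filter γ} {p : α → Prop}
    (hp : ∀ᶠ x in F, p x) (hΦ : Tendsto Φ F (𝓝 b))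
    (h : ∀ u : ℕ → α, (∀ n, p (u n)) → Tendsto (fun n => Φ (u n)) atTop (𝓝 b) →
      Tendsto (fun n => Ψ (u n)) atTop g) : Tendsto Ψ F g := by
  -- `F` need not be countably generated, but the coarser filter pulled back from a first countable
  -- space is, so sequences suffice for it.
  have h1 : Tendsto Ψ (comap Φ (𝓝 b) ⊓ 𝓟 {x | p x}) g := by
    refine tendsto_of_seq_tendsto fun u hu => ?_
    rw [tendsto_inf, tendsto_principal, tendsto_comap_iff] at hu
    obtain ⟨k, hk⟩ := eventually_atTop.1 hu.2
    rw [← tendsto_add_atTop_iff_nat k]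
    exact h (fun n => u (n + k)) (fun n => hk _ (Nat.le_add_left k n))
      ((tendsto_add_atTop_iff_nat k).2 hu.1)
  exact h1.mono_left (le_inf hΦ.le_comap (le_principal_iff.2 hp))

/-! ### Replacing products and powers by exponentials -/

section Products

variable {𝕜 : Type*} [NormedCommRing 𝕜] [NormOneClass 𝕜]

/-- Telescoping: exchange one factor at a time, all the others staying in the unit ball. -/
lemma norm_prod_sub_prod_le {ι : Type*} (s : Finset ι) (a b : ι → 𝕜) (ha : ∀ i ∈ s, ‖a i‖ ≤ 1)
    (hb : ∀ i ∈ s, ‖b i‖ ≤ 1) : ‖∏ i ∈ s, a i - ∏ i ∈ s, b i‖ ≤ ∑ i ∈ s, ‖a i - b i‖ := by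
  classical
  induction s using Finset.induction_on with
  | empty => simp
  | insert j s hj ih =>
    rw [Finset.prod_insert hj, Finset.prod_insert hj, Finset.sum_insert hj]
    have h1 : ‖∏ i ∈ s, a i‖ ≤ 1 := (Finset.norm_prod_le _ _).trans
      (Finset.prod_le_one (fun _ _ => norm_nonneg _) fun i hi => ha i (Finset.mem_insert_of_mem hi))
    have h2 := ih (fun i hi => ha i (Finset.mem_insert_of_mem hi))
      (fun i hi => hb i (Finset.mem_insert_of_mem hi))
    calc ‖a j * ∏ i ∈ s, a i - b j * ∏ i ∈ s, b i‖
        = ‖(a j - b j) * ∏ i ∈ s, a i + b j * (∏ i ∈ s, a i - ∏ i ∈ s, b i)‖ := by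
          congr 1; ring
      _ ≤ ‖(a j - b j)‖ * ‖∏ i ∈ s, a i‖ + ‖b j‖ * ‖∏ i ∈ s, a i - ∏ i ∈ s, b i‖ :=
          (norm_add_le _ _).trans (add_le_add (norm_mul_le _ _) (norm_mul_le _ _))
      _ ≤ ‖(a j - b j)‖ * 1 + 1 * ∑ i ∈ s, ‖a i - b i‖ := by
          gcongr
          exact hb j (Finset.mem_insert_self _ _)
      _ = _ := by ring

end Products

/-- `z ^ N` is close to `exp (N (z - 1))`, for `z` in the unit disk close to `1`. -/
lemma norm_pow_sub_exp_le (N : ℕ) {z : ℂ} (hz : ‖z‖ ≤ 1) :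
    ‖z ^ N - Complex.exp (N * (z - 1))‖ ≤ N * (2 * ‖z - 1‖ ^ 2) := by
  have h1 : ‖Complex.exp (z - 1)‖ ≤ 1 := by
    rw [Complex.norm_exp, Real.exp_le_one_iff]
    have := (Complex.re_le_norm z).trans hz
    simpa using this
  have h0 : ‖z - Complex.exp (z - 1)‖ ≤ 2 * ‖z - 1‖ ^ 2 := by
    -- Near `1` the bound is the second-order remainder of the exponential; otherwise both points
    -- lie in the unit disk, and their distance `≤ 2` is at most `2 ‖z - 1‖ ^ 2`.
    by_cases hs : ‖z - 1‖ ≤ 1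
    · have h3 := Complex.norm_exp_sub_one_sub_id_le hs
      rw [norm_sub_rev, show Complex.exp (z - 1) - z = Complex.exp (z - 1) - 1 - (z - 1) by ring]
      nlinarith [sq_nonneg ‖z - 1‖]
    · push Not at hs
      have := norm_sub_le z (Complex.exp (z - 1))
      nlinarith
  have h2 := norm_prod_sub_prod_le (Finset.range N) (fun _ => z) (fun _ => Complex.exp (z - 1))
    (fun _ _ => hz) (fun _ _ => h1)
  simp only [Finset.prod_const, Finset.card_range, Finset.sum_const, nsmul_eq_mul] at h2
  rw [Complex.exp_nat_mul]
  exact h2.trans (by gcongr)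

/-! ### Transforms of the bootstrap counts -/

section Bootstrap

lemma integral_pow_binomial (n : ℕ) (p : unitInterval) (z : ℂ) :
    ∫ m, z ^ m ∂(binomial n p) = (1 - (p : ℝ) + (p : ℝ) * z) ^ n := by
  rw [integral_binomial, add_comm, add_pow, Finset.range_eq_Ico]
  refine Finset.sum_congr ?_ fun k _ => ?_
  · ext k; simp
  · rw [Complex.real_smul, mul_pow]
    push_cast
    ring

variable {U : Type*} {N : ℕ} (π : Design U) (s : Outcome U N)

lemma weight_nonneg (i : Fin N) : 0 ≤ weight π s i := inv_nonneg.2 (inclProb π s i).2.1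

lemma multinomialMass_nonneg (k : Fin N → ℕ) : 0 ≤ multinomialMass π s k := by
  refine mul_nonneg (Nat.cast_nonneg _) (Finset.prod_nonneg fun i _ => pow_nonneg ?_ _)
  exact div_nonneg (weight_nonneg π s i) (Finset.sum_nonneg fun j _ => weight_nonneg π s j)

/-- The probability generating function of the bootstrap counts. -/
lemma integral_prod_pow_bootLaw (z : Fin N → ℂ) (hz : ∀ i, ‖z i‖ ≤ 1) :
    ∫ m, ∏ i, z i ^ m i ∂(bootLaw π s) =
      (∑ i ∈ sample s, ((weight π s i / ∑ j ∈ sample s, weight π s j : ℝ) : ℂ) *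
        (1 - (inclProb π s i : ℝ) + (inclProb π s i : ℝ) * z i)) ^ N := by
  have hint : ∀ k : Fin N → ℕ, Integrable (fun m : Fin N → ℕ => ∏ i, z i ^ m i)
      (Measure.pi fun i => binomial (k i) (inclProb π s i)) := by
    intro k
    refine Integrable.of_bound (C := 1) (Measurable.of_discrete).aestronglyMeasurable
      (Eventually.of_forall fun m => ?_)
    rw [norm_prod]
    refine Finset.prod_le_one (fun _ _ => norm_nonneg _) fun i _ => ?_
    rw [norm_pow]
    exact pow_le_one₀ (norm_nonneg _) (hz i)
  rw [bootLaw, integral_finsetSum_measure fun k _ => (hint k).smul_measure ENNReal.ofReal_ne_top,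
    Finset.sum_pow_eq_sum_piAntidiag]
  refine Finset.sum_congr rfl fun k hk => ?_
  rw [Finset.mem_piAntidiag] at hk
  rw [integral_smul_measure, ENNReal.toReal_ofReal (multinomialMass_nonneg π s k),
    integral_fintype_prod_eq_prod (f := fun i (m : ℕ) => z i ^ m), Complex.real_smul,
    multinomialMass]
  simp_rw [integral_pow_binomial, mul_pow]
  rw [Finset.prod_mul_distrib, ← Finset.prod_subset (Finset.subset_univ (sample s))]
  · push_cast
    ring
  · intro i _ hi
    have : k i = 0 := by
      by_contra h
      exact hi (hk.2 i h)
    rw [this, pow_zero]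

variable {π s}

/-- The cell probability `w_i / W` times the thinning probability `π_i` is `1 / W` for every sampled
unit. Jointly the `m_i*` are therefore multinomial with equal cell probabilities, the mass left over
being the trials that are thinned away. -/
lemma one_add_sum_bootLaw (h0 : ∑ j ∈ sample s, weight π s j ≠ 0)
    (hπ : ∀ i ∈ sample s, (inclProb π s i : ℝ) ≠ 0) (z : Fin N → ℂ) :
    1 + ((∑ j ∈ sample s, weight π s j : ℝ) : ℂ)⁻¹ * ∑ i ∈ sample s, (z i - 1) =
      ∑ i ∈ sample s, ((weight π s i / ∑ j ∈ sample s, weight π s j : ℝ) : ℂ) *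
        (1 - (inclProb π s i : ℝ) + (inclProb π s i : ℝ) * z i) := by
  have h1 : (1 : ℂ) = ∑ i ∈ sample s,
      ((weight π s i / ∑ j ∈ sample s, weight π s j : ℝ) : ℂ) := by
    rw [← Complex.ofReal_sum, ← Finset.sum_div, div_self h0, Complex.ofReal_one]
  have h4 : ((∑ j ∈ sample s, weight π s j : ℝ) : ℂ) ≠ 0 := by exact_mod_cast h0
  conv_lhs => rw [h1]
  rw [Finset.mul_sum, ← Finset.sum_add_distrib]
  refine Finset.sum_congr rfl fun i hi => ?_
  rw [Complex.ofReal_div]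
  generalize ((∑ j ∈ sample s, weight π s j : ℝ) : ℂ) = W at h4
  have h3 : ((inclProb π s i : ℝ) : ℂ) ≠ 0 := by exact_mod_cast hπ i hi
  rw [weight, Complex.ofReal_inv, ← h1]
  field_simp
  ring

lemma integral_prod_pow_bootLaw' (h0 : ∑ j ∈ sample s, weight π s j ≠ 0)
    (hπ : ∀ i ∈ sample s, (inclProb π s i : ℝ) ≠ 0) (z : Fin N → ℂ) (hz : ∀ i, ‖z i‖ ≤ 1) :
    ∫ m, ∏ i, z i ^ m i ∂(bootLaw π s) =
      (1 + ((∑ j ∈ sample s, weight π s j : ℝ) : ℂ)⁻¹ * ∑ i ∈ sample s, (z i - 1)) ^ N := by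
  rw [integral_prod_pow_bootLaw π s z hz, one_add_sum_bootLaw h0 hπ]

/-- The total mass is the generating function at `z = 1`. The nonzero total weight excludes the
empty sample, for which no multinomial draw with `N > 0` trials exists. -/
lemma isProbabilityMeasure_bootLaw (h0 : ∑ j ∈ sample s, weight π s j ≠ 0)
    (hπ : ∀ i ∈ sample s, (inclProb π s i : ℝ) ≠ 0) : IsProbabilityMeasure (bootLaw π s) := by
  have h := integral_prod_pow_bootLaw' h0 hπ (fun _ => 1) (by simp)
  simp only [one_pow, Finset.prod_const_one, integral_const, sub_self, Finset.sum_const_zero,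
    mul_zero, add_zero, Complex.real_smul, mul_one, Complex.ofReal_eq_one] at h
  constructor
  rw [measureReal_def, ENNReal.toReal_eq_one_iff] at h
  exact h

/-- The generating function at `z_i = exp (τ_i)`. Real `τ ≤ 0` gives the Laplace transforms for the
law of large numbers, imaginary `τ` the characteristic functions for the central limit theorem. -/
lemma integral_exp_bootLaw (h0 : ∑ j ∈ sample s, weight π s j ≠ 0)
    (hπ : ∀ i ∈ sample s, (inclProb π s i : ℝ) ≠ 0) (τ : Fin N → ℂ)
    (hτ : ∀ i ∈ sample s, (τ i).re ≤ 0) :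
    ∫ m, Complex.exp (∑ i ∈ sample s, m i * τ i) ∂(bootLaw π s) =
      (1 + ((∑ j ∈ sample s, weight π s j : ℝ) : ℂ)⁻¹ *
        ∑ i ∈ sample s, (Complex.exp (τ i) - 1)) ^ N := by
  classical
  have h := integral_prod_pow_bootLaw' h0 hπ
    (fun i => if i ∈ sample s then Complex.exp (τ i) else 1) (fun i => by
      split_ifs with hi
      · rw [Complex.norm_exp, Real.exp_le_one_iff]
        exact hτ i hi
      · simp)
  rw [Finset.sum_congr rfl fun i hi => show (if i ∈ sample s then Complex.exp (τ i) else 1) - 1 =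
    Complex.exp (τ i) - 1 by rw [if_pos hi]] at h
  rw [← h]
  refine integral_congr_ae (Eventually.of_forall fun m => ?_)
  simp only
  rw [Complex.exp_sum, ← Finset.prod_subset (Finset.subset_univ (sample s))]
  · refine Finset.prod_congr rfl fun i hi => ?_
    rw [if_pos hi, ← Complex.exp_nat_mul]
  · intro i _ hi
    simp [hi]

/-- By `one_add_sum_bootLaw` the base of the power is a convex combination of points of the unit
disk; this is the condition of `norm_pow_sub_exp_le`. -/
lemma norm_one_add_bootLaw_le (h0 : ∑ j ∈ sample s, weight π s j ≠ 0)
    (hπ : ∀ i ∈ sample s, (inclProb π s i : ℝ) ≠ 0) (τ : Fin N → ℂ)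
    (hτ : ∀ i ∈ sample s, (τ i).re ≤ 0) :
    ‖1 + ((∑ j ∈ sample s, weight π s j : ℝ) : ℂ)⁻¹ *
        ∑ i ∈ sample s, (Complex.exp (τ i) - 1)‖ ≤ 1 := by
  have h3 : (1 : ℝ) = ∑ i ∈ sample s, (weight π s i / ∑ j ∈ sample s, weight π s j : ℝ) := by
    rw [← Finset.sum_div, div_self h0]
  rw [one_add_sum_bootLaw h0 hπ, h3]
  refine (norm_sum_le _ _).trans (Finset.sum_le_sum fun i hi => ?_)
  have hp := (inclProb π s i).2
  have hw : 0 ≤ weight π s i / ∑ j ∈ sample s, weight π s j :=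
    div_nonneg (weight_nonneg π s i) (Finset.sum_nonneg fun j _ => weight_nonneg π s j)
  rw [norm_mul, Complex.norm_real, Real.norm_of_nonneg hw]
  refine mul_le_of_le_one_right hw ?_
  have h5 : ‖Complex.exp (τ i)‖ ≤ 1 := by
    rw [Complex.norm_exp, Real.exp_le_one_iff]
    exact hτ i hi
  have h6 : ‖(1 - ((inclProb π s i : ℝ) : ℂ))‖ = 1 - (inclProb π s i : ℝ) := by
    rw [← Complex.ofReal_one, ← Complex.ofReal_sub, Complex.norm_real,
      Real.norm_of_nonneg (by linarith [hp.2])]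
  calc _ ≤ ‖(1 - ((inclProb π s i : ℝ) : ℂ))‖ + ‖((inclProb π s i : ℝ) : ℂ) * Complex.exp (τ i)‖ :=
        norm_add_le _ _
    _ ≤ (1 - (inclProb π s i : ℝ)) + (inclProb π s i : ℝ) * 1 := by
        rw [h6, norm_mul, Complex.norm_real, Real.norm_of_nonneg hp.1]
        gcongr
        exact hp.1
    _ = 1 := by ring

end Bootstrap

/-! ### The law of one unit under Poisson sampling -/

section UnitLaw

variable {U : Type*} [MeasurableSpace U]

/-- The law of a unit together with the indicator of its selection. -/
def unitLaw (P : Measure U) (p : U → unitInterval) : Measure (U × Bool) :=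
  P.bind fun d => bernoulliMeasure (d, true) (d, false) (p d)

variable {P : Measure U} {p : U → unitInterval}

lemma measurable_toNNReal_comp (hp : Measurable p) :
    Measurable fun d => unitInterval.toNNReal (p d) :=
  unitInterval.toNNReal_continuous.measurable.comp hp

lemma measurable_bernoulliMeasure_pair (hp : Measurable p) :
    Measurable fun d : U => bernoulliMeasure (d, true) (d, false) (p d) := by
  refine Measure.measurable_of_measurable_coe _ fun s hs => ?_
  have h1 : Measurable fun d : U => s.indicator (1 : U × Bool → ENNReal) (d, true) :=
    (measurable_one.indicator hs).comp (by fun_prop)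
  have h2 : Measurable fun d : U => s.indicator (1 : U × Bool → ENNReal) (d, false) :=
    (measurable_one.indicator hs).comp (by fun_prop)
  simp only [bernoulliMeasure, Measure.add_apply, Measure.smul_apply, Measure.dirac_apply' _ hs,
    ENNReal.smul_def, smul_eq_mul]
  exact ((measurable_toNNReal_comp hp).coe_nnreal_ennreal.mul h1).add
    ((measurable_toNNReal_comp
      (unitInterval.continuous_symm.measurable.comp hp)).coe_nnreal_ennreal.mul h2)

lemma lintegral_unitLaw (hp : Measurable p) {f : U × Bool → ENNReal} (hf : Measurable f) :
    ∫⁻ z, f z ∂unitLaw P p = ∫⁻ d, (unitInterval.toNNReal (p d) * f (d, true) +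
      unitInterval.toNNReal (unitInterval.symm (p d)) * f (d, false)) ∂P := by
  rw [unitLaw, Measure.lintegral_bind (measurable_bernoulliMeasure_pair hp).aemeasurable
    hf.aemeasurable]
  refine lintegral_congr fun d => ?_
  rw [bernoulliMeasure, lintegral_add_measure, lintegral_smul_measure, lintegral_smul_measure,
    lintegral_dirac' _ hf, lintegral_dirac' _ hf]
  rfl

/-- Splitting by selection into two images of measures with density reduces integrability and real
integrals, not covered by the formula for lower integrals, to integrals over `P`. -/
lemma unitLaw_eq (hp : Measurable p) : unitLaw P p =
    (P.withDensity fun d => unitInterval.toNNReal (p d)).map (fun d => (d, true)) +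
    (P.withDensity fun d => unitInterval.toNNReal (unitInterval.symm (p d))).map
      (fun d => (d, false)) := by
  have hp' : Measurable fun d => unitInterval.symm (p d) :=
    unitInterval.continuous_symm.measurable.comp hp
  refine Measure.ext_of_lintegral _ fun f hf => ?_
  have h1 : Measurable fun d : U => f (d, true) := hf.comp (by fun_prop)
  have h2 : Measurable fun d : U => f (d, false) := hf.comp (by fun_prop)
  rw [lintegral_unitLaw hp hf, lintegral_add_measure, lintegral_map hf (by fun_prop),
    lintegral_map hf (by fun_prop), lintegral_withDensity_eq_lintegral_mul _
      (measurable_toNNReal_comp hp).coe_nnreal_ennreal h1,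
    lintegral_withDensity_eq_lintegral_mul _
      (measurable_toNNReal_comp hp').coe_nnreal_ennreal h2]
  exact lintegral_add_left ((measurable_toNNReal_comp hp).coe_nnreal_ennreal.mul h1) _

lemma isProbabilityMeasure_unitLaw [IsProbabilityMeasure P] (hp : Measurable p) :
    IsProbabilityMeasure (unitLaw P p) := by
  constructor
  rw [← lintegral_one, lintegral_unitLaw hp measurable_const]
  have : ∀ d, (unitInterval.toNNReal (p d) * 1 +
      unitInterval.toNNReal (unitInterval.symm (p d)) * 1 : ENNReal) = 1 := by
    intro d
    rw [mul_one, mul_one, ← ENNReal.coe_add]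
    simp
  simp_rw [this]
  simp

lemma map_fst_unitLaw (hp : Measurable p) : (unitLaw P p).map Prod.fst = P := by
  refine Measure.ext_of_lintegral _ fun f hf => ?_
  rw [lintegral_map hf measurable_fst, lintegral_unitLaw hp (f := fun z => f z.1)
    (hf.comp measurable_fst)]
  refine lintegral_congr fun d => ?_
  rw [← add_mul, ← ENNReal.coe_add]
  simp

lemma integrable_unitLaw (hp : Measurable p) {f : U × Bool → ℝ} (hf : Measurable f)
    (h1 : Integrable (fun d => (p d : ℝ) * f (d, true)) P)
    (h2 : Integrable (fun d => (1 - (p d : ℝ)) * f (d, false)) P) :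
    Integrable f (unitLaw P p) := by
  have hp' : Measurable fun d => unitInterval.symm (p d) :=
    unitInterval.continuous_symm.measurable.comp hp
  rw [unitLaw_eq hp, integrable_add_measure]
  constructor
  · rw [integrable_map_measure hf.aestronglyMeasurable (by fun_prop),
      integrable_withDensity_iff_integrable_smul (measurable_toNNReal_comp hp)]
    exact h1
  · rw [integrable_map_measure hf.aestronglyMeasurable (by fun_prop),
      integrable_withDensity_iff_integrable_smul (measurable_toNNReal_comp hp')]
    exact h2

lemma integral_unitLaw (hp : Measurable p) {f : U × Bool → ℝ} (hf : Measurable f)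
    (h1 : Integrable (fun d => (p d : ℝ) * f (d, true)) P)
    (h2 : Integrable (fun d => (1 - (p d : ℝ)) * f (d, false)) P) :
    ∫ z, f z ∂unitLaw P p =
      ∫ d, (p d : ℝ) * f (d, true) ∂P + ∫ d, (1 - (p d : ℝ)) * f (d, false) ∂P := by
  have hp' : Measurable fun d => unitInterval.symm (p d) :=
    unitInterval.continuous_symm.measurable.comp hp
  have h := integrable_unitLaw hp hf h1 h2
  rw [unitLaw_eq hp, integrable_add_measure] at h
  rw [unitLaw_eq hp, integral_add_measure h.1 h.2,
    integral_map (by fun_prop) hf.aestronglyMeasurable,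
    integral_map (by fun_prop) hf.aestronglyMeasurable,
    integral_withDensity_eq_integral_smul (measurable_toNNReal_comp hp),
    integral_withDensity_eq_integral_smul (measurable_toNNReal_comp hp')]
  rfl

variable {π : Design U}

lemma samplingLaw_eq (N : ℕ) :
    samplingLaw P π N = Measure.pi fun i : Fin N => unitLaw P (π N i) := rfl

lemma isProbabilityMeasure_samplingLaw [IsProbabilityMeasure P] (hπ : ∀ N i, Measurable (π N i))
    (N : ℕ) : IsProbabilityMeasure (samplingLaw P π N) := by
  have := fun i => isProbabilityMeasure_unitLaw (P := P) (hπ N i)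
  rw [samplingLaw_eq]
  infer_instance

lemma ae_samplingLaw [IsProbabilityMeasure P] (hπ : ∀ N i, Measurable (π N i)) {N : ℕ}
    {r : Fin N → U → Prop} (h : ∀ i, ∀ᵐ d ∂P, r i d) :
    ∀ᵐ s ∂samplingLaw P π N, ∀ i, r i (s i).1 := by
  have := fun i => isProbabilityMeasure_unitLaw (P := P) (hπ N i)
  rw [ae_all_iff]
  intro i
  have h1 : ∀ᵐ z ∂unitLaw P (π N i), r i z.1 := by
    refine ae_of_ae_map (f := Prod.fst) measurable_fst.aemeasurable ?_
    rw [map_fst_unitLaw (hπ N i)]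
    exact h i
  exact (measurePreserving_eval (fun i : Fin N => unitLaw P (π N i)) i).quasiMeasurePreserving.ae h1

end UnitLaw

/-! ### Damped functions and regular designs -/

section LawOfLargeNumbers

variable {U : Type*}

/-- The weighted mean `N⁻¹ ∑_{i ∈ A} v_i h_i(d_i)`. -/
def wMean {N : ℕ} (s : Outcome U N) (v : Fin N → ℝ) (h : Fin N → U → ℝ) : ℝ :=
  (N : ℝ)⁻¹ * ∑ i ∈ sample s, v i * h i (s i).1

lemma wMean_eq_sum {N : ℕ} (s : Outcome U N) (v : Fin N → ℝ) (h : Fin N → U → ℝ) :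
    wMean s v h = ∑ i, if (s i).2 = true then (N : ℝ)⁻¹ * (v i * h i (s i).1) else 0 := by
  rw [wMean, sample, Finset.sum_filter, Finset.mul_sum]
  refine Finset.sum_congr rfl fun i _ => ?_
  split_ifs <;> simp

lemma wMean_sub {N : ℕ} (s : Outcome U N) (v : Fin N → ℝ) (g h : Fin N → U → ℝ) :
    wMean s v (fun i d => g i d - h i d) = wMean s v g - wMean s v h := by
  simp only [wMean, mul_sub, Finset.sum_sub_distrib]

/-- Two regimes in one bound: the linear one supplies domination by an integrable function, the
quadratic one the convergence. No second moment is then needed. -/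
lemma abs_sub_one_sub_exp_neg_le {x : ℝ} (hx : 0 ≤ x) :
    |x - (1 - Real.exp (-x))| ≤ x * min 1 x := by
  have h1 := Real.add_one_le_exp (-x)
  have h2 : Real.exp (-x) ≤ 1 := Real.exp_le_one_iff.2 (by linarith)
  rw [abs_of_nonneg (by linarith), mul_min_of_nonneg _ _ hx, le_min_iff]
  refine ⟨by linarith, ?_⟩
  by_cases h : x ≤ 1
  · have := Real.abs_exp_sub_one_sub_id_le (x := -x) (by rwa [abs_neg, abs_of_nonneg hx])
    have := (abs_le.1 this).2
    nlinarith
  · nlinarith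

/-- `N π (1 - exp (-t h / (N π)))`, an approximation to `t h`. -/
def damped (p : U → unitInterval) (N : ℕ) (t : ℝ) (h : U → ℝ) (d : U) : ℝ :=
  N * (p d : ℝ) * (1 - Real.exp (-(t * ((N : ℝ)⁻¹ * ((p d : ℝ)⁻¹ * h d)))))

lemma damped_bounds {p : U → unitInterval} {N : ℕ} {t : ℝ} {h : U → ℝ} {d : U} (ht : 0 ≤ t)
    (hh : 0 ≤ h d) (hp : 0 < N * (p d : ℝ)) :
    0 ≤ damped p N t h d ∧ damped p N t h d ≤ t * h d ∧
    |t * h d - damped p N t h d| ≤ t * h d * min 1 (t * h d / (N * (p d : ℝ))) := by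
  set x := t * h d / (N * (p d : ℝ)) with hx
  have hx0 : 0 ≤ x := by positivity
  have hxt : t * h d = N * (p d : ℝ) * x := by
    rw [hx, eq_comm, mul_comm]
    exact div_mul_cancel₀ _ hp.ne'
  have he : damped p N t h d = N * (p d : ℝ) * (1 - Real.exp (-x)) := by
    have : t * ((N : ℝ)⁻¹ * ((p d : ℝ)⁻¹ * h d)) = x := by
      rw [hx, div_eq_mul_inv, mul_inv]; ring
    rw [damped, this]
  have h1 := Real.add_one_le_exp (-x)
  have h2 : Real.exp (-x) ≤ 1 := Real.exp_le_one_iff.2 (by linarith)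
  refine ⟨?_, ?_, ?_⟩
  · rw [he]
    exact mul_nonneg hp.le (by linarith)
  · rw [he, hxt]
    exact mul_le_mul_of_nonneg_left (by linarith) hp.le
  · rw [he, hxt, ← mul_sub, abs_mul, abs_of_pos hp, mul_assoc (N * (p d : ℝ)) x]
    exact mul_le_mul_of_nonneg_left (abs_sub_one_sub_exp_neg_le hx0) hp.le

variable [MeasurableSpace U]

/-- The conditions on the design: Poisson sampling with `n₀ → ∞`, `n₀ / N → 0` and inclusion
probabilities of the exact order `n₀ / N`. -/
structure IsRegularDesign (P : Measure U) (π : Design U) (C₁ C₂ : ℝ) : Prop where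
  measurable : ∀ N i, Measurable (π N i)
  tendsto_size : Tendsto (expectedSize P π) atTop atTop
  tendsto_fraction : Tendsto (fun N => expectedSize P π N / N) atTop (𝓝 0)
  pos : 0 < C₁
  bounds : ∀ N i, ∀ᵐ d ∂P, C₁ ≤ N * (expectedSize P π N)⁻¹ * (π N i d : ℝ) ∧
      N * (expectedSize P π N)⁻¹ * (π N i d : ℝ) ≤ C₂

/-- The filter of the events whose probability tends to one. -/
def sampleFilter (P : Measure U) (π : Design U) : Filter (Σ N, Outcome U N) :=
  highProb atTop (samplingLaw P π)

lemma measurable_damped {p : U → unitInterval} (hp : Measurable p) (N : ℕ) (t : ℝ) {h : U → ℝ}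
    (hh : Measurable h) : Measurable (damped p N t h) := by
  have : Measurable fun d => (p d : ℝ) := measurable_subtype_coe.comp hp
  unfold damped
  fun_prop

variable {P : Measure U} {π : Design U} {C₁ C₂ : ℝ}

lemma IsRegularDesign.eventually_pos (hD : IsRegularDesign P π C₁ C₂) :
    ∀ᶠ N in atTop, 0 < N ∧ 0 < expectedSize P π N :=
  (eventually_gt_atTop 0).and (hD.tendsto_size.eventually_gt_atTop 0)

/-- The usable form of the lower bound: `N π_i` is at least of order `n₀ → ∞`, uniformly in the
units, so no single unit dominates a weighted mean. -/
lemma IsRegularDesign.ae_le (hD : IsRegularDesign P π C₁ C₂) {N : ℕ} (i : Fin N)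
    (h0 : 0 < expectedSize P π N) :
    ∀ᵐ d ∂P, C₁ * expectedSize P π N ≤ N * (π N i d : ℝ) ∧ 0 < (π N i d : ℝ) := by
  filter_upwards [hD.bounds N i] with d hd
  have h1 := hd.1
  have hp := hD.pos
  rw [mul_right_comm, ← div_eq_mul_inv, le_div_iff₀ h0] at h1
  refine ⟨h1, ?_⟩
  by_contra h
  have h2 : (π N i d : ℝ) = 0 := le_antisymm (not_lt.1 h) (π N i d).2.1
  rw [h2, mul_zero] at h1
  have := mul_pos hp h0
  linarith

/-- The approximation of `t h` by `damped` holds in mean. -/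
lemma tendsto_mean_damped (hD : IsRegularDesign P π C₁ C₂) {h : ∀ N : ℕ, Fin N → U → ℝ}
    (hm : ∀ N i, Measurable (h N i)) {H : U → ℝ} (hH : Integrable H P)
    (h0 : ∀ N i d, 0 ≤ h N i d) (hle : ∀ N i, ∀ᵐ d ∂P, h N i d ≤ H d) {c : ℝ}
    (hc : Tendsto (fun N : ℕ => (N : ℝ)⁻¹ * ∑ i, ∫ d, h N i d ∂P) atTop (𝓝 c)) {t : ℝ}
    (ht : 0 < t) :
    Tendsto (fun N : ℕ => (N : ℝ)⁻¹ * ∑ i, ∫ d, damped (π N i) N t (h N i) d ∂P) atTop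
      (𝓝 (t * c)) := by
  -- A bound of the damping error common to all units, obtained by replacing `h` by its envelope and
  -- `N π` by its lower bound `C₁ n₀`. It is at most `t |H|` and tends to `0` pointwise.
  set B : ℕ → U → ℝ := fun N d => t * |H d| * min 1 (t * |H d| / (C₁ * expectedSize P π N))
  have hBint : ∀ N, 0 < expectedSize P π N → AEStronglyMeasurable (B N) P := by
    intro N _
    have := hH.aestronglyMeasurable.norm
    simp only [Real.norm_eq_abs] at this
    refine AEStronglyMeasurable.mul (this.const_mul t) ?_
    exact (aemeasurable_const.min
      ((this.aemeasurable.const_mul t).div_const _)).aestronglyMeasurable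
  have hBle : ∀ N, 0 < expectedSize P π N → ∀ d, 0 ≤ B N d ∧ B N d ≤ t * |H d| := by
    intro N hN d
    have hp := mul_pos hD.pos hN
    refine ⟨by positivity, mul_le_of_le_one_right (by positivity) (min_le_left _ _)⟩
  have hB0 : Tendsto (fun N => ∫ d, B N d ∂P) atTop (𝓝 0) := by
    have h1 : Tendsto (fun N => ∫ d, B N d ∂P) atTop (𝓝 (∫ _, (0 : ℝ) ∂P)) := by
      refine tendsto_integral_filter_of_dominated_convergence (fun d => t * |H d|) ?_ ?_
        (hH.abs.const_mul t) ?_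
      · filter_upwards [hD.eventually_pos] with N hN using hBint N hN.2
      · filter_upwards [hD.eventually_pos] with N hN
        refine Eventually.of_forall fun d => ?_
        rw [Real.norm_of_nonneg (hBle N hN.2 d).1]
        exact (hBle N hN.2 d).2
      · refine Eventually.of_forall fun d => ?_
        have h2 : Tendsto (fun N => t * |H d| / (C₁ * expectedSize P π N)) atTop (𝓝 0) :=
          (hD.tendsto_size.const_mul_atTop hD.pos).const_div_atTop _
        have h3 := (tendsto_const_nhds (x := (1 : ℝ))).min h2
        rw [min_eq_right zero_le_one] at h3
        simpa using h3.const_mul (t * |H d|)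
    simpa using h1
  have hdiff : Tendsto (fun N : ℕ => (N : ℝ)⁻¹ * ∑ i, ∫ d, damped (π N i) N t (h N i) d ∂P -
      t * ((N : ℝ)⁻¹ * ∑ i, ∫ d, h N i d ∂P)) atTop (𝓝 0) := by
    refine squeeze_zero_norm' ?_ hB0
    filter_upwards [hD.eventually_pos] with N hN
    have hN0 : (0 : ℝ) < N := by exact_mod_cast hN.1
    have hbd : ∀ i, |∫ d, damped (π N i) N t (h N i) d ∂P - t * ∫ d, h N i d ∂P| ≤
        ∫ d, B N d ∂P := by
      intro i
      have hae : ∀ᵐ d ∂P, 0 ≤ damped (π N i) N t (h N i) d ∧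
          damped (π N i) N t (h N i) d ≤ t * h N i d ∧
          |t * h N i d - damped (π N i) N t (h N i) d| ≤ B N d := by
        filter_upwards [hD.ae_le i hN.2, hle N i] with d hd hd2
        have hp : 0 < N * (π N i d : ℝ) := mul_pos hN0 hd.2
        have hb := damped_bounds (p := π N i) (N := N) ht.le (h0 N i d) hp
        refine ⟨hb.1, hb.2.1, hb.2.2.trans ?_⟩
        have hH' : h N i d ≤ |H d| := hd2.trans (le_abs_self _)
        have h00 := h0 N i d
        have hpp := mul_pos hD.pos hN.2
        exact mul_le_mul (mul_le_mul_of_nonneg_left hH' ht.le)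
          (min_le_min le_rfl (div_le_div₀ (by positivity) (mul_le_mul_of_nonneg_left hH' ht.le)
            hpp hd.1)) (by positivity) (by positivity)
      have hi1 : Integrable (h N i) P := by
        refine hH.mono' (hm N i).aestronglyMeasurable ?_
        filter_upwards [hle N i] with d hd
        rwa [Real.norm_of_nonneg (h0 N i d)]
      have hi2 : Integrable (damped (π N i) N t (h N i)) P := by
        refine (hi1.const_mul t).mono'
          (measurable_damped (hD.measurable N i) N t (hm N i)).aestronglyMeasurable ?_
        filter_upwards [hae] with d hd
        rw [Real.norm_of_nonneg hd.1]
        exact hd.2.1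
      rw [← integral_const_mul, ← integral_sub hi2 (hi1.const_mul t)]
      refine abs_integral_le_integral_abs.trans ?_
      refine integral_mono_ae (hi2.sub (hi1.const_mul t)).abs ?_ ?_
      · refine (hH.abs.const_mul t).mono' (hBint N hN.2) (Eventually.of_forall fun d => ?_)
        rw [Real.norm_of_nonneg (hBle N hN.2 d).1]
        exact (hBle N hN.2 d).2
      · filter_upwards [hae] with d hd
        rw [abs_sub_comm]
        exact hd.2.2
    rw [mul_left_comm, ← mul_sub, Finset.mul_sum, ← Finset.sum_sub_distrib, Real.norm_eq_abs,
      abs_mul, abs_of_pos (inv_pos.2 hN0), inv_mul_le_iff₀ hN0]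
    calc _ ≤ ∑ i, |∫ d, damped (π N i) N t (h N i) d ∂P - t * ∫ d, h N i d ∂P| :=
          Finset.abs_sum_le_sum_abs _ _
      _ ≤ ∑ _i : Fin N, ∫ d, B N d ∂P := Finset.sum_le_sum fun i _ => hbd i
      _ = _ := by simp
  simpa using hdiff.add (hc.const_mul t)

end LawOfLargeNumbers

/-! ### Weak law of large numbers for the sampling weights -/

section LawOfLargeNumbers

variable {U : Type*} [MeasurableSpace U] {P : Measure U} {π : Design U} {C₁ C₂ : ℝ}

lemma measurable_ite_snd {f : U → ℝ} (hf : Measurable f) (c : ℝ) :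
    Measurable fun z : U × Bool => if z.2 = true then f z.1 else c :=
  Measurable.ite (measurable_snd (measurableSet_singleton true)) (hf.comp measurable_fst)
    measurable_const

lemma measurable_unitInterval_coe {p : U → unitInterval} (hp : Measurable p) :
    Measurable fun d => (p d : ℝ) := measurable_subtype_coe.comp hp

lemma measurable_wMean (hπ : ∀ N i, Measurable (π N i)) {N : ℕ} {h : Fin N → U → ℝ}
    (hm : ∀ i, Measurable (h i)) :
    Measurable fun s : Outcome U N => wMean s (weight π s) h := by
  simp_rw [wMean_eq_sum]
  refine Finset.measurable_sum _ fun i _ => ?_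
  have h1 : Measurable fun d => (N : ℝ)⁻¹ * ((π N i d : ℝ)⁻¹ * h i d) := by
    have := measurable_unitInterval_coe (hπ N i)
    have := hm i
    fun_prop
  exact (measurable_ite_snd h1 0).comp (measurable_pi_apply i)

/-- The Laplace transform of a weighted mean of a nonnegative function. -/
lemma integral_exp_wMean [IsProbabilityMeasure P] (hπ : ∀ N i, Measurable (π N i)) {N : ℕ}
    (hN : 0 < N) {h : Fin N → U → ℝ} (hm : ∀ i, Measurable (h i)) (h0 : ∀ i d, 0 ≤ h i d)
    {t : ℝ} (ht : 0 ≤ t) :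
    ∫ s, Real.exp (-(t * wMean s (weight π s) h)) ∂samplingLaw P π N =
      ∏ i, (1 - (N : ℝ)⁻¹ * ∫ d, damped (π N i) N t (h i) d ∂P) := by
  have hN0 : (N : ℝ) ≠ 0 := by exact_mod_cast hN.ne'
  have := fun i => isProbabilityMeasure_unitLaw (P := P) (hπ N i)
  obtain ⟨g, hg⟩ : ∃ g : Fin N → U × Bool → ℝ, g = fun i z => if z.2 = true then
    Real.exp (-(t * ((N : ℝ)⁻¹ * ((π N i z.1 : ℝ)⁻¹ * h i z.1)))) else 1 := ⟨_, rfl⟩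
  have h1 : ∀ s : Outcome U N, Real.exp (-(t * wMean s (weight π s) h)) = ∏ i, g i (s i) := by
    intro s
    rw [hg, wMean_eq_sum, Finset.mul_sum, ← Finset.sum_neg_distrib, Real.exp_sum]
    refine Finset.prod_congr rfl fun i _ => ?_
    dsimp only
    split_ifs
    · rfl
    · simp
  simp_rw [h1]
  rw [samplingLaw_eq, integral_fintype_prod_eq_prod (f := g), hg]
  refine Finset.prod_congr rfl fun i _ => ?_
  have hp := measurable_unitInterval_coe (hπ N i)
  have hmi := hm i
  have he : Measurable fun d => Real.exp (-(t * ((N : ℝ)⁻¹ * ((π N i d : ℝ)⁻¹ * h i d)))) := by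
    fun_prop
  have hp01 : ∀ d, 0 ≤ (π N i d : ℝ) ∧ (π N i d : ℝ) ≤ 1 := fun d => (π N i d).2
  have he1 : ∀ d, Real.exp (-(t * ((N : ℝ)⁻¹ * ((π N i d : ℝ)⁻¹ * h i d)))) ≤ 1 := by
    intro d
    rw [Real.exp_le_one_iff]
    have := h0 i d
    have := (hp01 d).1
    have : 0 ≤ t * ((N : ℝ)⁻¹ * ((π N i d : ℝ)⁻¹ * h i d)) := by positivity
    linarith
  have hi1 : Integrable (fun d => (π N i d : ℝ) *
      Real.exp (-(t * ((N : ℝ)⁻¹ * ((π N i d : ℝ)⁻¹ * h i d))))) P := by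
    refine Integrable.of_bound (C := 1) (hp.mul he).aestronglyMeasurable
      (Eventually.of_forall fun d => ?_)
    rw [Real.norm_of_nonneg (mul_nonneg (hp01 d).1 (Real.exp_pos _).le)]
    exact mul_le_one₀ (hp01 d).2 (Real.exp_pos _).le (he1 d)
  have hi2 : Integrable (fun d => (π N i d : ℝ)) P := by
    refine Integrable.of_bound (C := 1) hp.aestronglyMeasurable (Eventually.of_forall fun d => ?_)
    rw [Real.norm_of_nonneg (hp01 d).1]
    exact (hp01 d).2
  rw [integral_unitLaw (hπ N i) (measurable_ite_snd he 1)]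
  · simp only [if_true, Bool.false_eq_true, if_false, mul_one]
    rw [integral_sub (integrable_const _) hi2, ← integral_const_mul]
    -- The factor of one unit is `1 - E π (1 - exp (-t h / (N π)))`; `damped` is scaled so that the
    -- second term is a mean divided by `N`.
    have h2 : ∀ d, (N : ℝ)⁻¹ * damped (π N i) N t (h i) d = (π N i d : ℝ) - (π N i d : ℝ) *
        Real.exp (-(t * ((N : ℝ)⁻¹ * ((π N i d : ℝ)⁻¹ * h i d)))) := by
      intro d
      rw [damped]
      field_simp
    simp_rw [h2]
    rw [integral_sub hi2 hi1]
    simp only [integral_const, probReal_univ, smul_eq_mul, mul_one]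
    ring
  · simpa using hi1
  · simpa using (integrable_const (1 : ℝ)).sub' hi2

/-- The weak law of large numbers for weighted means, for arrays of nonnegative functions with an
integrable envelope. -/
theorem tendsto_wMean_weight [IsProbabilityMeasure P] (hD : IsRegularDesign P π C₁ C₂)
    {h : ∀ N : ℕ, Fin N → U → ℝ} (hm : ∀ N i, Measurable (h N i)) {H : U → ℝ}
    (hH : Integrable H P) (h0 : ∀ N i d, 0 ≤ h N i d) (hle : ∀ N i, ∀ᵐ d ∂P, h N i d ≤ H d)
    {c : ℝ} (hc : Tendsto (fun N : ℕ => (N : ℝ)⁻¹ * ∑ i, ∫ d, h N i d ∂P) atTop (𝓝 c)) :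
    Tendsto (fun x : Σ N, Outcome U N => wMean x.2 (weight π x.2) (h x.1)) (sampleFilter P π)
      (𝓝 c) := by
  have hpr := fun N => isProbabilityMeasure_samplingLaw (P := P) hD.measurable N
  refine tendsto_highProb_of_laplace ?_ (Eventually.of_forall hpr) ?_ ?_
  · refine Eventually.of_forall fun N => Eventually.of_forall fun s => ?_
    refine mul_nonneg (by positivity) (Finset.sum_nonneg fun i _ => mul_nonneg ?_ (h0 _ _ _))
    exact weight_nonneg π s i
  · exact Eventually.of_forall fun N =>
      (measurable_wMean hD.measurable (hm N)).aestronglyMeasurable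
  intro t ht
  set e : ∀ N : ℕ, Fin N → ℝ := fun N i => (N : ℝ)⁻¹ * ∫ d, damped (π N i) N t (h N i) d ∂P
  have hsum : Tendsto (fun N => ∑ i, e N i) atTop (𝓝 (t * c)) := by
    simpa only [e, Finset.mul_sum] using tendsto_mean_damped hD hm hH h0 hle hc ht
  have hexp : Tendsto (fun N => ∏ i, Real.exp (-e N i)) atTop (𝓝 (Real.exp (-(t * c)))) := by
    simp_rw [← Real.exp_sum, Finset.sum_neg_distrib]
    exact (Real.continuous_exp.tendsto _).comp hsum.neg
  have hbd : ∀ᶠ N in atTop, ∀ i, 0 ≤ e N i ∧ e N i ≤ (N : ℝ)⁻¹ * (t * ∫ d, |H d| ∂P) := by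
    filter_upwards [hD.eventually_pos] with N hN i
    have hN0 : (0 : ℝ) < N := by exact_mod_cast hN.1
    have hae : ∀ᵐ d ∂P, 0 ≤ damped (π N i) N t (h N i) d ∧
        damped (π N i) N t (h N i) d ≤ t * |H d| := by
      filter_upwards [hD.ae_le i hN.2, hle N i] with d hd hd2
      have hp : 0 < N * (π N i d : ℝ) := mul_pos hN0 hd.2
      have hb := damped_bounds (p := π N i) (N := N) ht.le (h0 N i d) hp
      exact ⟨hb.1, hb.2.1.trans
        (mul_le_mul_of_nonneg_left (hd2.trans (le_abs_self _)) ht.le)⟩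
    refine ⟨mul_nonneg (by positivity) (integral_nonneg_of_ae (hae.mono fun d hd => hd.1)), ?_⟩
    refine mul_le_mul_of_nonneg_left ?_ (by positivity)
    rw [← integral_const_mul]
    exact integral_mono_of_nonneg (hae.mono fun d hd => hd.1) (hH.abs.const_mul t)
      (hae.mono fun d hd => hd.2)
  set K := t * ∫ d, |H d| ∂P
  -- Keeps each `1 - e N i` in `[0, 1]`, as the telescoping bound requires; the `N` errors of size
  -- at most `(K / N) ^ 2` then add up to `K ^ 2 / N`.
  have hsmall : ∀ᶠ N : ℕ in atTop, (N : ℝ)⁻¹ * K ≤ 1 := by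
    have : Tendsto (fun N : ℕ => (N : ℝ)⁻¹ * K) atTop (𝓝 (0 * K)) :=
      tendsto_inv_atTop_nhds_zero_nat.mul_const K
    rw [zero_mul] at this
    exact this.eventually_le_const one_pos
  have hdiff : Tendsto (fun N => ∏ i, (1 - e N i) - ∏ i, Real.exp (-e N i)) atTop (𝓝 0) := by
    have hz : Tendsto (fun N : ℕ => (N : ℝ)⁻¹ * K ^ 2) atTop (𝓝 0) := by
      simpa using tendsto_inv_atTop_nhds_zero_nat.mul_const (K ^ 2)
    refine squeeze_zero_norm' ?_ hz
    filter_upwards [hbd, hsmall, hD.eventually_pos] with N hb hs hN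
    have hN0 : (0 : ℝ) < N := by exact_mod_cast hN.1
    refine (norm_prod_sub_prod_le _ _ _ ?_ ?_).trans ?_
    · intro i _
      rw [Real.norm_eq_abs, abs_le]
      constructor <;> linarith [hb i]
    · intro i _
      rw [Real.norm_eq_abs, Real.abs_exp, Real.exp_le_one_iff]
      linarith [hb i]
    · have h3 : ∀ i, ‖1 - e N i - Real.exp (-e N i)‖ ≤ ((N : ℝ)⁻¹ * K) ^ 2 := by
        intro i
        have h4 := Real.abs_exp_sub_one_sub_id_le (x := -e N i) (by
          rw [abs_neg, abs_of_nonneg (hb i).1]; linarith [hb i])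
        rw [norm_sub_rev, Real.norm_eq_abs,
          show Real.exp (-e N i) - (1 - e N i) = Real.exp (-e N i) - 1 - -e N i by ring]
        refine h4.trans ?_
        rw [neg_sq]
        exact pow_le_pow_left₀ (hb i).1 (hb i).2 2
      calc _ ≤ ∑ _i : Fin N, ((N : ℝ)⁻¹ * K) ^ 2 := Finset.sum_le_sum fun i _ => h3 i
        _ = (N : ℝ)⁻¹ * K ^ 2 := by
          simp only [Finset.sum_const, Finset.card_univ, Fintype.card_fin, nsmul_eq_mul]
          field_simp
  have hfin := hdiff.add hexp
  rw [zero_add] at hfin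
  refine hfin.congr' ?_
  filter_upwards [hD.eventually_pos] with N hN
  rw [integral_exp_wMean hD.measurable hN.1 (hm N) (h0 N) ht.le]
  ring

lemma tendsto_mean_const {h : U → ℝ} :
    Tendsto (fun N : ℕ => (N : ℝ)⁻¹ * ∑ _i : Fin N, ∫ d, h d ∂P) atTop (𝓝 (∫ d, h d ∂P)) := by
  refine tendsto_nhds_of_eventually_eq ?_
  filter_upwards [eventually_gt_atTop 0] with N hN
  have : (N : ℝ) ≠ 0 := by exact_mod_cast hN.ne'
  simp [this]

/-- The Laplace argument needs a sign, so positive and negative parts are treated separately. -/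
theorem tendsto_wMean_weight_of_integrable [IsProbabilityMeasure P]
    (hD : IsRegularDesign P π C₁ C₂) {h : U → ℝ} (hm : Measurable h) (hh : Integrable h P) :
    Tendsto (fun x : Σ N, Outcome U N => wMean x.2 (weight π x.2) (fun _ => h))
      (sampleFilter P π) (𝓝 (∫ d, h d ∂P)) := by
  have h1 := tendsto_wMean_weight hD (h := fun _ _ d => max (h d) 0)
    (fun _ _ => hm.max measurable_const) hh.pos_part (fun _ _ _ => le_max_right _ _)
    (fun _ _ => Eventually.of_forall fun _ => le_rfl) tendsto_mean_const
  have h2 := tendsto_wMean_weight hD (h := fun _ _ d => max (-h d) 0)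
    (fun _ _ => hm.neg.max measurable_const) hh.neg_part (fun _ _ _ => le_max_right _ _)
    (fun _ _ => Eventually.of_forall fun _ => le_rfl) tendsto_mean_const
  have h3 := h1.sub h2
  rw [← integral_sub hh.pos_part hh.neg_part] at h3
  have h4 : ∀ d, max (h d) 0 - max (-h d) 0 = h d := fun d => max_zero_sub_eq_self (h d)
  simp_rw [← wMean_sub, h4] at h3
  exact h3

/-- The properties of the sample, holding with probability tending to one, that make the bootstrap
distribution well behaved. -/
lemma eventually_sample_good [IsProbabilityMeasure P] (hD : IsRegularDesign P π C₁ C₂)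
    {r : U → Prop} (hr : ∀ᵐ d ∂P, r d) :
    ∀ᶠ x : Σ N, Outcome U N in sampleFilter P π, 0 < x.1 ∧ 0 < expectedSize P π x.1 ∧
      (∀ i, C₁ * expectedSize P π x.1 ≤ x.1 * (inclProb π x.2 i : ℝ) ∧
        0 < (inclProb π x.2 i : ℝ) ∧ r (x.2 i).1) ∧
      0 < ∑ i ∈ sample x.2, weight π x.2 i := by
  have h1 := tendsto_wMean_weight_of_integrable hD (h := fun _ => (1 : ℝ)) measurable_const
    (integrable_const _)
  simp only [integral_const, probReal_univ, smul_eq_mul, mul_one] at h1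
  have h2 : ∀ᶠ x : Σ N, Outcome U N in sampleFilter P π,
      ∀ i, C₁ * expectedSize P π x.1 ≤ x.1 * (inclProb π x.2 i : ℝ) ∧
        0 < (inclProb π x.2 i : ℝ) ∧ r (x.2 i).1 := by
    refine eventually_highProb_of_ae ?_
    filter_upwards [hD.eventually_pos] with N hN
    refine ae_samplingLaw hD.measurable (r := fun i d =>
      C₁ * expectedSize P π N ≤ N * (π N i d : ℝ) ∧ 0 < (π N i d : ℝ) ∧ r d) fun i => ?_
    filter_upwards [hD.ae_le i hN.2, hr] with d hd hd2 using ⟨hd.1, hd.2, hd2⟩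
  -- The total weight divided by `N` tends to `1`, hence is eventually positive.
  filter_upwards [h2, h1.eventually_const_lt one_pos,
    tendsto_fst_highProb.eventually hD.eventually_pos] with x hx1 hx2 hx3
  refine ⟨hx3.1, hx3.2, hx1, ?_⟩
  simp only [wMean, mul_one] at hx2
  have : (0 : ℝ) < (x.1 : ℝ)⁻¹ := by
    have := hx3.1
    positivity
  exact pos_of_mul_pos_right hx2 this.le

end LawOfLargeNumbers

/-! ### Conditional law of large numbers for the bootstrap weights -/

section BootstrapLaw

variable {U : Type*} {π : Design U}

/-- The conditional Laplace transform is exactly `(1 - S / W) ^ N`, where `S` is the weighted mean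
of the damped function: `N⁻¹ w_i` times `damped` is `1 - exp (τ_i)`. The error is that of
`norm_pow_sub_exp_le`. -/
lemma integral_exp_wMean_bootLaw {N : ℕ} (hN : 0 < N) {s : Outcome U N} {h : U → ℝ}
    (hh : ∀ d, 0 ≤ h d) (h0 : 0 < ∑ j ∈ sample s, weight π s j)
    (hπ : ∀ i, 0 < (inclProb π s i : ℝ)) {t : ℝ} (ht : 0 ≤ t) :
    |∫ m, Real.exp (-(t * wMean s (bootWeight π s m) (fun _ => h))) ∂bootLaw π s -
      Real.exp (-(wMean s (weight π s) (fun i => damped (π N i) N t h) *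
        ((N : ℝ)⁻¹ * ∑ j ∈ sample s, weight π s j)⁻¹))| ≤
      2 * (wMean s (weight π s) (fun i => damped (π N i) N t h) *
        ((N : ℝ)⁻¹ * ∑ j ∈ sample s, weight π s j)⁻¹) ^ 2 * (N : ℝ)⁻¹ := by
  have hN0 : (N : ℝ) ≠ 0 := by exact_mod_cast hN.ne'
  set W := ∑ j ∈ sample s, weight π s j
  set S := wMean s (weight π s) (fun i => damped (π N i) N t h) with hS
  set τ : Fin N → ℝ := fun i => -(t * ((N : ℝ)⁻¹ * (weight π s i * h (s i).1)))
  have hτ : ∀ i ∈ sample s, ((τ i : ℂ)).re ≤ 0 := by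
    intro i _
    have h1 := weight_nonneg π s i
    have h2 := hh (s i).1
    have : 0 ≤ t * ((N : ℝ)⁻¹ * (weight π s i * h (s i).1)) := by positivity
    rw [Complex.ofReal_re]
    simp only [τ]
    linarith
  have hSs : ∑ i ∈ sample s, (Complex.exp (τ i) - 1) = ((-S : ℝ) : ℂ) := by
    rw [hS, wMean, Finset.mul_sum, ← Finset.sum_neg_distrib, Complex.ofReal_sum]
    refine Finset.sum_congr rfl fun i _ => ?_
    rw [← Complex.ofReal_exp, ← Complex.ofReal_one, ← Complex.ofReal_sub]
    congr 1
    have hp := (hπ i).ne'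
    change (π N i (s i).1 : ℝ) ≠ 0 at hp
    simp only [damped, τ, weight, inclProb]
    field_simp
    ring
  have hz : (1 + (W : ℂ)⁻¹ * ∑ i ∈ sample s, (Complex.exp (τ i) - 1)) =
      ((1 - W⁻¹ * S : ℝ) : ℂ) := by
    rw [hSs]
    push_cast
    ring
  have hn := norm_one_add_bootLaw_le h0.ne' (fun i _ => (hπ i).ne') (fun i => (τ i : ℂ)) hτ
  have hI := integral_exp_bootLaw h0.ne' (fun i _ => (hπ i).ne') (fun i => (τ i : ℂ)) hτ
  have hI2 : ∫ m, Complex.exp (∑ i ∈ sample s, m i * (τ i : ℂ)) ∂bootLaw π s =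
      ((∫ m, Real.exp (-(t * wMean s (bootWeight π s m) (fun _ => h))) ∂bootLaw π s : ℝ) : ℂ) := by
    rw [← integral_complex_ofReal]
    refine integral_congr_ae (Eventually.of_forall fun m => ?_)
    simp only
    rw [Complex.ofReal_exp]
    congr 1
    rw [wMean, Finset.mul_sum, Finset.mul_sum, ← Finset.sum_neg_distrib, Complex.ofReal_sum]
    refine Finset.sum_congr rfl fun i _ => ?_
    simp only [τ, bootWeight]
    push_cast
    ring
  have hW : (N : ℂ) * (((1 - W⁻¹ * S : ℝ) : ℂ) - 1) = ((-(S * ((N : ℝ)⁻¹ * W)⁻¹) : ℝ) : ℂ) := by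
    have hN1 : (N : ℂ) ≠ 0 := by exact_mod_cast hN.ne'
    rw [mul_inv, inv_inv]
    push_cast
    ring
  rw [hz] at hI hn
  have hfin := norm_pow_sub_exp_le N hn
  rw [← hI, hI2, hW, ← Complex.ofReal_exp, ← Complex.ofReal_sub, Complex.norm_real,
    Real.norm_eq_abs] at hfin
  refine hfin.trans (le_of_eq ?_)
  rw [← Complex.ofReal_one, ← Complex.ofReal_sub, Complex.norm_real, Real.norm_eq_abs, sq_abs,
    mul_inv, inv_inv]
  have hW0 := h0.ne'
  field_simp
  ring

variable [MeasurableSpace U] {P : Measure U} {C₁ C₂ : ℝ}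

/-- The filter of the events whose conditional bootstrap probability tends to one in
probability. -/
def bootFilter (P : Measure U) (π : Design U) :
    Filter (Σ x : (Σ N, Outcome U N), (Fin x.1 → ℕ)) :=
  highProb (sampleFilter P π) (fun x => bootLaw π x.2)

lemma tendsto_inv_size : Tendsto (fun x : Σ N, Outcome U N => (x.1 : ℝ)⁻¹) (sampleFilter P π)
    (𝓝 0) :=
  tendsto_inv_atTop_nhds_zero_nat.comp tendsto_fst_highProb

lemma eventually_isProbabilityMeasure_bootLaw [IsProbabilityMeasure P]
    (hD : IsRegularDesign P π C₁ C₂) :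
    ∀ᶠ x : Σ N, Outcome U N in sampleFilter P π, IsProbabilityMeasure (bootLaw π x.2) := by
  filter_upwards [eventually_sample_good hD (r := fun _ => True) (by simp)] with x hx
  exact isProbabilityMeasure_bootLaw hx.2.2.2.ne' fun i _ => (hx.2.2.1 i).2.1.ne'

lemma tendsto_totalWeight [IsProbabilityMeasure P] (hD : IsRegularDesign P π C₁ C₂) :
    Tendsto (fun x : Σ N, Outcome U N => (x.1 : ℝ)⁻¹ * ∑ i ∈ sample x.2, weight π x.2 i)
      (sampleFilter P π) (𝓝 1) := by
  have h1 := tendsto_wMean_weight_of_integrable hD (h := fun _ => (1 : ℝ)) measurable_const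
    (integrable_const _)
  simpa [wMean] using h1

/-- The Laplace criterion one level up: the conditional transforms are governed by weighted means of
damped functions under the sampling weights, whose limit is `t ∫ h` by the unconditional law for
arrays. -/
theorem tendsto_wMean_bootWeight [IsProbabilityMeasure P] (hD : IsRegularDesign P π C₁ C₂)
    {h : U → ℝ} (hm : Measurable h) (hh : Integrable h P) (h0 : ∀ d, 0 ≤ h d) :
    Tendsto (fun z : Σ x : (Σ N, Outcome U N), (Fin x.1 → ℕ) =>
      wMean z.1.2 (bootWeight π z.1.2 z.2) (fun _ => h)) (bootFilter P π) (𝓝 (∫ d, h d ∂P)) := by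
  refine tendsto_highProb_of_laplace ?_ (eventually_isProbabilityMeasure_bootLaw hD) ?_ ?_
  · refine Eventually.of_forall fun x => Eventually.of_forall fun m => ?_
    refine mul_nonneg (by positivity) (Finset.sum_nonneg fun i _ => mul_nonneg ?_ (h0 _))
    exact mul_nonneg (weight_nonneg π x.2 i) (Nat.cast_nonneg _)
  · exact Eventually.of_forall fun x => (Measurable.of_discrete).aestronglyMeasurable
  intro t ht
  have hgood := eventually_sample_good hD (r := fun _ => True) (by simp)
  have hle : ∀ N i, 0 < N → 0 < expectedSize P π N →
      ∀ᵐ d ∂P, 0 ≤ damped (π N i) N t h d ∧ damped (π N i) N t h d ≤ t * h d := by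
    intro N i hN hn
    filter_upwards [hD.ae_le i hn] with d hd
    have hb := damped_bounds (p := π N i) (N := N) ht.le (h0 d)
      (mul_pos (by exact_mod_cast hN) hd.2)
    exact ⟨hb.1, hb.2.1⟩
  -- `tendsto_wMean_weight` wants nonnegativity everywhere and an envelope for every `N`, while the
  -- bounds on `damped` hold only almost everywhere and for large `N`. Clipping to `[0, t h]`
  -- changes nothing that matters.
  have hcut : ∀ N i, ∀ᵐ d ∂P, 0 < N → 0 < expectedSize P π N →
      max (min (damped (π N i) N t h d) (t * h d)) 0 = damped (π N i) N t h d := by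
    intro N i
    by_cases hc : 0 < N ∧ 0 < expectedSize P π N
    · filter_upwards [hle N i hc.1 hc.2] with d hd _ _
      rw [min_eq_left hd.2, max_eq_left hd.1]
    · exact Eventually.of_forall fun d h1 h2 => absurd ⟨h1, h2⟩ hc
  have hS := tendsto_wMean_weight hD
    (h := fun N i d => max (min (damped (π N i) N t h d) (t * h d)) 0) (H := fun d => t * h d)
    (c := t * ∫ d, h d ∂P)
    (fun N i => ((measurable_damped (hD.measurable N i) N t hm).min (hm.const_mul t)).max
      measurable_const) (hh.const_mul t) (fun _ _ _ => le_max_right _ _)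
    (fun N i => Eventually.of_forall fun d => max_le (min_le_right _ _) (mul_nonneg ht.le (h0 d)))
    (by
      refine (tendsto_mean_damped hD (h := fun _ _ => h) (fun _ _ => hm) hh (fun _ _ => h0)
        (fun _ _ => Eventually.of_forall fun _ => le_rfl) tendsto_mean_const ht).congr' ?_
      filter_upwards [hD.eventually_pos] with N hN
      congr 1
      refine Finset.sum_congr rfl fun i _ => integral_congr_ae ?_
      filter_upwards [hcut N i] with d hd
      exact (hd hN.1 hN.2).symm)
  have hS' : Tendsto (fun x : Σ N, Outcome U N => wMean x.2 (weight π x.2)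
      (fun i => damped (π x.1 i) x.1 t h)) (sampleFilter P π) (𝓝 (t * ∫ d, h d ∂P)) := by
    have hae : ∀ᶠ x : Σ N, Outcome U N in sampleFilter P π, ∀ i,
        (0 < x.1 → 0 < expectedSize P π x.1 →
      max (min (damped (π x.1 i) x.1 t h (x.2 i).1) (t * h (x.2 i).1)) 0 =
        damped (π x.1 i) x.1 t h (x.2 i).1) :=
      eventually_highProb_of_ae (Eventually.of_forall fun N =>
        ae_samplingLaw hD.measurable (r := fun i d => 0 < N → 0 < expectedSize P π N →
      max (min (damped (π N i) N t h d) (t * h d)) 0 = damped (π N i) N t h d) (hcut N))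
    refine hS.congr' ?_
    filter_upwards [hae, hgood] with x hx hg
    rw [wMean, wMean]
    congr 1
    refine Finset.sum_congr rfl fun i _ => ?_
    rw [hx i hg.1 hg.2.1]
  have hR := hS'.mul ((tendsto_totalWeight hD).inv₀ one_ne_zero)
  rw [inv_one, mul_one] at hR
  have hE := (Real.continuous_exp.tendsto _).comp hR.neg
  have hB := ((hR.pow 2).const_mul 2).mul (tendsto_inv_size (P := P) (π := π))
  rw [mul_zero] at hB
  have hdiff : Tendsto (fun x : Σ N, Outcome U N =>
      ∫ m, Real.exp (-(t * wMean x.2 (bootWeight π x.2 m) (fun _ => h))) ∂bootLaw π x.2 -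
      Real.exp (-(wMean x.2 (weight π x.2) (fun i => damped (π x.1 i) x.1 t h) *
        ((x.1 : ℝ)⁻¹ * ∑ j ∈ sample x.2, weight π x.2 j)⁻¹))) (sampleFilter P π) (𝓝 0) := by
    refine squeeze_zero_norm' ?_ hB
    filter_upwards [hgood] with x hx
    exact integral_exp_wMean_bootLaw hx.1 h0 hx.2.2.2 (fun i => (hx.2.2.1 i).2.1) ht.le
  have hfin := hdiff.add hE
  rw [zero_add] at hfin
  refine hfin.congr fun x => ?_
  simp only [Function.comp_apply]
  ring

theorem tendsto_wMean_bootWeight_of_integrable [IsProbabilityMeasure P]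
    (hD : IsRegularDesign P π C₁ C₂) {h : U → ℝ} (hm : Measurable h) (hh : Integrable h P) :
    Tendsto (fun z : Σ x : (Σ N, Outcome U N), (Fin x.1 → ℕ) =>
      wMean z.1.2 (bootWeight π z.1.2 z.2) (fun _ => h)) (bootFilter P π) (𝓝 (∫ d, h d ∂P)) := by
  have h1 := tendsto_wMean_bootWeight hD (h := fun d => max (h d) 0) (hm.max measurable_const)
    hh.pos_part (fun _ => le_max_right _ _)
  have h2 := tendsto_wMean_bootWeight hD (h := fun d => max (-h d) 0)
    (hm.neg.max measurable_const) hh.neg_part (fun _ => le_max_right _ _)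
  have h3 := h1.sub h2
  rw [← integral_sub hh.pos_part hh.neg_part] at h3
  have h4 : ∀ d, max (h d) 0 - max (-h d) 0 = h d := fun d => max_zero_sub_eq_self (h d)
  simp_rw [← wMean_sub, h4] at h3
  exact h3

end BootstrapLaw

/-! ### Second moments of weighted means -/

section SecondMoments

variable {U : Type*} [MeasurableSpace U] {P : Measure U} {π : Design U} {C₁ C₂ : ℝ}

lemma expectedSize_nonneg (P : Measure U) (π : Design U) (N : ℕ) : 0 ≤ expectedSize P π N :=
  Finset.sum_nonneg fun i _ => integral_nonneg fun d => (π N i d).2.1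

/-- The mean and the variance of a weighted mean of a centred function. -/
lemma variance_wMean [IsProbabilityMeasure P] (hD : IsRegularDesign P π C₁ C₂) {N : ℕ}
    (hn : 0 < expectedSize P π N) {φ : U → ℝ} (hm : Measurable φ)
    (h2 : Integrable (fun d => φ d ^ 2) P) (hφ : ∫ d, φ d ∂P = 0) :
    MemLp (fun s : Outcome U N => wMean s (weight π s) (fun _ => φ)) 2 (samplingLaw P π N) ∧
    ∫ s : Outcome U N, wMean s (weight π s) (fun _ => φ) ∂samplingLaw P π N = 0 ∧
    Var[fun s : Outcome U N => wMean s (weight π s) (fun _ => φ); samplingLaw P π N] =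
      ∑ i : Fin N, ∫ d, (N : ℝ)⁻¹ * ((N : ℝ)⁻¹ * ((π N i d : ℝ)⁻¹ * φ d ^ 2)) ∂P := by
  have hpr := fun i => isProbabilityMeasure_unitLaw (P := P) (hD.measurable N i)
  have hφ1 : Integrable φ P :=
    ((memLp_two_iff_integrable_sq hm.aestronglyMeasurable).2 h2).integrable (by norm_num)
  set X : Fin N → U × Bool → ℝ := fun i z =>
    if z.2 = true then (N : ℝ)⁻¹ * ((π N i z.1 : ℝ)⁻¹ * φ z.1) else 0 with hX
  have hXm : ∀ i, Measurable (X i) := by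
    intro i
    have hp := measurable_unitInterval_coe (hD.measurable N i)
    exact measurable_ite_snd (f := fun d => (N : ℝ)⁻¹ * ((π N i d : ℝ)⁻¹ * φ d))
      (by fun_prop) 0
  -- Selection has probability `π` and the squared weight is `π⁻²`, so one factor `π⁻¹` survives; in
  -- the mean (`hlin`) none does, which makes the estimator unbiased.
  have hsq : ∀ i, ∀ᵐ d ∂P, (π N i d : ℝ) * (X i (d, true)) ^ 2 =
      (N : ℝ)⁻¹ * ((N : ℝ)⁻¹ * ((π N i d : ℝ)⁻¹ * φ d ^ 2)) := by
    intro i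
    filter_upwards [hD.ae_le i hn] with d hd
    have hp := hd.2.ne'
    simp only [hX, if_true]
    field_simp
  have hlin : ∀ i, ∀ᵐ d ∂P, (π N i d : ℝ) * X i (d, true) = (N : ℝ)⁻¹ * φ d := by
    intro i
    filter_upwards [hD.ae_le i hn] with d hd
    have hp := hd.2.ne'
    simp only [hX, if_true]
    field_simp
  have hint2 : ∀ i, Integrable
      (fun d => (N : ℝ)⁻¹ * ((N : ℝ)⁻¹ * ((π N i d : ℝ)⁻¹ * φ d ^ 2))) P := by
    intro i
    refine Integrable.const_mul ?_ _
    refine (h2.const_mul (C₁ * expectedSize P π N)⁻¹).mono' ?_ ?_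
    · have hp := measurable_unitInterval_coe (hD.measurable N i)
      exact Measurable.aestronglyMeasurable (by fun_prop)
    · filter_upwards [hD.ae_le i hn] with d hd
      have hc := mul_pos hD.pos hn
      have hN : (0 : ℝ) < N := by
        have := i.pos
        exact_mod_cast this
      have h3 : (N : ℝ)⁻¹ * (π N i d : ℝ)⁻¹ ≤ (C₁ * expectedSize P π N)⁻¹ := by
        rw [← mul_inv]
        exact inv_anti₀ hc hd.1
      have hp := hd.2
      rw [Real.norm_of_nonneg (by positivity), ← mul_assoc]
      exact mul_le_mul_of_nonneg_right h3 (sq_nonneg _)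
  have hi1 : ∀ i, Integrable (X i) (unitLaw P (π N i)) := fun i =>
    integrable_unitLaw (hD.measurable N i) (hXm i)
      ((hφ1.const_mul _).congr ((hlin i).mono fun d hd => hd.symm)) (by simp [hX])
  have hi2 : ∀ i, MemLp (X i) 2 (unitLaw P (π N i)) := fun i =>
    (memLp_two_iff_integrable_sq (hXm i).aestronglyMeasurable).2
      (integrable_unitLaw (hD.measurable N i) (f := fun z => X i z ^ 2) ((hXm i).pow_const 2)
      ((hint2 i).congr ((hsq i).mono fun d hd => hd.symm)) (by simp [hX]))
  have hmean : ∀ i, ∫ z, X i z ∂unitLaw P (π N i) = 0 := by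
    intro i
    rw [integral_unitLaw (hD.measurable N i) (hXm i)
      ((hφ1.const_mul _).congr ((hlin i).mono fun d hd => hd.symm)) (by simp [hX]),
      integral_congr_ae (hlin i), integral_const_mul, hφ]
    simp [hX]
  have hvar : ∀ i, Var[X i; unitLaw P (π N i)] =
      ∫ d, (N : ℝ)⁻¹ * ((N : ℝ)⁻¹ * ((π N i d : ℝ)⁻¹ * φ d ^ 2)) ∂P := by
    intro i
    rw [variance_of_integral_eq_zero (hXm i).aemeasurable (hmean i)]
    rw [integral_unitLaw (hD.measurable N i) (f := fun z => X i z ^ 2) ((hXm i).pow_const 2)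
      ((hint2 i).congr ((hsq i).mono fun d hd => hd.symm)) (by simp [hX]),
      integral_congr_ae (hsq i)]
    simp [hX]
  have hsum : (fun s : Outcome U N => wMean s (weight π s) (fun _ => φ)) =
      fun s => ∑ i, X i (s i) := by
    funext s
    rw [wMean_eq_sum]
    rfl
  have hmemi : ∀ i, MemLp (fun s : Outcome U N => X i (s i)) 2 (samplingLaw P π N) := fun i =>
    (hi2 i).comp_measurePreserving (measurePreserving_eval (fun i => unitLaw P (π N i)) i)
  have hpr' := isProbabilityMeasure_samplingLaw (P := P) hD.measurable N
  refine ⟨?_, ?_, ?_⟩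
  · rw [hsum]
    exact memLp_finsetSum _ fun i _ => hmemi i
  · simp_rw [congrFun hsum]
    rw [integral_finsetSum _ fun i _ => (hmemi i).integrable (by norm_num)]
    refine Finset.sum_eq_zero fun i _ => ?_
    rw [← hmean i, samplingLaw_eq]
    exact integral_comp_eval (hXm i).aestronglyMeasurable
  · rw [hsum, ← Finset.sum_congr rfl fun i _ => hvar i, samplingLaw_eq, ← variance_sum_pi hi2]
    congr 1
    funext s
    simp

/-- The weighted mean of squares that estimates the variance of a weighted mean. -/
lemma tendsto_wMean_sq [IsProbabilityMeasure P] (hD : IsRegularDesign P π C₁ C₂)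
    {φ : U → ℝ} (hm : Measurable φ) (h2 : Integrable (fun d => φ d ^ 2) P)
    (hφ : ∫ d, φ d ∂P = 0) {v : ℝ}
    (hv : Tendsto (fun N => expectedSize P π N *
      Var[fun s : Outcome U N => wMean s (weight π s) (fun _ => φ); samplingLaw P π N])
      atTop (𝓝 v)) :
    Tendsto (fun x : Σ N, Outcome U N => wMean x.2 (weight π x.2)
      (fun i d => expectedSize P π x.1 * ((x.1 : ℝ)⁻¹ * ((π x.1 i d : ℝ)⁻¹ * φ d ^ 2))))
      (sampleFilter P π) (𝓝 v) := by
  have hn0 := expectedSize_nonneg P π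
  refine tendsto_wMean_weight hD
    -- The average over units of the means of these functions is exactly `n₀` times the variance, so
    -- its limit is the given one. The envelope comes from `n₀ / (N π) ≤ C₁⁻¹`.
    (h := fun N i d => expectedSize P π N * ((N : ℝ)⁻¹ * ((π N i d : ℝ)⁻¹ * φ d ^ 2)))
    (H := fun d => C₁⁻¹ * φ d ^ 2) ?_ (h2.const_mul _) ?_ ?_ ?_
  · intro N i
    have hp := measurable_unitInterval_coe (hD.measurable N i)
    fun_prop
  · intro N i d
    have := (π N i d).2.1
    have := hn0 N
    positivity
  · intro N i
    rcases (hn0 N).eq_or_lt with h | h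
    · refine Eventually.of_forall fun d => ?_
      have := hD.pos
      rw [← h, zero_mul]
      positivity
    · filter_upwards [hD.ae_le i h] with d hd
      have hN : (0 : ℝ) < N := by
        have := i.pos
        exact_mod_cast this
      have hp := hd.2
      rw [← mul_assoc, ← mul_assoc]
      refine mul_le_mul_of_nonneg_right ?_ (sq_nonneg _)
      rw [mul_assoc, ← mul_inv, ← div_eq_mul_inv, div_le_iff₀ (by positivity)]
      have hc := hD.pos
      rw [inv_mul_eq_div, le_div_iff₀ hc, mul_comm]
      exact hd.1
  · refine hv.congr' ?_
    filter_upwards [hD.eventually_pos] with N hN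
    rw [(variance_wMean hD hN.2 hm h2 hφ).2.2, Finset.mul_sum, Finset.mul_sum]
    refine Finset.sum_congr rfl fun i _ => ?_
    simp only [integral_const_mul]
    ring

end SecondMoments

/-! ### Characteristic function of the bootstrap score: exact formula and Poisson approximation -/

section CentralLimit

/-- A cubic remainder for all `x`, so that no truncation is needed: for `|x| > 1` the four terms are
bounded by `1 + 1 + |x| + |x| ^ 2 / 2 ≤ 4 |x| ^ 3`. -/
lemma norm_exp_I_taylor_two_le (x : ℝ) :
    ‖Complex.exp (x * Complex.I) - 1 - x * Complex.I + x ^ 2 / 2‖ ≤ 4 * |x| ^ 3 := by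
  have hxI : ‖(x : ℂ) * Complex.I‖ = |x| := by simp
  by_cases h : |x| ≤ 1
  · have h1 := Complex.exp_bound (x := x * Complex.I) (by rw [hxI]; exact h) (n := 3) (by norm_num)
    rw [hxI] at h1
    have h2 : Complex.exp (x * Complex.I) - 1 - x * Complex.I + x ^ 2 / 2 =
        Complex.exp (x * Complex.I) -
          ∑ m ∈ Finset.range 3, (x * Complex.I) ^ m / (m.factorial : ℂ) := by
      simp [Finset.sum_range_succ, mul_pow]
      ring
    rw [h2]
    refine h1.trans ?_
    have h3 : (0 : ℝ) ≤ |x| ^ 3 := by positivity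
    norm_num [Nat.factorial]
    linarith
  · push Not at h
    have h1 : ‖Complex.exp (x * Complex.I)‖ = 1 := Complex.norm_exp_ofReal_mul_I x
    have h2 : ‖(x : ℂ) ^ 2 / 2‖ = |x| ^ 2 / 2 := by simp
    calc _ ≤ ‖Complex.exp (x * Complex.I)‖ + ‖(1 : ℂ)‖ + ‖(x : ℂ) * Complex.I‖ +
          ‖(x : ℂ) ^ 2 / 2‖ :=
          (norm_add_le _ _).trans (add_le_add_left ((norm_sub_le _ _).trans
            (add_le_add_left (norm_sub_le _ _) _)) _)
      _ = 1 + 1 + |x| + |x| ^ 2 / 2 := by rw [h1, hxI, h2, norm_one]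
      _ ≤ 4 * |x| ^ 3 := by nlinarith [pow_pos (zero_lt_one.trans h) 2]

variable {U : Type*} {ι : Type*}

/-- The weighted mean `N⁻¹ ∑_{i ∈ A} v_i u(d_i)` of a vector valued function. -/
def vMean {N : ℕ} (s : Outcome U N) (v : Fin N → ℝ) (u : U → EuclideanSpace ℝ ι) :
    EuclideanSpace ℝ ι :=
  (N : ℝ)⁻¹ • ∑ i ∈ sample s, v i • u (s i).1

lemma vMean_apply {N : ℕ} (s : Outcome U N) (v : Fin N → ℝ) (u : U → EuclideanSpace ℝ ι) (j : ι) :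
    vMean s v u j = wMean s v (fun _ d => u d j) := by
  simp [vMean, wMean]

variable [Fintype ι]

lemma inner_vMean {N : ℕ} (s : Outcome U N) (v : Fin N → ℝ) (u : U → EuclideanSpace ℝ ι)
    (a : EuclideanSpace ℝ ι) :
    inner ℝ (vMean s v u) a = ∑ i ∈ sample s, (N : ℝ)⁻¹ * (v i * inner ℝ (u (s i).1) a) := by
  simp only [vMean, real_inner_smul_left, sum_inner, Finset.mul_sum]

variable {π : Design U} {N : ℕ} {s : Outcome U N}

/-- The characteristic function of the centred bootstrap mean. -/
lemma charFun_map_bootLaw (u : U → EuclideanSpace ℝ ι) (r : ℝ)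
    (h0 : ∑ j ∈ sample s, weight π s j ≠ 0)
    (hπ : ∀ i ∈ sample s, (inclProb π s i : ℝ) ≠ 0) (a : EuclideanSpace ℝ ι) (τ : Fin N → ℝ)
    (hτ : τ = fun i => r * ((N : ℝ)⁻¹ * (weight π s i * inner ℝ (u (s i).1) a))) :
    charFun ((bootLaw π s).map
      (fun m => r • (vMean s (bootWeight π s m) u - vMean s (weight π s) u))) a =
      Complex.exp (-((∑ i ∈ sample s, τ i : ℝ) : ℂ) * Complex.I) *
      (1 + ((∑ j ∈ sample s, weight π s j : ℝ) : ℂ)⁻¹ *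
        ∑ i ∈ sample s, (Complex.exp (τ i * Complex.I) - 1)) ^ N := by
  rw [charFun_apply, integral_map (Measurable.of_discrete).aemeasurable
    (Measurable.aestronglyMeasurable (by fun_prop)),
    ← integral_exp_bootLaw h0 hπ (fun i => τ i * Complex.I) (fun i _ => by simp),
    ← integral_const_mul]
  refine integral_congr_ae (Eventually.of_forall fun m => ?_)
  simp only
  rw [← Complex.exp_add]
  congr 1
  rw [real_inner_smul_left, inner_sub_left, inner_vMean, inner_vMean, mul_sub, Finset.mul_sum,
    Finset.mul_sum, hτ]
  push_cast
  rw [sub_mul, Finset.sum_mul, neg_mul, neg_add_eq_sub]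
  congr 1
  refine Finset.sum_congr rfl fun i _ => ?_
  rw [bootWeight]
  push_cast
  ring

/-- Cost of passing from the multinomial law to the compound Poisson law with intensity `N / W`: it
is `norm_pow_sub_exp_le` combined with `|exp (i τ) - 1| ≤ |τ|`. -/
lemma norm_bootLaw_sub_exp_le (hN : 0 < N) (h0 : 0 < ∑ j ∈ sample s, weight π s j)
    (hπ : ∀ i ∈ sample s, (inclProb π s i : ℝ) ≠ 0) (τ : Fin N → ℝ) :
    ‖(1 + ((∑ j ∈ sample s, weight π s j : ℝ) : ℂ)⁻¹ *
        ∑ i ∈ sample s, (Complex.exp (τ i * Complex.I) - 1)) ^ N -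
      Complex.exp (((((N : ℝ)⁻¹ * ∑ j ∈ sample s, weight π s j)⁻¹ : ℝ) : ℂ) *
        ∑ i ∈ sample s, (Complex.exp (τ i * Complex.I) - 1))‖ ≤
    2 * (((N : ℝ)⁻¹ * ∑ j ∈ sample s, weight π s j)⁻¹) ^ 2 *
      ((N : ℝ)⁻¹ * (∑ i ∈ sample s, |τ i|) ^ 2) := by
  have hN0 : (N : ℝ) ≠ 0 := by exact_mod_cast hN.ne'
  have hN1 : (N : ℂ) ≠ 0 := by exact_mod_cast hN.ne'
  have hn := norm_one_add_bootLaw_le h0.ne' hπ (fun i => τ i * Complex.I) (fun i _ => by simp)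
  have h1 := norm_pow_sub_exp_le N hn
  set W := ∑ j ∈ sample s, weight π s j
  set S := ∑ i ∈ sample s, (Complex.exp (τ i * Complex.I) - 1) with hS
  have h2 : ‖S‖ ≤ ∑ i ∈ sample s, |τ i| := by
    refine (norm_sum_le _ _).trans (Finset.sum_le_sum fun i _ => ?_)
    have := Real.norm_exp_I_mul_ofReal_sub_one_le (x := τ i)
    rwa [mul_comm Complex.I, Real.norm_eq_abs] at this
  rw [add_sub_cancel_left] at h1
  have h3 : (N : ℂ) * ((W : ℂ)⁻¹ * S) = ((((N : ℝ)⁻¹ * W)⁻¹ : ℝ) : ℂ) * S := by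
    rw [mul_inv, inv_inv]
    push_cast
    ring
  rw [h3] at h1
  refine h1.trans ?_
  rw [norm_mul, norm_inv, Complex.norm_real, Real.norm_of_nonneg h0.le, mul_pow]
  have h4 : ‖S‖ ^ 2 ≤ (∑ i ∈ sample s, |τ i|) ^ 2 := pow_le_pow_left₀ (norm_nonneg _) h2 2
  calc (N : ℝ) * (2 * (W⁻¹ ^ 2 * ‖S‖ ^ 2)) =
      2 * (((N : ℝ)⁻¹ * W)⁻¹) ^ 2 * ((N : ℝ)⁻¹ * ‖S‖ ^ 2) := by
        rw [mul_inv, inv_inv]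
        field_simp
    _ ≤ _ := by gcongr

end CentralLimit

/-! ### Convergence of the conditional characteristic functions -/

section CentralLimit

variable {U : Type*} {ι : Type*} [Fintype ι] {π : Design U}

/-- The matrix of the weighted second moments of the summands of a weighted mean. -/
def sqMatrix {N : ℕ} (π : Design U) (r : ℝ) (u : U → EuclideanSpace ℝ ι) (s : Outcome U N) :
    Matrix ι ι ℝ :=
  Matrix.of fun j k => ∑ i ∈ sample s, (r * ((N : ℝ)⁻¹ * weight π s i)) ^ 2 *
    (u (s i).1 j * u (s i).1 k)

lemma dotProduct_sqMatrix {N : ℕ} (r : ℝ) (u : U → EuclideanSpace ℝ ι) (s : Outcome U N)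
    (a : EuclideanSpace ℝ ι) :
    a ⬝ᵥ (sqMatrix π r u s *ᵥ a) = ∑ i ∈ sample s,
      (r * ((N : ℝ)⁻¹ * (weight π s i * inner ℝ (u (s i).1) a))) ^ 2 := by
  have h : ∀ i, (r * ((N : ℝ)⁻¹ * (weight π s i * inner ℝ (u (s i).1) a))) ^ 2 =
      ∑ j, ∑ k, a j * ((r * ((N : ℝ)⁻¹ * weight π s i)) ^ 2 *
        (u (s i).1 j * u (s i).1 k) * a k) := by
    intro i
    have h1 : inner ℝ (u (s i).1) a = ∑ j, u (s i).1 j * a j := by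
      simp [PiLp.inner_apply, mul_comm]
    rw [show (r * ((N : ℝ)⁻¹ * (weight π s i * inner ℝ (u (s i).1) a))) ^ 2 =
      (r * ((N : ℝ)⁻¹ * weight π s i)) ^ 2 *
        (inner ℝ (u (s i).1) a * inner ℝ (u (s i).1) a) by ring,
      h1, Finset.sum_mul_sum, Finset.mul_sum]
    refine Finset.sum_congr rfl fun j _ => ?_
    rw [Finset.mul_sum]
    exact Finset.sum_congr rfl fun k _ => by ring
  simp_rw [h, dotProduct, Matrix.mulVec, dotProduct, sqMatrix, Matrix.of_apply, Finset.sum_mul,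
    Finset.mul_sum]
  rw [Finset.sum_comm]
  conv_lhs =>
    enter [2, k]
    rw [Finset.sum_comm]
  rw [Finset.sum_comm]
  conv_lhs =>
    enter [2, k]
    rw [Finset.sum_comm]

/-- Convergence of the characteristic functions of the centred bootstrap mean. -/
lemma tendsto_charFun_bootLaw {l : Filter (Σ N, Outcome U N)} (r : (Σ N, Outcome U N) → ℝ)
    (hr : ∀ x, 0 ≤ r x) (u : U → EuclideanSpace ℝ ι) (V : Matrix ι ι ℝ)
    (hgood : ∀ᶠ x in l, 0 < x.1 ∧ 0 < ∑ j ∈ sample x.2, weight π x.2 j ∧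
      ∀ i ∈ sample x.2, (inclProb π x.2 i : ℝ) ≠ 0)
    (hW : Tendsto (fun x => (x.1 : ℝ)⁻¹ * ∑ j ∈ sample x.2, weight π x.2 j) l (𝓝 1))
    (hD : Tendsto (fun x => (((x.1 : ℝ)⁻¹ * ∑ j ∈ sample x.2, weight π x.2 j)⁻¹ - 1) •
      (r x • vMean x.2 (weight π x.2) u)) l (𝓝 0))
    (h1 : Tendsto (fun x => (x.1 : ℝ)⁻¹ *
      (∑ i ∈ sample x.2, r x * ((x.1 : ℝ)⁻¹ * (weight π x.2 i * ‖u (x.2 i).1‖))) ^ 2) l (𝓝 0))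
    (h3 : Tendsto (fun x =>
      ∑ i ∈ sample x.2, (r x * ((x.1 : ℝ)⁻¹ * (weight π x.2 i * ‖u (x.2 i).1‖))) ^ 3) l (𝓝 0))
    (hQ : Tendsto (fun x => sqMatrix π (r x) u x.2) l (𝓝 V)) (a : EuclideanSpace ℝ ι) :
    Tendsto (fun x => charFun ((bootLaw π x.2).map
      (fun m => r x • (vMean x.2 (bootWeight π x.2 m) u - vMean x.2 (weight π x.2) u))) a) l
      (𝓝 (Complex.exp (-((a ⬝ᵥ (V *ᵥ a) : ℝ) : ℂ) / 2))) := by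
  set τ : ∀ x : Σ N, Outcome U N, Fin x.1 → ℝ := fun x i =>
    r x * ((x.1 : ℝ)⁻¹ * (weight π x.2 i * inner ℝ (u (x.2 i).1) a)) with hτ
  set ρ : (Σ N, Outcome U N) → ℝ := fun x =>
    ((x.1 : ℝ)⁻¹ * ∑ j ∈ sample x.2, weight π x.2 j)⁻¹ with hρdef
  have hρ : Tendsto ρ l (𝓝 1) := by
    have := hW.inv₀ one_ne_zero
    rwa [inv_one] at this
  have hτr : ∀ x i, |τ x i| ≤ r x * ((x.1 : ℝ)⁻¹ * (weight π x.2 i * ‖u (x.2 i).1‖)) * ‖a‖ := by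
    intro x i
    have hw := weight_nonneg π x.2 i
    have hr0 := hr x
    simp only [hτ]
    rw [abs_mul, abs_mul, abs_mul, abs_of_nonneg hr0, abs_of_nonneg hw,
      abs_of_nonneg (by positivity : (0 : ℝ) ≤ (x.1 : ℝ)⁻¹), mul_assoc, mul_assoc, mul_assoc]
    gcongr
    exact abs_real_inner_le_norm _ _
  set S : (Σ N, Outcome U N) → ℂ := fun x =>
    ∑ i ∈ sample x.2, (Complex.exp (τ x i * Complex.I) - 1)
  set T : (Σ N, Outcome U N) → ℝ := fun x => ∑ i ∈ sample x.2, τ x i with hTdef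
  -- the exponent
  have hR : Tendsto (fun x => (ρ x : ℂ) * ∑ i ∈ sample x.2,
      (Complex.exp (τ x i * Complex.I) - 1 - τ x i * Complex.I + (τ x i : ℂ) ^ 2 / 2)) l (𝓝 0) := by
    have hb : Tendsto (fun x => 4 * (∑ i ∈ sample x.2,
        (r x * ((x.1 : ℝ)⁻¹ * (weight π x.2 i * ‖u (x.2 i).1‖))) ^ 3) * ‖a‖ ^ 3) l (𝓝 0) := by
      simpa using (h3.const_mul 4).mul_const (‖a‖ ^ 3)
    have h0 := squeeze_zero_norm' (f := fun x => ∑ i ∈ sample x.2,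
      (Complex.exp (τ x i * Complex.I) - 1 - τ x i * Complex.I + (τ x i : ℂ) ^ 2 / 2))
      (Eventually.of_forall fun x => ?_) hb
    · have := ((Complex.continuous_ofReal.tendsto _).comp hρ).mul h0
      simpa using this
    · rw [mul_assoc, Finset.sum_mul, Finset.mul_sum]
      refine (norm_sum_le _ _).trans (Finset.sum_le_sum fun i _ => ?_)
      refine (norm_exp_I_taylor_two_le _).trans ?_
      rw [← mul_pow]
      gcongr
      exact hτr x i
  have hT : Tendsto (fun x => (ρ x - 1) * T x) l (𝓝 0) := by
    have h := hD.inner (tendsto_const_nhds (x := a)) (𝕜 := ℝ)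
    rw [inner_zero_left] at h
    refine h.congr fun x => ?_
    have hTx : T x = r x * ∑ i ∈ sample x.2,
        (x.1 : ℝ)⁻¹ * (weight π x.2 i * inner ℝ (u (x.2 i).1) a) := by
      simp only [hTdef, hτ, Finset.mul_sum]
    rw [real_inner_smul_left, real_inner_smul_left, inner_vMean, hTx]
  have hsq : Tendsto (fun x => ∑ i ∈ sample x.2, τ x i ^ 2) l (𝓝 (a ⬝ᵥ (V *ᵥ a))) := by
    have hc : Continuous fun M : Matrix ι ι ℝ => (a : ι → ℝ) ⬝ᵥ (M *ᵥ a) := by fun_prop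
    refine ((hc.tendsto V).comp hQ).congr fun x => ?_
    exact dotProduct_sqMatrix (π := π) (r x) u x.2 a
  have hexpo : Tendsto (fun x => -(T x : ℂ) * Complex.I + (ρ x : ℂ) * S x) l
      (𝓝 (-((a ⬝ᵥ (V *ᵥ a) : ℝ) : ℂ) / 2)) := by
    have hc := Complex.continuous_ofReal
    have h := (hR.add (((hc.tendsto _).comp hT).mul_const Complex.I)).sub
      ((((hc.tendsto _).comp hρ).mul ((hc.tendsto _).comp hsq)).div_const 2)
    have hlim : (0 : ℂ) + ((0 : ℝ) : ℂ) * Complex.I -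
        ((1 : ℝ) : ℂ) * ((a ⬝ᵥ (V *ᵥ a) : ℝ) : ℂ) / 2 =
      -((a ⬝ᵥ (V *ᵥ a) : ℝ) : ℂ) / 2 := by
      push_cast
      ring
    rw [hlim] at h
    refine h.congr fun x => ?_
    simp only [Function.comp_apply, S, hTdef, Finset.sum_add_distrib, Finset.sum_sub_distrib]
    push_cast
    rw [← Finset.sum_mul, ← Finset.sum_div]
    ring
  -- the power
  have hdiff : Tendsto (fun x => Complex.exp (-(T x : ℂ) * Complex.I) *
      (1 + ((∑ j ∈ sample x.2, weight π x.2 j : ℝ) : ℂ)⁻¹ * S x) ^ x.1 -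
      Complex.exp (-(T x : ℂ) * Complex.I + (ρ x : ℂ) * S x)) l (𝓝 0) := by
    have hb : Tendsto (fun x => 2 * ρ x ^ 2 * (((x.1 : ℝ)⁻¹ *
      (∑ i ∈ sample x.2, r x * ((x.1 : ℝ)⁻¹ * (weight π x.2 i * ‖u (x.2 i).1‖))) ^ 2) *
        ‖a‖ ^ 2)) l (𝓝 0) := by
      simpa using ((hρ.pow 2).const_mul 2).mul (h1.mul_const (‖a‖ ^ 2))
    refine squeeze_zero_norm' ?_ hb
    filter_upwards [hgood] with x hx
    rw [Complex.exp_add, ← mul_sub, norm_mul, ← Complex.ofReal_neg,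
      Complex.norm_exp_ofReal_mul_I, one_mul]
    refine (norm_bootLaw_sub_exp_le hx.1 hx.2.1 hx.2.2 (τ x)).trans ?_
    rw [mul_assoc _ _ (‖a‖ ^ 2), ← mul_pow, Finset.sum_mul]
    gcongr
    exact hτr x _
  have hfin := hdiff.add ((Complex.continuous_exp.tendsto _).comp hexpo)
  rw [zero_add] at hfin
  refine hfin.congr' ?_
  filter_upwards [hgood] with x hx
  rw [charFun_map_bootLaw u (r x) hx.2.1.ne' hx.2.2 a (τ x) rfl]
  simp only [Function.comp_apply, S, hTdef]
  ring

end CentralLimit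

/-! ### Conditional central limit theorem for the score -/

section ConditionalCentralLimit

variable {U : Type*} [MeasurableSpace U] {ι : Type*} [Fintype ι]

/-- The conditions on the score at the true parameter. -/
structure IsCenteredScore (P : Measure U) (π : Design U) (u : U → EuclideanSpace ℝ ι)
    (V : Matrix ι ι ℝ) : Prop where
  measurable : Measurable u
  memLp : MemLp u 3 P
  integral_eq_zero : ∀ j, ∫ d, u d j ∂P = 0
  tendsto_covariance : ∀ j k, Tendsto (fun N => expectedSize P π N *
      covariance (fun s : Outcome U N => wMean s (weight π s) fun _ d => u d j)
        (fun s : Outcome U N => wMean s (weight π s) fun _ d => u d k) (samplingLaw P π N))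
      atTop (𝓝 (V j k))

variable {P : Measure U} {π : Design U} {C₁ C₂ : ℝ}
  {u : U → EuclideanSpace ℝ ι} {V : Matrix ι ι ℝ}

/-- The scaled weighted score. -/
def scaledMean (P : Measure U) (π : Design U) (u : U → EuclideanSpace ℝ ι)
    (x : Σ N, Outcome U N) : EuclideanSpace ℝ ι :=
  √(expectedSize P π x.1) • vMean x.2 (weight π x.2) u

/-- The scaled and centred bootstrap score. -/
def scaledBoot (P : Measure U) (π : Design U) (u : U → EuclideanSpace ℝ ι)
    (z : Σ x : (Σ N, Outcome U N), (Fin x.1 → ℕ)) : EuclideanSpace ℝ ι :=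
  √(expectedSize P π z.1.1) •
    (vMean z.1.2 (bootWeight π z.1.2 z.2) u - vMean z.1.2 (weight π z.1.2) u)

namespace IsCenteredScore

lemma measurable_coord (hu : IsCenteredScore P π u V) (j : ι) : Measurable fun d => u d j :=
  (EuclideanSpace.proj (𝕜 := ℝ) j).continuous.measurable.comp hu.measurable

variable [IsProbabilityMeasure P]

lemma memLp_coord (hu : IsCenteredScore P π u V) (j : ι) : MemLp (fun d => u d j) 2 P := by
  have h1 : MemLp u 2 P := hu.memLp.mono_exponent (by norm_num)
  refine MemLp.of_le h1 (hu.measurable_coord j).aestronglyMeasurable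
    (Eventually.of_forall fun d => PiLp.norm_apply_le _ _)

lemma tendsto_variance (hu : IsCenteredScore P π u V) (hD : IsRegularDesign P π C₁ C₂) (j k : ι) :
    Tendsto (fun N => expectedSize P π N *
      Var[fun s : Outcome U N => wMean s (weight π s) (fun _ d => u d j + u d k);
        samplingLaw P π N]) atTop (𝓝 (V j j + 2 * V j k + V k k)) := by
  have h := ((hu.tendsto_covariance j j).add ((hu.tendsto_covariance j k).const_mul 2)).add
    (hu.tendsto_covariance k k)
  refine h.congr' ?_
  filter_upwards [hD.eventually_pos] with N hN
  have hpr := isProbabilityMeasure_samplingLaw (P := P) hD.measurable N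
  have hmem := fun j => (variance_wMean hD hN.2 (hu.measurable_coord j)
    ((hu.memLp_coord j).integrable_sq) (hu.integral_eq_zero j)).1
  have hsum : (fun s : Outcome U N => wMean s (weight π s) (fun _ d => u d j + u d k)) =
      (fun s : Outcome U N => wMean s (weight π s) (fun _ d => u d j)) +
      (fun s : Outcome U N => wMean s (weight π s) (fun _ d => u d k)) := by
    funext s
    simp only [wMean, mul_add, Finset.sum_add_distrib, Pi.add_apply]
  rw [hsum, variance_add (hmem j) (hmem k),
    covariance_self (hmem j).aestronglyMeasurable.aemeasurable,
    covariance_self (hmem k).aestronglyMeasurable.aemeasurable]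
  ring

lemma tendsto_wMean_sq_coord (hu : IsCenteredScore P π u V)
    (hD : IsRegularDesign P π C₁ C₂) (j : ι) :
    Tendsto (fun x : Σ N, Outcome U N => wMean x.2 (weight π x.2)
      (fun i d => expectedSize P π x.1 * ((x.1 : ℝ)⁻¹ * ((π x.1 i d : ℝ)⁻¹ * (u d j) ^ 2))))
      (sampleFilter P π) (𝓝 (V j j)) := by
  refine tendsto_wMean_sq hD (hu.measurable_coord j) ((hu.memLp_coord j).integrable_sq)
    (hu.integral_eq_zero j) ?_
  refine (hu.tendsto_covariance j j).congr' ?_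
  filter_upwards [hD.eventually_pos] with N hN
  rw [covariance_self (variance_wMean hD hN.2 (hu.measurable_coord j)
    ((hu.memLp_coord j).integrable_sq) (hu.integral_eq_zero j)).1.aestronglyMeasurable.aemeasurable]

/-- Polarization: the law of large numbers for weighted squares needs nonnegative summands, so
off-diagonal entries come from the squares of `u_j + u_k`, `u_j` and `u_k`. -/
lemma tendsto_sqMatrix (hu : IsCenteredScore P π u V) (hD : IsRegularDesign P π C₁ C₂) :
    Tendsto (fun x : Σ N, Outcome U N => sqMatrix π (√(expectedSize P π x.1)) u x.2)
      (sampleFilter P π) (𝓝 V) := by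
  refine tendsto_pi_nhds.2 fun j => tendsto_pi_nhds.2 fun k => ?_
  have h1 := tendsto_wMean_sq hD (φ := fun d => u d j + u d k)
    ((hu.measurable_coord j).add (hu.measurable_coord k))
    (((hu.memLp_coord j).add (hu.memLp_coord k)).integrable_sq)
    (by
      rw [integral_add ((hu.memLp_coord j).integrable (by norm_num))
        ((hu.memLp_coord k).integrable (by norm_num)), hu.integral_eq_zero j,
        hu.integral_eq_zero k, add_zero]) (hu.tendsto_variance hD j k)
  have h2 := ((h1.sub (hu.tendsto_wMean_sq_coord hD j)).sub
    (hu.tendsto_wMean_sq_coord hD k)).div_const 2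
  rw [show (V j j + 2 * V j k + V k k - V j j - V k k) / 2 = V j k by ring] at h2
  refine h2.congr fun x => ?_
  rw [← wMean_sub, ← wMean_sub, wMean, sqMatrix, Matrix.of_apply, Finset.mul_sum, Finset.sum_div]
  refine Finset.sum_congr rfl fun i _ => ?_
  rw [mul_pow, Real.sq_sqrt (expectedSize_nonneg P π x.1), weight, inclProb]
  ring

lemma integrable_norm (hu : IsCenteredScore P π u V) : Integrable (fun d => ‖u d‖) P :=
  (hu.memLp.integrable (by norm_num)).norm

/-- Negligibility of the Poisson approximation error: the expression is `n₀ / N` times the square of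
a convergent weighted mean. -/
lemma tendsto_inv_mul_sum_sq (hu : IsCenteredScore P π u V) (hD : IsRegularDesign P π C₁ C₂) :
    Tendsto (fun x : Σ N, Outcome U N => (x.1 : ℝ)⁻¹ * (∑ i ∈ sample x.2,
      √(expectedSize P π x.1) * ((x.1 : ℝ)⁻¹ * (weight π x.2 i * ‖u (x.2 i).1‖))) ^ 2)
      (sampleFilter P π) (𝓝 0) := by
  have h1 := tendsto_wMean_weight_of_integrable hD hu.measurable.norm hu.integrable_norm
  have h2 := (hD.tendsto_fraction.comp (tendsto_fst_highProb (l := atTop)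
    (ν := samplingLaw P π))).mul (h1.pow 2)
  rw [zero_mul] at h2
  refine h2.congr fun x => ?_
  rw [← Finset.mul_sum, ← Finset.mul_sum, mul_pow, Real.sq_sqrt (expectedSize_nonneg P π x.1)]
  simp only [Function.comp_apply, wMean]
  ring

/-- The Lyapunov condition. Since `n₀ w_i / N ≤ C₁⁻¹`, two of the three weight factors are absorbed,
leaving `n₀ ^ (-1/2)` times a weighted mean of `‖u‖ ^ 3`. -/
lemma tendsto_sum_cube (hu : IsCenteredScore P π u V) (hD : IsRegularDesign P π C₁ C₂) :
    Tendsto (fun x : Σ N, Outcome U N => ∑ i ∈ sample x.2,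
      (√(expectedSize P π x.1) * ((x.1 : ℝ)⁻¹ * (weight π x.2 i * ‖u (x.2 i).1‖))) ^ 3)
      (sampleFilter P π) (𝓝 0) := by
  have hint : Integrable (fun d => ‖u d‖ ^ 3) P := by
    have := hu.memLp.integrable_norm_pow (p := 3) (by norm_num)
    simpa using this
  have h1 := tendsto_wMean_weight_of_integrable hD (hu.measurable.norm.pow_const 3) hint
  have h2 : Tendsto (fun x : Σ N, Outcome U N => (√(expectedSize P π x.1))⁻¹)
      (sampleFilter P π) (𝓝 0) :=
    (tendsto_inv_atTop_zero.comp (Real.tendsto_sqrt_atTop.comp hD.tendsto_size)).comp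
      tendsto_fst_highProb
  have h3 := (h2.const_mul (C₁⁻¹ ^ 2)).mul h1
  rw [mul_zero, zero_mul] at h3
  refine squeeze_zero' (Eventually.of_forall fun x => ?_) ?_ h3
  · refine Finset.sum_nonneg fun i _ => ?_
    have := weight_nonneg π x.2 i
    positivity
  · filter_upwards [eventually_sample_good hD (r := fun _ => True) (by simp)] with x hx
    rw [wMean, Finset.mul_sum, Finset.mul_sum]
    refine Finset.sum_le_sum fun i _ => ?_
    have hw := weight_nonneg π x.2 i
    have hn := hx.2.1
    have hN : (0 : ℝ) < x.1 := by exact_mod_cast hx.1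
    have hC := hD.pos
    have hp := (hx.2.2.1 i).2.1
    have hwb : expectedSize P π x.1 * ((x.1 : ℝ)⁻¹ * weight π x.2 i) ≤ C₁⁻¹ := by
      rw [weight, ← mul_inv, ← div_eq_mul_inv, div_le_iff₀ (by positivity), inv_mul_eq_div,
        le_div_iff₀ hC, mul_comm]
      exact (hx.2.2.1 i).1
    have hs := Real.sq_sqrt hn.le
    have hs0 := Real.sqrt_pos.2 hn
    set r := √(expectedSize P π x.1)
    rw [← hs] at hwb
    have hsq : (r ^ 2 * ((x.1 : ℝ)⁻¹ * weight π x.2 i)) ^ 2 ≤ C₁⁻¹ ^ 2 :=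
      pow_le_pow_left₀ (by positivity) hwb 2
    calc (r * ((x.1 : ℝ)⁻¹ * (weight π x.2 i * ‖u (x.2 i).1‖))) ^ 3
        = (r ^ 2 * ((x.1 : ℝ)⁻¹ * weight π x.2 i)) ^ 2 * (r⁻¹ * ((x.1 : ℝ)⁻¹ *
          (weight π x.2 i * ‖u (x.2 i).1‖ ^ 3))) := by
          field_simp
      _ ≤ C₁⁻¹ ^ 2 * (r⁻¹ * ((x.1 : ℝ)⁻¹ * (weight π x.2 i * ‖u (x.2 i).1‖ ^ 3))) := by
          gcongr
      _ = _ := by ring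

/-- Markov's inequality for the squared norm, whose mean is `n₀` times the trace of the covariance
matrix and hence converges. -/
lemma tight_scaledMean (hu : IsCenteredScore P π u V) (hD : IsRegularDesign P π C₁ C₂)
    (ε : ENNReal) (hε : 0 < ε) :
    ∃ K : ℝ, ∀ᶠ N in atTop,
      samplingLaw P π N {s | K < ‖scaledMean P π u ⟨N, s⟩‖} ≤ ε := by
  have hlim := tendsto_finsetSum Finset.univ fun j (_ : j ∈ Finset.univ) =>
    hu.tendsto_covariance j j
  set v := ∑ j, V j j
  have hb := hlim.eventually_lt_const (lt_add_one v)
  obtain ⟨K, hK0, hK⟩ : ∃ K : ℝ, 0 < K ∧ ENNReal.ofReal (|v| + 1) / ENNReal.ofReal (K ^ 2) ≤ ε := by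
    have h1 : Tendsto (fun K : ℝ => ENNReal.ofReal ((|v| + 1) / K ^ 2)) atTop (𝓝 0) := by
      have h2 : Tendsto (fun K : ℝ => (|v| + 1) / K ^ 2) atTop (𝓝 0) :=
        (tendsto_pow_atTop (two_ne_zero)).const_div_atTop _
      have := (ENNReal.continuous_ofReal.tendsto _).comp h2
      rwa [ENNReal.ofReal_zero] at this
    obtain ⟨K, hK1, hK2⟩ := ((eventually_gt_atTop 0).and
      ((ENNReal.tendsto_nhds_zero.1 h1) ε hε)).exists
    refine ⟨K, hK1, ?_⟩
    rwa [← ENNReal.ofReal_div_of_pos (by positivity)]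
  refine ⟨K, ?_⟩
  filter_upwards [hb, hD.eventually_pos] with N hN hpos
  have hpr := isProbabilityMeasure_samplingLaw (P := P) hD.measurable N
  have hv := fun j => variance_wMean hD hpos.2 (hu.measurable_coord j)
    ((hu.memLp_coord j).integrable_sq) (hu.integral_eq_zero j)
  have hsq : ∀ s : Outcome U N, ‖scaledMean P π u ⟨N, s⟩‖ ^ 2 =
      ∑ j, expectedSize P π N * (wMean s (weight π s) fun _ d => u d j) ^ 2 := by
    intro s
    rw [EuclideanSpace.norm_sq_eq]
    refine Finset.sum_congr rfl fun j _ => ?_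
    rw [scaledMean, PiLp.smul_apply, vMean_apply, smul_eq_mul, norm_mul, mul_pow,
      Real.norm_of_nonneg (Real.sqrt_nonneg _), Real.sq_sqrt (expectedSize_nonneg P π N),
      Real.norm_eq_abs, sq_abs]
  have hintj : ∀ j, Integrable (fun s : Outcome U N => expectedSize P π N *
      (wMean s (weight π s) fun _ d => u d j) ^ 2) (samplingLaw P π N) := fun j =>
    ((hv j).1.integrable_sq).const_mul _
  have hint : Integrable (fun s : Outcome U N => ‖scaledMean P π u ⟨N, s⟩‖ ^ 2)
      (samplingLaw P π N) := by
    simp_rw [hsq]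
    exact integrable_finsetSum _ fun j _ => hintj j
  have hE : ∫ s : Outcome U N, ‖scaledMean P π u ⟨N, s⟩‖ ^ 2 ∂samplingLaw P π N ≤ |v| + 1 := by
    simp_rw [hsq]
    rw [integral_finsetSum _ fun j _ => hintj j]
    refine le_trans (le_of_eq ?_) (hN.le.trans (by linarith [le_abs_self v]))
    refine Finset.sum_congr rfl fun j _ => ?_
    rw [covariance_self (hv j).1.aestronglyMeasurable.aemeasurable,
      variance_of_integral_eq_zero (hv j).1.aestronglyMeasurable.aemeasurable (hv j).2.1,
      integral_const_mul]
  refine le_trans ?_ hK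
  refine le_trans ?_ (ENNReal.div_le_div_right (ENNReal.ofReal_le_ofReal hE) _)
  rw [ofReal_integral_eq_lintegral_ofReal hint (Eventually.of_forall fun s => by positivity)]
  refine le_trans (measure_mono ?_)
    (meas_ge_le_lintegral_div hint.aestronglyMeasurable.aemeasurable.ennreal_ofReal
      (by simp; exact hK0.ne') ENNReal.ofReal_ne_top)
  intro s hs
  simp only [Set.mem_ofPred_eq] at hs ⊢
  exact ENNReal.ofReal_le_ofReal (pow_le_pow_left₀ hK0.le hs.le 2)

/-- The conditional central limit theorem for the bootstrap score. -/
theorem tendsto_integral_scaledBoot (hu : IsCenteredScore P π u V) [DecidableEq ι]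
    (hD : IsRegularDesign P π C₁ C₂) (hV : V.PosSemidef) (f : EuclideanSpace ℝ ι →ᵇ ℝ) :
    Tendsto (fun x : Σ N, Outcome U N => ∫ m, f (scaledBoot P π u ⟨x, m⟩) ∂bootLaw π x.2)
      (sampleFilter P π) (𝓝 (∫ z, f z ∂(multivariateGaussian 0 V))) := by
  have hgood := eventually_sample_good hD (r := fun _ => True) (by simp)
  have hW := tendsto_totalWeight hD
  -- The bootstrap mean given the sample is `N / W` times the sample mean, not the sample mean
  -- itself. The discrepancy is a vanishing factor times a tight variable.
  have hDe : Tendsto (fun x : Σ N, Outcome U N =>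
      (((x.1 : ℝ)⁻¹ * ∑ j ∈ sample x.2, weight π x.2 j)⁻¹ - 1) •
      (√(expectedSize P π x.1) • vMean x.2 (weight π x.2) u)) (sampleFilter P π) (𝓝 0) := by
    have h1 : Tendsto (fun x : Σ N, Outcome U N =>
        ((x.1 : ℝ)⁻¹ * ∑ j ∈ sample x.2, weight π x.2 j)⁻¹ - 1) (sampleFilter P π) (𝓝 0) := by
      have := (hW.inv₀ one_ne_zero).sub_const 1
      rwa [inv_one, sub_self] at this
    refine tendsto_highProb_of_tight (Y := scaledMean P π u) (hu.tight_scaledMean hD) fun K => ?_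
    refine Tendsto.zero_smul_isBoundedUnder_le (h1.mono_left inf_le_left) ?_
    refine ⟨K, ?_⟩
    rw [eventually_map]
    exact eventually_inf_principal.2 (Eventually.of_forall fun x hx => hx)
  have hQ := hu.tendsto_sqMatrix hD
  have h1 := hu.tendsto_inv_mul_sum_sq hD
  have h3 := hu.tendsto_sum_cube hD
  have : FirstCountableTopology (Matrix ι ι ℝ) :=
    inferInstanceAs (FirstCountableTopology (ι → ι → ℝ))
  -- The continuity theorem for characteristic functions is applied along sequences. All that it
  -- needs is packed into one convergent statistic, so that it can be used on deterministic
  -- sequences of samples.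
  refine tendsto_of_statistic (p := fun x : Σ N, Outcome U N => 0 < x.1 ∧
      0 < ∑ j ∈ sample x.2, weight π x.2 j ∧ ∀ i ∈ sample x.2, (inclProb π x.2 i : ℝ) ≠ 0)
    (hgood.mono fun x hx => ⟨hx.1, hx.2.2.2, fun i _ => (hx.2.2.1 i).2.1.ne'⟩)
    (hW.prodMk_nhds (hDe.prodMk_nhds (h1.prodMk_nhds (h3.prodMk_nhds hQ)))) ?_
  intro y hy hlim
  have hprob : ∀ n, IsProbabilityMeasure (bootLaw π (y n).2) := fun n =>
    isProbabilityMeasure_bootLaw (hy n).2.1.ne' (hy n).2.2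
  have hmeas : ∀ n, Measurable fun m => scaledBoot P π u ⟨y n, m⟩ := fun n => Measurable.of_discrete
  set μ : ℕ → ProbabilityMeasure (EuclideanSpace ℝ ι) := fun n =>
    ⟨(bootLaw π (y n).2).map fun m => scaledBoot P π u ⟨y n, m⟩,
      Measure.isProbabilityMeasure_map (hmeas n).aemeasurable⟩ with hμ
  set μ₀ : ProbabilityMeasure (EuclideanSpace ℝ ι) := ⟨multivariateGaussian 0 V, inferInstance⟩
  have hconv : Tendsto μ atTop (𝓝 μ₀) := by
    refine ProbabilityMeasure.tendsto_of_tendsto_charFun fun a => ?_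
    have hc := tendsto_charFun_bootLaw (π := π) (l := map y atTop)
      (fun x => √(expectedSize P π x.1)) (fun x => Real.sqrt_nonneg _) u V
      (eventually_map.2 (Eventually.of_forall hy))
      (tendsto_map'_iff.2 ((continuous_fst.tendsto _).comp hlim))
      (tendsto_map'_iff.2 (((continuous_fst.comp continuous_snd).tendsto _).comp hlim))
      (tendsto_map'_iff.2
        (((continuous_fst.comp (continuous_snd.comp continuous_snd)).tendsto _).comp hlim))
      (tendsto_map'_iff.2 (((continuous_fst.comp
        (continuous_snd.comp (continuous_snd.comp continuous_snd))).tendsto _).comp hlim))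
      (tendsto_map'_iff.2 (((continuous_snd.comp
        (continuous_snd.comp (continuous_snd.comp continuous_snd))).tendsto _).comp hlim)) a
    have hg : charFun (μ₀ : Measure (EuclideanSpace ℝ ι)) a =
        Complex.exp (-((a ⬝ᵥ (V *ᵥ a) : ℝ) : ℂ) / 2) := by
      change charFun (multivariateGaussian 0 V) a = _
      rw [charFun_multivariateGaussian hV]
      congr 1
      simp
      ring
    rw [hg]
    exact tendsto_map'_iff.1 hc
  have h5 := ProbabilityMeasure.tendsto_iff_forall_integral_tendsto.1 hconv f
  refine h5.congr fun n => ?_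
  exact integral_map (hmeas n).aemeasurable f.continuous.aestronglyMeasurable

/-- Tightness is inherited from the Gaussian limit by testing the weak convergence with one
continuous function, which vanishes for norm at most `K` and equals `1` beyond `K + 1`. -/
lemma tight_scaledBoot (hu : IsCenteredScore P π u V) [DecidableEq ι]
    (hD : IsRegularDesign P π C₁ C₂) (hV : V.PosSemidef) (ε : ENNReal) (hε : 0 < ε) :
    ∃ K : ℝ, ∀ᶠ x in sampleFilter P π,
      bootLaw π x.2 {m | K < ‖scaledBoot P π u ⟨x, m⟩‖} ≤ ε := by
  obtain ⟨r, hr0, hrε⟩ := ENNReal.lt_iff_exists_nnreal_btwn.1 hε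
  have hr : 0 < (r : ℝ) := by exact_mod_cast hr0
  set b : ℕ → EuclideanSpace ℝ ι → ℝ := fun K z => min 1 (max 0 (‖z‖ - K))
  have hb : ∀ K z, 0 ≤ b K z ∧ b K z ≤ 1 := fun K z =>
    ⟨le_min zero_le_one (le_max_left _ _), min_le_left _ _⟩
  have hbc : ∀ K, Continuous (b K) := fun K => by fun_prop
  have hlim : Tendsto (fun K : ℕ => ∫ z, b K z ∂multivariateGaussian (0 : EuclideanSpace ℝ ι) V)
      atTop (𝓝 (∫ _, (0 : ℝ) ∂multivariateGaussian (0 : EuclideanSpace ℝ ι) V)) := by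
    refine tendsto_integral_of_dominated_convergence (fun _ => 1)
      (fun K => (hbc K).aestronglyMeasurable) (integrable_const _)
      (fun K => Eventually.of_forall fun z => ?_) (Eventually.of_forall fun z => ?_)
    · rw [Real.norm_of_nonneg (hb K z).1]
      exact (hb K z).2
    · refine tendsto_nhds_of_eventually_eq ?_
      filter_upwards [tendsto_natCast_atTop_atTop.eventually_ge_atTop ‖z‖] with K hK
      simp only [b]
      rw [max_eq_left (by linarith), min_eq_right zero_le_one]
  rw [integral_zero] at hlim
  obtain ⟨K, hK⟩ := (hlim.eventually_lt_const hr).exists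
  refine ⟨K + 1, ?_⟩
  have hconv := hu.tendsto_integral_scaledBoot hD hV
    (BoundedContinuousFunction.ofNormedAddCommGroup (b K) (hbc K) 1 fun z => by
      rw [Real.norm_of_nonneg (hb K z).1]
      exact (hb K z).2)
  filter_upwards [hconv.eventually_lt_const hK, eventually_isProbabilityMeasure_bootLaw hD]
    with x hx hpr
  simp only [BoundedContinuousFunction.coe_ofNormedAddCommGroup] at hx
  have hint : Integrable (fun m => b K (scaledBoot P π u ⟨x, m⟩)) (bootLaw π x.2) :=
    Integrable.of_bound (C := 1) (Measurable.of_discrete).aestronglyMeasurable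
      (Eventually.of_forall fun m => by
        rw [Real.norm_of_nonneg (hb K _).1]
        exact (hb K _).2)
  refine le_trans ?_ hrε.le
  have h1 := mul_meas_ge_le_integral_of_nonneg (μ := bootLaw π x.2)
    (f := fun m => b K (scaledBoot P π u ⟨x, m⟩)) (Eventually.of_forall fun m => (hb K _).1) hint 1
  rw [one_mul] at h1
  have h2 := (h1.trans hx.le)
  rw [measureReal_def] at h2
  have h3 : bootLaw π x.2 {m | 1 ≤ b K (scaledBoot P π u ⟨x, m⟩)} ≤ r := by
    rw [← ENNReal.toReal_le_toReal (measure_ne_top _ _) ENNReal.coe_ne_top]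
    simpa using h2
  refine le_trans (measure_mono fun m hm => ?_) h3
  simp only [Set.mem_ofPred_eq] at hm ⊢
  exact le_min le_rfl (le_max_of_le_right (by linarith))

end IsCenteredScore

end ConditionalCentralLimit

/-! ### Consequences of the conditional mean model -/

section ConditionalMean

variable {U X : Type*} [MeasurableSpace U] [mX : MeasurableSpace X] {P : Measure U}
  [IsProbabilityMeasure P]

/-- If `E(y | x) = m(x)` and `a ≥ 0`, then `a(x) + (y - m(x)) g(x)` has a nonnegative mean as soon
as it is integrable. -/
lemma integral_nonneg_of_condMean {x : U → X} {y : U → ℝ} {m a g : X → ℝ} (hx : Measurable x)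
    (hyi : Integrable y P)
    (hmean : P[y | MeasurableSpace.comap x mX] =ᵐ[P] fun d => m (x d))
    (ha : Measurable a) (hg : Measurable g) (ha0 : ∀ b, 0 ≤ a b)
    (hint : Integrable (fun d => a (x d) + (y d - m (x d)) * g (x d)) P) :
    0 ≤ ∫ d, (a (x d) + (y d - m (x d)) * g (x d)) ∂P := by
  have hle : MeasurableSpace.comap x mX ≤ ‹MeasurableSpace U› := hx.comap_le
  have hmi : Integrable (fun d => m (x d)) P := integrable_condExp.congr hmean
  -- Only the sum is assumed integrable, not its two terms. On this set both functions are bounded,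
  -- so the terms separate and the conditional mean removes the second; integrability of the sum
  -- permits `n → ∞`.
  set S : ℕ → Set X := fun n => {b | |a b| ≤ n ∧ |g b| ≤ n} with hS
  have hSm : ∀ n, MeasurableSet (S n) := fun n =>
    (measurableSet_le ha.abs measurable_const).inter (measurableSet_le hg.abs measurable_const)
  set A : ℕ → Set U := fun n => x ⁻¹' S n
  have hAm : ∀ n, MeasurableSet (A n) := fun n => hx (hSm n)
  have hmono : Monotone A := by
    intro n k hnk d hd
    have : (n : ℝ) ≤ k := by exact_mod_cast hnk
    exact ⟨hd.1.trans this, hd.2.trans this⟩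
  have hunion : ⋃ n, A n = Set.univ := by
    refine Set.eq_univ_of_forall fun d => ?_
    obtain ⟨n, hn⟩ := exists_nat_ge (max |a (x d)| |g (x d)|)
    exact Set.mem_iUnion.2 ⟨n, (le_max_left _ _).trans hn, (le_max_right _ _).trans hn⟩
  have hlim := tendsto_setIntegral_of_monotone hAm hmono hint.integrableOn
  rw [hunion, setIntegral_univ] at hlim
  refine ge_of_tendsto' hlim fun n => ?_
  set G : X → ℝ := (S n).indicator g with hGdef
  have hGm : Measurable G := hg.indicator (hSm n)
  have hGb : ∀ b, |G b| ≤ n := by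
    intro b
    by_cases hb : b ∈ S n
    · rw [hGdef, Set.indicator_of_mem hb]
      exact hb.2
    · rw [hGdef, Set.indicator_of_notMem hb, abs_zero]
      exact Nat.cast_nonneg n
  have hGs : StronglyMeasurable[MeasurableSpace.comap x mX] fun d => G (x d) := by
    have : Measurable[MeasurableSpace.comap x mX] fun d => G (x d) :=
      hGm.comp (comap_measurable x)
    exact this.stronglyMeasurable
  have hGy : Integrable (fun d => G (x d) * y d) P :=
    hyi.bdd_mul (hGm.comp hx).aestronglyMeasurable (Eventually.of_forall fun d => hGb (x d))
  have hGmi : Integrable (fun d => G (x d) * m (x d)) P :=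
    hmi.bdd_mul (hGm.comp hx).aestronglyMeasurable (Eventually.of_forall fun d => hGb (x d))
  have hzero : ∫ d, G (x d) * y d ∂P = ∫ d, G (x d) * m (x d) ∂P := by
    rw [← integral_condExp hle]
    refine integral_congr_ae ?_
    refine (condExp_stronglyMeasurable_mul_of_bound hle hGs hyi n
      (Eventually.of_forall fun d => hGb (x d))).trans ?_
    filter_upwards [hmean] with d hd
    rw [Pi.mul_apply, hd]
  have hai : Integrable (fun d => (S n).indicator a (x d)) P := by
    refine Integrable.of_bound (C := n) ((ha.indicator (hSm n)).comp hx).aestronglyMeasurable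
      (Eventually.of_forall fun d => ?_)
    by_cases hb : x d ∈ S n
    · rw [Set.indicator_of_mem hb]
      exact hb.1
    · rw [Set.indicator_of_notMem hb, norm_zero]
      exact Nat.cast_nonneg n
  have heq : ∫ d in A n, (a (x d) + (y d - m (x d)) * g (x d)) ∂P =
      ∫ d, ((S n).indicator a (x d) + (G (x d) * y d - G (x d) * m (x d))) ∂P := by
    rw [← integral_indicator (hAm n)]
    refine integral_congr_ae (Eventually.of_forall fun d => ?_)
    by_cases hb : x d ∈ S n
    · have hd : d ∈ A n := hb
      simp only [hGdef, Set.indicator_of_mem hb, Set.indicator_of_mem hd]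
      ring
    · have hd : d ∉ A n := hb
      simp only [hGdef, Set.indicator_of_notMem hb, Set.indicator_of_notMem hd]
      ring
  rw [heq, integral_add hai (hGy.sub' hGmi), integral_sub hGy hGmi, hzero, sub_self, add_zero]
  exact integral_nonneg fun d => Set.indicator_nonneg (fun b _ => ha0 b) _

/-- The inequality with `a = 0`, used for `g` and for `-g`. -/
lemma integral_eq_zero_of_condMean {x : U → X} {y : U → ℝ} {m g : X → ℝ} (hx : Measurable x)
    (hyi : Integrable y P)
    (hmean : P[y | MeasurableSpace.comap x mX] =ᵐ[P] fun d => m (x d))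
    (hg : Measurable g) (hint : Integrable (fun d => (y d - m (x d)) * g (x d)) P) :
    ∫ d, (y d - m (x d)) * g (x d) ∂P = 0 := by
  have h1 := integral_nonneg_of_condMean hx hyi hmean (a := fun _ => 0) measurable_const hg
    (fun _ => le_rfl) (by simpa using hint)
  have h2 := integral_nonneg_of_condMean hx hyi hmean (a := fun _ => 0) measurable_const hg.neg
    (fun _ => le_rfl) (by simpa using hint.neg)
  simp only [zero_add, Pi.neg_apply, mul_neg, integral_neg] at h1 h2
  linarith

end ConditionalMean

/-! ### Measurability of derivatives and of the variance factor -/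

section Measurability

/-- Measurability of a directional derivative in a parameter. -/
lemma measurable_fderiv_apply {X E : Type*} [MeasurableSpace X] [NormedAddCommGroup E]
    [NormedSpace ℝ E] {f : X → E → ℝ} {t : E} (v : E) (hd : ∀ a, DifferentiableAt ℝ (f a) t)
    (hm : ∀ᶠ r in 𝓝 t, Measurable fun a => f a r) :
    Measurable fun a => fderiv ℝ (f a) t v := by
  have h0 : Tendsto (fun n : ℕ => t + (n : ℝ)⁻¹ • v) atTop (𝓝 t) := by
    have : Tendsto (fun n : ℕ => (n : ℝ)⁻¹ • v) atTop (𝓝 ((0 : ℝ) • v)) :=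
      tendsto_inv_atTop_nhds_zero_nat.smul_const v
    rw [zero_smul] at this
    simpa using this.const_add t
  obtain ⟨k, hk⟩ := eventually_atTop.1 (h0.eventually hm)
  -- The derivative is a limit of difference quotients; the shift by `k` keeps the evaluation points
  -- where measurability is known.
  refine measurable_of_tendsto_metrizable (f := fun n a =>
    ((n + k : ℕ) : ℝ) • (f a (t + ((n + k : ℕ) : ℝ)⁻¹ • v) - f a t)) (fun n => ?_) ?_
  · simp only [smul_eq_mul]
    exact ((hk (n + k) (Nat.le_add_left k n)).sub hm.self_of_nhds).const_mul _
  · refine tendsto_pi_nhds.2 fun a => ?_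
    exact (tendsto_add_atTop_iff_nat k).2 (((hd a).hasFDerivAt.lim_real v).comp
      tendsto_natCast_atTop_atTop)

/-- `g` stands for `V₀`, which is not assumed measurable. Being `C¹` at a point is an open
condition, so `g` is continuous on an open set containing all values of `f`, and may be replaced by
`0` elsewhere. -/
lemma measurable_comp_of_contDiffAt {X : Type*} [MeasurableSpace X] {g : ℝ → ℝ} {f : X → ℝ}
    (hf : Measurable f) (hg : ∀ a, ContDiffAt ℝ 1 g (f a)) : Measurable fun a => g (f a) := by
  set C : Set ℝ := {v | ContDiffAt ℝ 1 g v}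
  have hC : IsOpen C := isOpen_iff_mem_nhds.2 fun v hv =>
    ContDiffAt.eventually (show ContDiffAt ℝ 1 g v from hv) (by simp)
  have hcont : ContinuousOn g C := fun v hv =>
    (show ContDiffAt ℝ 1 g v from hv).continuousAt.continuousWithinAt
  have h1 : Measurable (C.indicator g) := by
    classical
    rw [← Set.piecewise_eq_indicator]
    exact hcont.measurable_piecewise continuousOn_const hC.measurableSet
  have h2 : (fun a => g (f a)) = C.indicator g ∘ f := by
    funext a
    exact (Set.indicator_of_mem (s := C) (hg a) _).symm
  rw [h2]
  exact h1.comp hf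

end Measurability

/-! ### Smoothness of the score and positivity of the information -/

namespace Model

variable {U X : Type*} [MeasurableSpace U] {p₀ q : ℕ}

/-- The factor `V₀(μ)⁻¹ ∂μ/∂θ_j` of the quasi-score. -/
def scoreFactor (M : Model U X p₀ q) (j : Fin p₀ ⊕ Fin q) (a : X) (t : Param p₀ q) : ℝ :=
  (M.V₀ (M.μ a t))⁻¹ * fderiv ℝ (M.μ a) t (EuclideanSpace.single j 1)

variable {M : Model U X p₀ q}

lemma score_apply (t : Param p₀ q) (d : U) (j : Fin p₀ ⊕ Fin q) :
    M.score t d j = (M.y d - M.μ (M.x d) t) * M.scoreFactor j (M.x d) t := by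
  have h : gradient (M.μ (M.x d)) t j =
      fderiv ℝ (M.μ (M.x d)) t (EuclideanSpace.single j 1) := by
    rw [gradient, ← InnerProductSpace.toDual_symm_apply, EuclideanSpace.inner_single_right]
    simp
  rw [score, PiLp.smul_apply, smul_eq_mul, h, scoreFactor, mul_assoc]

variable [MeasurableSpace X]

/-- The measurability and smoothness conditions on the model. -/
structure IsSmooth (M : Model U X p₀ q) : Prop where
  measurable_x : Measurable M.x
  measurable_y : Measurable M.y
  measurable_mean : ∀ t, Measurable fun a => M.μ a t
  isOpen : IsOpen M.Θ
  contDiffOn_mean : ∀ a, ContDiffOn ℝ 2 (M.μ a) M.Θ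
  variance_pos : ∀ a, ∀ t ∈ M.Θ, 0 < M.V₀ (M.μ a t)
  contDiffAt_variance : ∀ a, ∀ t ∈ M.Θ, ContDiffAt ℝ 1 M.V₀ (M.μ a t)

variable {M : Model U X p₀ q}

namespace IsSmooth

variable {t : Param p₀ q}

lemma contDiffAt_mean (hM : M.IsSmooth) (ht : t ∈ M.Θ) (a : X) : ContDiffAt ℝ 2 (M.μ a) t :=
  (hM.contDiffOn_mean a).contDiffAt (hM.isOpen.mem_nhds ht)

lemma contDiffAt_scoreFactor (hM : M.IsSmooth) (ht : t ∈ M.Θ) (j : Fin p₀ ⊕ Fin q) (a : X) :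
    ContDiffAt ℝ 1 (M.scoreFactor j a) t := by
  have h1 := hM.contDiffAt_mean ht a
  have h2 : ContDiffAt ℝ 1 (fun r => M.V₀ (M.μ a r)) t :=
    (hM.contDiffAt_variance a t ht).comp t (h1.of_le (by norm_num))
  have h3 : ContDiffAt ℝ 1 (fun r => fderiv ℝ (M.μ a) r (EuclideanSpace.single j 1)) t :=
    (h1.fderiv_right (m := 1) (by norm_num)).clm_apply contDiffAt_const
  exact (h2.inv (hM.variance_pos a t ht).ne').mul h3

lemma contDiffAt_score (hM : M.IsSmooth) (ht : t ∈ M.Θ) (j : Fin p₀ ⊕ Fin q) (d : U) :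
    ContDiffAt ℝ 1 (fun r => M.score r d j) t := by
  simp_rw [score_apply]
  exact (contDiffAt_const.sub ((hM.contDiffAt_mean ht _).of_le (by norm_num))).mul
    (hM.contDiffAt_scoreFactor ht j _)

lemma measurable_fderiv_mean (hM : M.IsSmooth) (ht : t ∈ M.Θ) (v : Param p₀ q) :
    Measurable fun a => fderiv ℝ (M.μ a) t v :=
  measurable_fderiv_apply v (fun a => (hM.contDiffAt_mean ht a).differentiableAt (by norm_num))
    (Eventually.of_forall hM.measurable_mean)

lemma measurable_scoreFactor (hM : M.IsSmooth) (ht : t ∈ M.Θ) (j : Fin p₀ ⊕ Fin q) :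
    Measurable fun a => M.scoreFactor j a t :=
  (measurable_comp_of_contDiffAt (hM.measurable_mean t)
    fun a => hM.contDiffAt_variance a t ht).inv.mul (hM.measurable_fderiv_mean ht _)

lemma measurable_fderiv_scoreFactor (hM : M.IsSmooth) (ht : t ∈ M.Θ) (j : Fin p₀ ⊕ Fin q)
    (v : Param p₀ q) : Measurable fun a => fderiv ℝ (M.scoreFactor j a) t v :=
  measurable_fderiv_apply v
    (fun a => (hM.contDiffAt_scoreFactor ht j a).differentiableAt (by norm_num))
    (Filter.eventually_of_mem (hM.isOpen.mem_nhds ht) fun r hr => hM.measurable_scoreFactor hr j)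

lemma measurable_score (hM : M.IsSmooth) (ht : t ∈ M.Θ) : Measurable (M.score t) := by
  have h : Measurable fun d => (fun j => M.score t d j) := by
    refine measurable_pi_iff.2 fun j => ?_
    simp_rw [score_apply]
    exact (hM.measurable_y.sub ((hM.measurable_mean t).comp hM.measurable_x)).mul
      ((hM.measurable_scoreFactor ht j).comp hM.measurable_x)
  exact (MeasurableEquiv.toLp 2 (Fin p₀ ⊕ Fin q → ℝ)).measurable.comp h

/-- The decomposition behind positivity: the first term is the symmetric rank-one matrix `V₀⁻¹ ∂μ
∂μᵀ`, the second is the residual times a function of `x`. -/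
lemma info_apply (hM : M.IsSmooth) (ht : t ∈ M.Θ) (d : U) (j k : Fin p₀ ⊕ Fin q) :
    M.info t d j k =
      fderiv ℝ (M.μ (M.x d)) t (EuclideanSpace.single k 1) * M.scoreFactor j (M.x d) t +
      (M.y d - M.μ (M.x d) t) *
        -fderiv ℝ (M.scoreFactor j (M.x d)) t (EuclideanSpace.single k 1) := by
  have h1 := (hM.contDiffAt_mean ht (M.x d)).differentiableAt (by norm_num)
  have h2 := (hM.contDiffAt_scoreFactor ht j (M.x d)).differentiableAt (by norm_num)
  have h3 := ((hasFDerivAt_const (M.y d) t).sub h1.hasFDerivAt).mul h2.hasFDerivAt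
  have h4 : (fun r => M.score r d j) =
      fun r => (M.y d - M.μ (M.x d) r) * M.scoreFactor j (M.x d) r := by
    funext r
    exact score_apply r d j
  have h5 := HasFDerivAt.fderiv
    (f := fun r => (M.y d - M.μ (M.x d) r) * M.scoreFactor j (M.x d) r) h3
  rw [info, Matrix.of_apply, h4, h5]
  simp
  ring

lemma measurable_info (hM : M.IsSmooth) (ht : t ∈ M.Θ) (j k : Fin p₀ ⊕ Fin q) :
    Measurable fun d => M.info t d j k := by
  simp_rw [hM.info_apply ht]
  exact (((hM.measurable_fderiv_mean ht _).mul (hM.measurable_scoreFactor ht j)).comp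
    hM.measurable_x).add ((hM.measurable_y.sub ((hM.measurable_mean t).comp hM.measurable_x)).mul
      ((hM.measurable_fderiv_scoreFactor ht j _).neg.comp hM.measurable_x))

lemma continuousAt_info (hM : M.IsSmooth) (ht : t ∈ M.Θ) (d : U) (j k : Fin p₀ ⊕ Fin q) :
    ContinuousAt (fun r => M.info r d j k) t := by
  have h := ((hM.contDiffAt_score ht j d).continuousAt_fderiv (by norm_num)).clm_apply
    (continuousAt_const (y := EuclideanSpace.single k (1 : ℝ)))
  exact h.neg

lemma hasFDerivAt_score (hM : M.IsSmooth) (ht : t ∈ M.Θ) (d : U) (j : Fin p₀ ⊕ Fin q) :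
    HasFDerivAt (fun r => M.score r d j)
      (-∑ k, M.info t d j k • EuclideanSpace.proj (𝕜 := ℝ) k) t := by
  have h := ((hM.contDiffAt_score ht j d).differentiableAt (by norm_num)).hasFDerivAt
  convert! h using 1
  refine ContinuousLinearMap.ext fun v => ?_
  have hv : v = ∑ k, v k • EuclideanSpace.single k (1 : ℝ) := by
    ext i
    rcases i with i | i <;> simp [Finset.sum_apply, Pi.single_apply]
  conv_rhs => rw [hv]
  rw [map_sum]
  simp [info, -Fintype.sum_sum_type]
  exact Finset.sum_congr rfl fun k _ => mul_comm _ _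

variable [IsProbabilityMeasure M.P]

lemma integral_score_eq_zero (hM : M.IsSmooth) (ht : t ∈ M.Θ) (hYint : Integrable M.y M.P)
    (hmean : M.P[M.y | MeasurableSpace.comap M.x inferInstance] =ᵐ[M.P] fun d => M.μ (M.x d) t)
    (hint : Integrable (M.score t) M.P) (j : Fin p₀ ⊕ Fin q) : ∫ d, M.score t d j ∂M.P = 0 := by
  have h1 : Integrable (fun d => M.score t d j) M.P :=
    (EuclideanSpace.proj (𝕜 := ℝ) j).integrable_comp hint
  simp_rw [score_apply] at h1 ⊢
  exact integral_eq_zero_of_condMean (P := M.P) (m := fun a => M.μ a t)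
    (g := fun a => M.scoreFactor j a t) hM.measurable_x hYint hmean
    (hM.measurable_scoreFactor ht j) h1

/-- The expected information at the true parameter is symmetric and positive semidefinite. -/
lemma posSemidef_expInfo (hM : M.IsSmooth) (ht : t ∈ M.Θ) (hYint : Integrable M.y M.P)
    (hmean : M.P[M.y | MeasurableSpace.comap M.x inferInstance] =ᵐ[M.P] fun d => M.μ (M.x d) t)
    (hint : ∀ j k, Integrable (fun d => M.info t d j k) M.P) : (M.expInfo t).PosSemidef := by
  have key := fun (a g : X → ℝ) (ha : Measurable a) (hg : Measurable g) =>
    integral_nonneg_of_condMean (P := M.P) (m := fun b => M.μ b t) (a := a) (g := g)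
      hM.measurable_x hYint hmean ha hg
  -- The symmetric terms cancel, and what is left is a residual times a function of `x`, of mean
  -- zero.
  have hsymm : ∀ j k, M.expInfo t j k = M.expInfo t k j := by
    intro j k
    have h0 : ∀ d, M.info t d j k - M.info t d k j = (M.y d - M.μ (M.x d) t) *
        (-fderiv ℝ (M.scoreFactor j (M.x d)) t (EuclideanSpace.single k 1) +
          fderiv ℝ (M.scoreFactor k (M.x d)) t (EuclideanSpace.single j 1)) := by
      intro d
      rw [hM.info_apply ht, hM.info_apply ht, scoreFactor, scoreFactor]
      ring
    have h1 := (hint j k).sub' (hint k j)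
    have h2 := integral_sub (hint j k) (hint k j)
    simp_rw [h0] at h1 h2
    rw [integral_eq_zero_of_condMean (P := M.P) (m := fun b => M.μ b t)
      (g := fun a => -fderiv ℝ (M.scoreFactor j a) t (EuclideanSpace.single k 1) +
          fderiv ℝ (M.scoreFactor k a) t (EuclideanSpace.single j 1))
      hM.measurable_x hYint hmean
      ((hM.measurable_fderiv_scoreFactor ht j _).neg.add (hM.measurable_fderiv_scoreFactor ht k _))
      h1] at h2
    simp only [expInfo, Matrix.of_apply]
    linarith
  refine Matrix.PosSemidef.of_dotProduct_mulVec_nonneg ?_ fun v => ?_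
  · ext j k
    simp [hsymm j k]
  -- The quadratic form is a nonnegative function of `x` plus a residual term. The two are not known
  -- to be separately integrable, hence the appeal to `integral_nonneg_of_condMean`.
  · obtain ⟨a, haeq⟩ : ∃ a : X → ℝ, a = fun b => (M.V₀ (M.μ b t))⁻¹ *
        (∑ j, v j * fderiv ℝ (M.μ b) t (EuclideanSpace.single j 1)) ^ 2 := ⟨_, rfl⟩
    obtain ⟨g, hgeq⟩ : ∃ g : X → ℝ, g = fun b => ∑ j, ∑ k, v j *
        -fderiv ℝ (M.scoreFactor j b) t (EuclideanSpace.single k 1) * v k := ⟨_, rfl⟩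
    have h0 : ∀ d, ∑ j, ∑ k, v j * M.info t d j k * v k =
        a (M.x d) + (M.y d - M.μ (M.x d) t) * g (M.x d) := by
      intro d
      rw [haeq, hgeq]
      simp only
      rw [pow_two, Finset.sum_mul_sum, Finset.mul_sum, Finset.mul_sum, ← Finset.sum_add_distrib]
      refine Finset.sum_congr rfl fun j _ => ?_
      rw [Finset.mul_sum, Finset.mul_sum, ← Finset.sum_add_distrib]
      refine Finset.sum_congr rfl fun k _ => ?_
      rw [hM.info_apply ht, scoreFactor]
      ring
    have hi : Integrable (fun d => ∑ j, ∑ k, v j * M.info t d j k * v k) M.P :=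
      integrable_finsetSum _ fun j _ => integrable_finsetSum _ fun k _ =>
        ((hint j k).const_mul _).mul_const _
    have heq : star v ⬝ᵥ (M.expInfo t *ᵥ v) =
        ∫ d, ∑ j, ∑ k, v j * M.info t d j k * v k ∂M.P := by
      rw [integral_finsetSum _ fun j _ => integrable_finsetSum _ fun k _ =>
        ((hint j k).const_mul _).mul_const _]
      simp only [dotProduct, Matrix.mulVec, star_trivial]
      refine Finset.sum_congr rfl fun j _ => ?_
      rw [integral_finsetSum _ fun k _ => ((hint j k).const_mul _).mul_const _, Finset.mul_sum]
      refine Finset.sum_congr rfl fun k _ => ?_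
      rw [integral_mul_const, integral_const_mul, expInfo, Matrix.of_apply]
      ring
    rw [heq]
    simp_rw [h0] at hi ⊢
    refine key a g ?_ ?_ ?_ hi
    · rw [haeq]
      exact (measurable_comp_of_contDiffAt (hM.measurable_mean t)
        fun a => hM.contDiffAt_variance a t ht).inv.mul
        ((Finset.measurable_sum _ fun j _ =>
          (hM.measurable_fderiv_mean ht _).const_mul _).pow_const 2)
    · rw [hgeq]
      exact Finset.measurable_sum _ fun j _ => Finset.measurable_sum _ fun k _ =>
        ((hM.measurable_fderiv_scoreFactor ht j _).neg.const_mul _).mul_const _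
    · intro b
      rw [haeq]
      exact mul_nonneg (inv_nonneg.2 (hM.variance_pos b t ht).le) (sq_nonneg _)

end IsSmooth

end Model

/-! ### Uniform convergence of the information and linearization of the score -/

namespace Model

variable {U X : Type*} [MeasurableSpace U] {p₀ q : ℕ} {M : Model U X p₀ q}

lemma wInfo_apply {N : ℕ} (s : Outcome U N) (v : Fin N → ℝ) (t : Param p₀ q)
    (j k : Fin p₀ ⊕ Fin q) :
    M.wInfo s v t j k = wMean s v fun _ d => M.info t d j k := by
  simp [wInfo, wMean, Matrix.sum_apply]

lemma wScore_apply {N : ℕ} (s : Outcome U N) (v : Fin N → ℝ) (t : Param p₀ q)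
    (j : Fin p₀ ⊕ Fin q) : M.wScore s v t j = wMean s v fun _ d => M.score t d j :=
  vMean_apply s v (M.score t) j

namespace IsSmooth

variable [MeasurableSpace X] {θ : Param p₀ q}

/-- The oscillation of the information near `θ` is dominated by a function of small mean. -/
lemma exists_oscillation_bound (hM : M.IsSmooth) {B : Set (Param p₀ q)} (hB : B ∈ 𝓝 θ)
    (hBΘ : B ⊆ M.Θ) {H : U → ℝ} (hH : Integrable H M.P)
    (hdom : ∀ᵐ d ∂M.P, ∀ t ∈ B, ∀ j k, |M.info t d j k| ≤ H d) [IsProbabilityMeasure M.P]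
    {ε : ℝ} (hε : 0 < ε) :
    ∃ δ : ℝ, 0 < δ ∧ Metric.ball θ δ ⊆ M.Θ ∧ ∃ h : U → ℝ, Measurable h ∧ Integrable h M.P ∧
      ∫ d, h d ∂M.P < ε ∧
      ∀ᵐ d ∂M.P, ∀ t ∈ Metric.ball θ δ, ∀ j k, |M.info t d j k - M.info θ d j k| ≤ h d := by
  obtain ⟨D, hDc, hDd⟩ := TopologicalSpace.exists_countable_dense (Param p₀ q)
  obtain ⟨δ₀, hδ₀, hδB⟩ := Metric.mem_nhds_iff.1 hB
  have hθB : θ ∈ B := mem_of_mem_nhds hB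
  set δ : ℕ → ℝ := fun n => δ₀ / (n + 1)
  have hδpos : ∀ n, 0 < δ n := fun n => by positivity
  have hδle : ∀ n, δ n ≤ δ₀ := fun n => div_le_self hδ₀.le (by linarith [n.cast_nonneg (α := ℝ)])
  have hδanti : Antitone δ := fun n k hnk => by
    have : (n : ℝ) ≤ k := by exact_mod_cast hnk
    exact div_le_div_of_nonneg_left hδ₀.le (by positivity) (by linarith)
  have hδlim : Tendsto δ atTop (𝓝 0) := by
    have := tendsto_one_div_add_atTop_nhds_zero_nat (𝕜 := ℝ) |>.const_mul δ₀
    rw [mul_zero] at this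
    refine this.congr fun n => ?_
    simp [δ, div_eq_mul_inv]
  have hball : ∀ n, Metric.ball θ (δ n) ⊆ B := fun n =>
    (Metric.ball_subset_ball (hδle n)).trans hδB
  obtain ⟨H', hH'm, hH'⟩ : ∃ H' : U → ℝ, Measurable H' ∧ H =ᵐ[M.P] H' :=
    ⟨hH.1.mk H, hH.1.stronglyMeasurable_mk.measurable, hH.1.ae_eq_mk⟩
  have hH'i : Integrable H' M.P := hH.congr hH'
  -- The units with large oscillation near `θ`. The countable dense set `D` makes this measurable;
  -- continuity at `θ` makes the sets decrease to `∅`, and continuity throughout the ball extends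
  -- the bound from `D`.
  set S : ℕ → Set U := fun n => {d | ∃ t ∈ D ∩ Metric.ball θ (δ n), ∃ j k,
    ε / 2 < |M.info t d j k - M.info θ d j k|} with hS
  have hSm : ∀ n, MeasurableSet (S n) := by
    intro n
    have : S n = ⋃ t ∈ D ∩ Metric.ball θ (δ n), ⋃ j, ⋃ k,
        {d | ε / 2 < |M.info t d j k - M.info θ d j k|} := by
      ext d
      simp only [hS, Set.mem_iUnion, exists_prop]
      rfl
    rw [this]
    refine MeasurableSet.biUnion (hDc.mono Set.inter_subset_left) fun t ht =>
      MeasurableSet.iUnion fun j => MeasurableSet.iUnion fun k => ?_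
    exact measurableSet_lt measurable_const
      ((hM.measurable_info (hBΘ (hball n ht.2)) j k).sub (hM.measurable_info (hBΘ hθB) j k)).abs
  have hSanti : Antitone S := by
    rintro n k hnk d ⟨t, ht, h⟩
    exact ⟨t, ⟨ht.1, Metric.ball_subset_ball (hδanti hnk) ht.2⟩, h⟩
  have hSempty : ⋂ n, S n = ∅ := by
    refine Set.eq_empty_of_forall_notMem fun d hd => ?_
    have hev : ∀ᶠ t in 𝓝 θ, ∀ j k, |M.info t d j k - M.info θ d j k| < ε / 2 := by
      refine eventually_all.2 fun j => eventually_all.2 fun k => ?_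
      have := Metric.tendsto_nhds.1 (hM.continuousAt_info (hBΘ hθB) d j k) (ε / 2) (by positivity)
      exact this
    obtain ⟨r, hr, hr'⟩ := Metric.eventually_nhds_iff_ball.1 hev
    obtain ⟨n, hn⟩ := (hδlim.eventually_lt_const hr).exists
    obtain ⟨t, ht, j, k, h⟩ := Set.mem_iInter.1 hd n
    exact absurd (hr' t (Metric.ball_subset_ball hn.le ht.2) j k) (not_lt.2 h.le)
  have hlim := tendsto_setIntegral_of_antitone hSm hSanti ⟨0, (hH'i.abs.const_mul 2).integrableOn⟩
  rw [hSempty, setIntegral_empty] at hlim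
  obtain ⟨n, hn⟩ := (hlim.eventually_lt_const (half_pos hε)).exists
  -- Off `S n` the oscillation is at most `ε / 2`; on `S n` it is at most twice the envelope, whose
  -- integral there is small.
  refine ⟨δ n, hδpos n, (hball n).trans hBΘ,
    fun d => ε / 2 + (S n).indicator (fun d => 2 * |H' d|) d,
    measurable_const.add ((hH'm.abs.const_mul 2).indicator (hSm n)),
    (integrable_const _).add ((hH'i.abs.const_mul 2).indicator (hSm n)), ?_, ?_⟩
  · rw [integral_add (integrable_const _) ((hH'i.abs.const_mul 2).indicator (hSm n)),
      integral_indicator (hSm n)]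
    simp only [integral_const, probReal_univ, one_smul]
    linarith
  · filter_upwards [hdom, hH'] with d hd hHd t ht j k
    by_cases hdS : d ∈ S n
    · rw [Set.indicator_of_mem hdS, ← hHd]
      have h1 := hd t (hball n ht) j k
      have h2 := hd θ hθB j k
      have h3 := abs_sub (M.info t d j k) (M.info θ d j k)
      linarith [le_abs_self (H d)]
    · rw [Set.indicator_of_notMem hdS, add_zero]
      have hcl : t ∈ closure (Metric.ball θ (δ n) ∩ D) :=
        hDd.open_subset_closure_inter Metric.isOpen_ball ht
      obtain ⟨r, hr, hrt⟩ := mem_closure_iff_seq_limit.1 hcl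
      have hc : Tendsto (fun i => |M.info (r i) d j k - M.info θ d j k|) atTop
          (𝓝 |M.info t d j k - M.info θ d j k|) :=
        (((hM.continuousAt_info (hBΘ (hball n ht)) d j k).tendsto.comp hrt).sub_const _).abs
      refine le_of_tendsto' hc fun i => ?_
      by_contra hlt
      exact hdS ⟨r i, ⟨(hr i).2, (hr i).1⟩, j, k, not_le.1 hlt⟩

/-- A weighted law of large numbers for the information at each point extends to a neighbourhood
of `θ`. -/
lemma eventually_wInfo_close (hM : M.IsSmooth) {B : Set (Param p₀ q)} (hB : B ∈ 𝓝 θ)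
    (hBΘ : B ⊆ M.Θ) {H : U → ℝ} (hH : Integrable H M.P)
    (hdom : ∀ᵐ d ∂M.P, ∀ t ∈ B, ∀ j k, |M.info t d j k| ≤ H d) [IsProbabilityMeasure M.P]
    {ε : ℝ} (hε : 0 < ε) :
    ∃ δ : ℝ, 0 < δ ∧ Metric.ball θ δ ⊆ M.Θ ∧
      ∀ {α : Type _} (F : Filter α) (n : α → ℕ) (s : ∀ a, Outcome U (n a)) (v : ∀ a, Fin (n a) → ℝ),
        (∀ a i, 0 ≤ v a i) →
        (∀ h : U → ℝ, Measurable h → Integrable h M.P →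
          Tendsto (fun a => wMean (s a) (v a) fun _ => h) F (𝓝 (∫ d, h d ∂M.P))) →
        (∀ r : U → Prop, (∀ᵐ d ∂M.P, r d) → ∀ᶠ a in F, ∀ i, r (s a i).1) →
        ∀ᶠ a in F, ∀ t ∈ Metric.ball θ δ, ∀ j k,
          |M.wInfo (s a) (v a) t j k - M.expInfo θ j k| ≤ ε := by
  obtain ⟨δ, hδ, hδΘ, h, hm, hi, hlt, hosc⟩ :=
    hM.exists_oscillation_bound hB hBΘ hH hdom (half_pos hε)
  have hθ : θ ∈ M.Θ := hδΘ (Metric.mem_ball_self hδ)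
  have hinfo : ∀ j k, Integrable (fun d => M.info θ d j k) M.P := fun j k =>
    hH.mono' (hM.measurable_info hθ j k).aestronglyMeasurable
      (hdom.mono fun d hd => hd θ (mem_of_mem_nhds hB) j k)
  -- The radius is fixed before the filter and the weights, so the same ball can serve both the
  -- sample and the bootstrap.
  refine ⟨δ, hδ, hδΘ, fun {α} F n s v hv hlln hae => ?_⟩
  have h1 := (hlln h hm hi).eventually_lt_const hlt
  have h2 : ∀ᶠ a in F, ∀ j k, |M.wInfo (s a) (v a) θ j k - M.expInfo θ j k| < ε / 2 := by
    refine eventually_all.2 fun j => eventually_all.2 fun k => ?_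
    have := Metric.tendsto_nhds.1 (hlln _ (hM.measurable_info hθ j k) (hinfo j k)) (ε / 2)
      (half_pos hε)
    simp_rw [wInfo_apply]
    exact this
  filter_upwards [h1, h2, hae _ hosc] with a h1 h2 h3 t ht j k
  have h4 : |M.wInfo (s a) (v a) t j k - M.wInfo (s a) (v a) θ j k| ≤
      wMean (s a) (v a) fun _ => h := by
    rw [wInfo_apply, wInfo_apply, ← wMean_sub, wMean, wMean, abs_mul,
      abs_of_nonneg (by positivity : (0 : ℝ) ≤ (n a : ℝ)⁻¹)]
    refine mul_le_mul_of_nonneg_left ((Finset.abs_sum_le_sum_abs _ _).trans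
      (Finset.sum_le_sum fun i _ => ?_)) (by positivity)
    rw [abs_mul, abs_of_nonneg (hv a i)]
    exact mul_le_mul_of_nonneg_left (h3 i t ht j k) (hv a i)
  calc _ ≤ |M.wInfo (s a) (v a) t j k - M.wInfo (s a) (v a) θ j k| +
        |M.wInfo (s a) (v a) θ j k - M.expInfo θ j k| := abs_sub_le _ _ _
    _ ≤ ε := by linarith [h2 j k]

lemma hasFDerivAt_wScore (hM : M.IsSmooth) {t : Param p₀ q} (ht : t ∈ M.Θ) {N : ℕ}
    (s : Outcome U N) (v : Fin N → ℝ) (j : Fin p₀ ⊕ Fin q) :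
    HasFDerivAt (fun r => M.wScore s v r j)
      (-∑ k, M.wInfo s v t j k • EuclideanSpace.proj (𝕜 := ℝ) k) t := by
  have h := (HasFDerivAt.fun_sum (u := sample s) fun i _ =>
    (hM.hasFDerivAt_score ht (s i).1 j).const_mul (v i)).const_mul (N : ℝ)⁻¹
  simp_rw [wScore_apply, wMean]
  convert! h using 1
  simp_rw [wInfo_apply, wMean, smul_neg, Finset.sum_neg_distrib, smul_neg, Finset.smul_sum,
    Finset.mul_sum, Finset.sum_smul, smul_smul]
  rw [Finset.sum_comm]

/-- If the weighted information is uniformly close to a matrix `A`, then the weighted score is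
approximately affine with linear part `-A`. -/
lemma norm_wScore_sub_le (hM : M.IsSmooth) {A : Matrix (Fin p₀ ⊕ Fin q) (Fin p₀ ⊕ Fin q) ℝ}
    {δ ε : ℝ} (hδ : Metric.ball θ δ ⊆ M.Θ) {N : ℕ} {s : Outcome U N} {v : Fin N → ℝ}
    (hclose : ∀ t ∈ Metric.ball θ δ, ∀ j k, |M.wInfo s v t j k - A j k| ≤ ε)
    {t t' : Param p₀ q} (ht : t ∈ Metric.ball θ δ) (ht' : t' ∈ Metric.ball θ δ) :
    ‖M.wScore s v t - M.wScore s v t' + Matrix.toEuclideanCLM (𝕜 := ℝ) A (t - t')‖ ≤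
      (p₀ + q) ^ 2 * ε * ‖t - t'‖ := by
  have hcoord : ∀ j, |(M.wScore s v t - M.wScore s v t' +
      Matrix.toEuclideanCLM (𝕜 := ℝ) A (t - t')) j| ≤ (p₀ + q) * ε * ‖t - t'‖ := by
    intro j
    -- Adding the linear map `A` leaves a derivative with entries at most `ε`, and the mean value
    -- inequality on the convex ball applies. One factor `p₀ + q` comes from a row, the other from
    -- summing coordinates.
    have hd : ∀ r ∈ Metric.ball θ δ, HasFDerivWithinAt
        (fun r => M.wScore s v r j + ∑ k, A j k * EuclideanSpace.proj (𝕜 := ℝ) k r)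
        (-∑ k, M.wInfo s v r j k • EuclideanSpace.proj (𝕜 := ℝ) k +
          ∑ k, A j k • EuclideanSpace.proj (𝕜 := ℝ) k) (Metric.ball θ δ) r := by
      intro r hr
      exact ((hM.hasFDerivAt_wScore (hδ hr) s v j).add (HasFDerivAt.fun_sum fun k _ =>
        (EuclideanSpace.proj (𝕜 := ℝ) k).hasFDerivAt.const_mul _)).hasFDerivWithinAt
    have hb : ∀ r ∈ Metric.ball θ δ, ‖-∑ k, M.wInfo s v r j k • EuclideanSpace.proj (𝕜 := ℝ) k +
          ∑ k, A j k • (EuclideanSpace.proj (𝕜 := ℝ) k : Param p₀ q →L[ℝ] ℝ)‖ ≤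
        (p₀ + q) * ε := by
      intro r hr
      rw [← sub_eq_neg_add, ← Finset.sum_sub_distrib]
      simp_rw [← sub_smul]
      refine (norm_sum_le _ _).trans ?_
      have : ∀ k ∈ Finset.univ, ‖(A j k - M.wInfo s v r j k) •
          (EuclideanSpace.proj (𝕜 := ℝ) k : Param p₀ q →L[ℝ] ℝ)‖ ≤ ε := by
        intro k _
        rw [norm_smul, Real.norm_eq_abs, abs_sub_comm]
        have h1 : ‖(EuclideanSpace.proj (𝕜 := ℝ) k : Param p₀ q →L[ℝ] ℝ)‖ ≤ 1 :=
          ContinuousLinearMap.opNorm_le_bound _ zero_le_one fun x => by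
            rw [one_mul]
            exact PiLp.norm_apply_le x k
        exact (mul_le_of_le_one_right (abs_nonneg _) h1).trans (hclose r hr j k)
      refine (Finset.sum_le_card_nsmul _ _ _ this).trans (le_of_eq ?_)
      simp
    have h := (convex_ball θ δ).norm_image_sub_le_of_norm_hasFDerivWithin_le hd hb ht' ht
    rw [Real.norm_eq_abs] at h
    convert h using 2
    simp [Matrix.mulVec, dotProduct, -Fintype.sum_sum_type]
    ring
  set x := M.wScore s v t - M.wScore s v t' + Matrix.toEuclideanCLM (𝕜 := ℝ) A (t - t')
  have hx : x = ∑ k, x k • EuclideanSpace.single k (1 : ℝ) := by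
    ext i
    rcases i with i | i <;> simp [Finset.sum_apply, Pi.single_apply]
  calc ‖x‖ = ‖∑ k, x k • EuclideanSpace.single k (1 : ℝ)‖ := by rw [← hx]
    _ ≤ ∑ k, |x k| := (norm_sum_le _ _).trans (Finset.sum_le_sum fun k _ => by
        rw [norm_smul]; simp)
    _ ≤ ∑ _k : Fin p₀ ⊕ Fin q, (p₀ + q) * ε * ‖t - t'‖ := Finset.sum_le_sum fun k _ => hcoord k
    _ = (p₀ + q) ^ 2 * ε * ‖t - t'‖ := by
        simp only [Finset.sum_const, Finset.card_univ, Fintype.card_sum, Fintype.card_fin,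
          nsmul_eq_mul]
        push_cast
        ring

end IsSmooth

end Model

/-! ### Roots of approximately affine maps -/

section Roots

variable {W : Type*} [NormedAddCommGroup W] [NormedSpace ℝ W] [CompleteSpace W]

/-- An approximately affine map has a zero close to a point where it is small. -/
lemma exists_root_of_approx (T : W ≃L[ℝ] W) {K c δ : ℝ} (hK : ∀ w, ‖T.symm w‖ ≤ K * ‖w‖)
    (hK0 : 0 ≤ K) (hcK : K * c ≤ 1 / 2) {f : W → W} {w₀ : W}
    (hδ : 2 * K * ‖f w₀‖ ≤ δ)
    (hf : ∀ w ∈ Metric.closedBall w₀ δ, ∀ w' ∈ Metric.closedBall w₀ δ,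
      ‖f w - f w' + T (w - w')‖ ≤ c * ‖w - w'‖) :
    ∃ w, ‖w - w₀‖ ≤ 2 * K * ‖f w₀‖ ∧ f w = 0 := by
  set r := 2 * K * ‖f w₀‖ with hr
  have hr0 : 0 ≤ r := by positivity
  -- Newton's map with the derivative frozen at `-T`. As `K c ≤ 1 / 2` it contracts by `1 / 2`, and
  -- its first step has length at most `r / 2`, so it preserves the closed ball.
  set g : W → W := fun w => w + T.symm (f w) with hg
  have hgd : ∀ w ∈ Metric.closedBall w₀ r, ∀ w' ∈ Metric.closedBall w₀ r,
      ‖g w - g w'‖ ≤ 1 / 2 * ‖w - w'‖ := by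
    intro w hw w' hw'
    have h1 : g w - g w' = T.symm (f w - f w' + T (w - w')) := by
      simp only [hg, map_add, map_sub, T.symm_apply_apply]
      abel
    rw [h1]
    calc _ ≤ K * ‖f w - f w' + T (w - w')‖ := hK _
      _ ≤ K * (c * ‖w - w'‖) := mul_le_mul_of_nonneg_left
          (hf w (Metric.closedBall_subset_closedBall hδ hw) w'
            (Metric.closedBall_subset_closedBall hδ hw')) hK0
      _ = K * c * ‖w - w'‖ := by ring
      _ ≤ _ := by gcongr
  have hw₀ : w₀ ∈ Metric.closedBall w₀ r := Metric.mem_closedBall_self hr0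
  have hmaps : Set.MapsTo g (Metric.closedBall w₀ r) (Metric.closedBall w₀ r) := by
    intro w hw
    have h1 := hgd w hw w₀ hw₀
    have h2 : ‖g w₀ - w₀‖ ≤ r / 2 := by
      simp only [hg, add_sub_cancel_left]
      refine (hK _).trans (le_of_eq ?_)
      rw [hr]
      ring
    rw [mem_closedBall_iff_norm] at hw ⊢
    have h3 := norm_sub_le_norm_sub_add_norm_sub (g w) (g w₀) w₀
    linarith
  have hcontr : ContractingWith (1 / 2) (hmaps.restrict g _ _) := by
    refine ⟨by rw [← NNReal.coe_lt_coe]; norm_num, LipschitzWith.of_dist_le_mul fun x y => ?_⟩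
    have h := hgd x x.2 y y.2
    rw [Subtype.dist_eq, Subtype.dist_eq, dist_eq_norm, dist_eq_norm]
    have he : ((1 / 2 : NNReal) : ℝ) = 1 / 2 := by norm_num
    rw [he]
    exact h
  obtain ⟨w, hw, hfix, -⟩ := ContractingWith.exists_fixedPoint' (s := Metric.closedBall w₀ r)
    Metric.isClosed_closedBall.isComplete hmaps hcontr hw₀ (edist_ne_top _ _)
  refine ⟨w, mem_closedBall_iff_norm.1 hw, ?_⟩
  have h1 : w + T.symm (f w) = w := hfix
  rw [add_eq_left] at h1
  simpa using h1

variable {E E' : Type*} [NormedAddCommGroup E] [NormedSpace ℝ E] [CompleteSpace E]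
  [NormedAddCommGroup E'] [NormedSpace ℝ E']

/-- Let `S` and `S'` be approximately affine near `θ`, with linear part `-A`, let `t` be the
zero of `S`, and let `t' = t + J w` be the point of the affine space `t + J W` where the component
`R S'` vanishes. Then `S'(t')` is approximately a linear function of `S'(θ) - S(θ)`. -/
lemma exists_constrained_root_expansion (A : E ≃L[ℝ] E) (J : W →L[ℝ] E) (hJ : ∀ w, ‖J w‖ ≤ ‖w‖)
    (R : E →L[ℝ] W) (hR : ∀ x, ‖R x‖ ≤ ‖x‖) (A₁ : W ≃L[ℝ] W) (hA₁ : ∀ w, A₁ w = R (A (J w)))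
    (Q L : E →L[ℝ] E') (hL : ∀ w, L (A (J w)) = 0) (hQL : ∀ x, R x = 0 → Q x = L x) :
    ∃ C c₀ : ℝ, 0 < C ∧ 0 < c₀ ∧ ∀ (S S' : E → E) (θ t : E) (w : W) (δ c : ℝ), 0 ≤ c → c ≤ c₀ →
      (∀ x ∈ Metric.ball θ δ, ∀ y ∈ Metric.ball θ δ, ‖S x - S y + A (x - y)‖ ≤ c * ‖x - y‖) →
      (∀ x ∈ Metric.ball θ δ, ∀ y ∈ Metric.ball θ δ, ‖S' x - S' y + A (x - y)‖ ≤ c * ‖x - y‖) →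
      C * (‖S θ‖ + ‖S' θ - S θ‖) < δ →
      S t = 0 → (∀ x ∈ Metric.ball θ δ, S x = 0 → x = t) →
      R (S' (t + J w)) = 0 →
      (∀ w', t + J w' ∈ Metric.ball θ δ → R (S' (t + J w')) = 0 → w' = w) →
      t + J w ∈ Metric.ball θ δ ∧
      ‖Q (S' (t + J w)) - L (S' θ - S θ)‖ ≤ C * c * (‖S θ‖ + ‖S' θ - S θ‖) := by
  obtain ⟨K, hK1, hKA⟩ : ∃ K : ℝ, 1 ≤ K ∧ ∀ x, ‖A.symm x‖ ≤ K * ‖x‖ := by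
    refine ⟨‖(A.symm : E →L[ℝ] E)‖ + 1, by linarith [norm_nonneg (A.symm : E →L[ℝ] E)],
      fun x => ?_⟩
    have := (A.symm : E →L[ℝ] E).le_opNorm x
    have h2 := norm_nonneg x
    rw [ContinuousLinearEquiv.coe_coe] at this
    linarith
  obtain ⟨K₁, hK₁1, hKA₁⟩ : ∃ K : ℝ, 1 ≤ K ∧ ∀ x, ‖A₁.symm x‖ ≤ K * ‖x‖ := by
    refine ⟨‖(A₁.symm : W →L[ℝ] W)‖ + 1, by linarith [norm_nonneg (A₁.symm : W →L[ℝ] W)],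
      fun x => ?_⟩
    have := (A₁.symm : W →L[ℝ] W).le_opNorm x
    have h2 := norm_nonneg x
    rw [ContinuousLinearEquiv.coe_coe] at this
    linarith
  -- With `m` the size of the data, `2 K m` bounds `‖t - θ‖` and `2 K₁ (1 + 4 K) m` bounds `‖w‖`;
  -- their sum `C₀ m` must stay below `δ`.
  set C₀ : ℝ := 2 * K + 2 * K₁ * (1 + 4 * K)
  have hC₀ : 2 * K + 2 * K₁ ≤ C₀ := by
    have : 0 ≤ K₁ * K := by positivity
    simp only [C₀]
    nlinarith
  have hl := norm_nonneg L
  refine ⟨C₀ * (2 * (‖L‖ + 1)) , min 1 (1 / (2 * (K + K₁))), by positivity, by positivity, ?_⟩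
  intro S S' θ t w δ c hc0 hc hS hS' hδ ht htu hw hwu
  have hc1 : c ≤ 1 := hc.trans (min_le_left _ _)
  have hcK : (K + K₁) * c ≤ 1 / 2 := by
    have h1 := hc.trans (min_le_right _ _)
    rw [le_div_iff₀ (by positivity)] at h1
    linarith
  have hcKA : K * c ≤ 1 / 2 := by nlinarith
  have hcKA₁ : K₁ * c ≤ 1 / 2 := by nlinarith
  set m := ‖S θ‖ + ‖S' θ - S θ‖ with hm
  have ha := norm_nonneg (S θ)
  have hb := norm_nonneg (S' θ - S θ)
  have hm0 : 0 ≤ m := by positivity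
  have hC₀m : C₀ * m < δ := by
    refine lt_of_le_of_lt ?_ hδ
    have : 0 ≤ C₀ * m := by positivity
    nlinarith
  have hδ0 : 0 < δ := lt_of_le_of_lt (by positivity) hC₀m
  have hθb : θ ∈ Metric.ball θ δ := Metric.mem_ball_self hδ0
  -- Nothing places `t` near `θ` beforehand: the contraction produces a zero nearby, and uniqueness
  -- in the ball identifies it with `t`. The same device bounds `w` below.
  have htθ : ‖t - θ‖ ≤ 2 * K * m := by
    obtain ⟨x, hx1, hx2⟩ := exists_root_of_approx A (c := c) (δ := 2 * K * ‖S θ‖) (f := S)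
      (w₀ := θ) hKA (by linarith) hcKA le_rfl (by
        have hsub : Metric.closedBall θ (2 * K * ‖S θ‖) ⊆ Metric.ball θ δ := by
          refine Metric.closedBall_subset_ball (lt_of_le_of_lt ?_ hC₀m)
          gcongr
          · linarith
          · linarith
        exact fun x hx y hy => hS x (hsub hx) y (hsub hy))
    have h1 : 2 * K * ‖S θ‖ ≤ 2 * K * m := by
      gcongr
      linarith
    have hxb : x ∈ Metric.ball θ δ := by
      rw [mem_ball_iff_norm]
      refine lt_of_le_of_lt (hx1.trans h1) (lt_of_le_of_lt ?_ hC₀m)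
      gcongr
      linarith
    rw [← htu x hxb hx2]
    exact hx1.trans h1
  have htb : t ∈ Metric.ball θ δ := by
    rw [mem_ball_iff_norm]
    refine lt_of_le_of_lt htθ (lt_of_le_of_lt ?_ hC₀m)
    gcongr
    linarith
  have he₂ := hS' t htb θ hθb
  have he₃ := hS t htb θ hθb
  set e₂ := S' t - S' θ + A (t - θ) with he₂d
  set e₃ := S t - S θ + A (t - θ) with he₃d
  have hS't : S' t = S' θ - S θ + (e₂ - e₃) := by
    rw [he₂d, he₃d, ht]
    abel
  have he₂₃ : ‖e₂ - e₃‖ ≤ c * (4 * K * m) := by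
    have := norm_sub_le e₂ e₃
    have : c * ‖t - θ‖ ≤ c * (2 * K * m) := by gcongr
    linarith
  have hS'tn : ‖S' t‖ ≤ (1 + 4 * K) * m := by
    rw [hS't]
    have h1 := norm_add_le (S' θ - S θ) (e₂ - e₃)
    have h2 : c * (4 * K * m) ≤ 1 * (4 * K * m) := by gcongr
    linarith
  have hwn : ‖w‖ ≤ 2 * K₁ * ((1 + 4 * K) * m) := by
    have hball : ∀ w' : W, ‖w'‖ ≤ 2 * K₁ * ((1 + 4 * K) * m) → t + J w' ∈ Metric.ball θ δ := by
      intro w' hw'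
      rw [mem_ball_iff_norm]
      refine lt_of_le_of_lt ?_ hC₀m
      calc ‖t + J w' - θ‖ = ‖(t - θ) + J w'‖ := by congr 1; abel
        _ ≤ ‖t - θ‖ + ‖J w'‖ := norm_add_le _ _
        _ ≤ 2 * K * m + 2 * K₁ * ((1 + 4 * K) * m) := add_le_add htθ ((hJ _).trans hw')
        _ = C₀ * m := by ring
    have h0 : ‖R (S' (t + J 0))‖ ≤ (1 + 4 * K) * m := by
      rw [map_zero, add_zero]
      exact (hR _).trans hS'tn
    obtain ⟨x, hx1, hx2⟩ := exists_root_of_approx A₁ (c := c)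
      (δ := 2 * K₁ * ((1 + 4 * K) * m)) (f := fun w => R (S' (t + J w)))
      (w₀ := 0) hKA₁ (by linarith) hcKA₁ (by gcongr) (by
        intro x hx y hy
        rw [mem_closedBall_zero_iff] at hx hy
        have h1 := hS' _ (hball x hx) _ (hball y hy)
        have h2 : R (S' (t + J x)) - R (S' (t + J y)) + A₁ (x - y) =
            R (S' (t + J x) - S' (t + J y) + A (t + J x - (t + J y))) := by
          rw [hA₁, map_add, map_sub R (S' _), add_sub_add_left_eq_sub, map_sub J]
        rw [h2]
        refine (hR _).trans (h1.trans ?_)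
        rw [add_sub_add_left_eq_sub, ← map_sub]
        exact mul_le_mul_of_nonneg_left (hJ _) hc0)
    rw [sub_zero] at hx1
    have hx3 : ‖x‖ ≤ 2 * K₁ * ((1 + 4 * K) * m) := hx1.trans (by gcongr)
    rw [← hwu x (hball x hx3) hx2]
    exact hx3
  have hwb : t + J w ∈ Metric.ball θ δ := by
    rw [mem_ball_iff_norm]
    refine lt_of_le_of_lt ?_ hC₀m
    calc ‖t + J w - θ‖ = ‖(t - θ) + J w‖ := by congr 1; abel
      _ ≤ ‖t - θ‖ + ‖J w‖ := norm_add_le _ _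
      _ ≤ 2 * K * m + 2 * K₁ * ((1 + 4 * K) * m) := add_le_add htθ ((hJ _).trans hwn)
      _ = C₀ * m := by ring
  refine ⟨hwb, ?_⟩
  have he₁ := hS' _ hwb t htb
  rw [add_sub_cancel_left] at he₁
  set e₁ := S' (t + J w) - S' t + A (J w) with he₁d
  -- The constraint permits replacing `Q` by `L`, and `L` annihilates `A (J w)`. The displacement
  -- `w` thus leaves no first-order trace, and only the three linearization errors remain.
  have hfin : Q (S' (t + J w)) - L (S' θ - S θ) = L (e₁ + (e₂ - e₃)) := by
    rw [hQL _ hw]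
    have h1 : S' (t + J w) = e₁ - A (J w) + (S' θ - S θ + (e₂ - e₃)) := by
      rw [← hS't, he₁d]
      abel
    rw [h1]
    simp only [map_add, map_sub, hL]
    abel
  rw [hfin]
  have he₁n : ‖e₁‖ ≤ c * (2 * K₁ * ((1 + 4 * K) * m)) :=
    he₁.trans (mul_le_mul_of_nonneg_left ((hJ _).trans hwn) hc0)
  have hen : ‖e₁ + (e₂ - e₃)‖ ≤ c * (2 * (C₀ * m)) := by
    refine (norm_add_le _ _).trans ?_
    have h1 : c * (2 * K₁ * ((1 + 4 * K) * m)) + c * (4 * K * m) ≤ c * (2 * (C₀ * m)) := by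
      rw [← mul_add]
      refine mul_le_mul_of_nonneg_left ?_ hc0
      have : 0 ≤ 2 * K₁ * ((1 + 4 * K) * m) := by positivity
      have h3 : C₀ * m = 2 * K * m + 2 * K₁ * ((1 + 4 * K) * m) := by ring
      rw [h3]
      linarith
    linarith
  calc ‖L (e₁ + (e₂ - e₃))‖ ≤ ‖L‖ * ‖e₁ + (e₂ - e₃)‖ := L.le_opNorm _
    _ ≤ (‖L‖ + 1) * (c * (2 * (C₀ * m))) := by gcongr; linarith
    _ = _ := by ring

end Roots

/-! ### Schur complements and simultaneous diagonalization -/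

section LinearAlgebra

open Matrix
open scoped MatrixOrder

variable {p₀ q : ℕ}

/-- The matrix `(-M₂₁ M₁₁⁻¹, 1)`, which projects out the first block of `M`. -/
def residualMatrix (M : Matrix (Fin p₀ ⊕ Fin q) (Fin p₀ ⊕ Fin q) ℝ) :
    Matrix (Fin q) (Fin p₀ ⊕ Fin q) ℝ :=
  fromCols (-(M.toBlocks₂₁ * M.toBlocks₁₁⁻¹)) 1

variable {M V : Matrix (Fin p₀ ⊕ Fin q) (Fin p₀ ⊕ Fin q) ℝ}

lemma posDef_toBlocks₁₁ (hM : M.PosDef) : M.toBlocks₁₁.PosDef :=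
  hM.submatrix Sum.inl_injective

/-- One step of block elimination. The zero block is what makes the estimation of the first
component invisible at first order. -/
lemma residualMatrix_mul (hM : M.PosDef) : residualMatrix M * M = fromCols 0 (schur M) := by
  have h1 : M.toBlocks₁₁⁻¹ * M.toBlocks₁₁ = 1 :=
    nonsing_inv_mul _ ((isUnit_iff_isUnit_det _).1 (posDef_toBlocks₁₁ hM).isUnit)
  conv_lhs => rw [← fromBlocks_toBlocks M]
  rw [residualMatrix, toBlocks_fromBlocks₂₁, toBlocks_fromBlocks₁₁, fromCols_mul_fromBlocks]
  congr 1
  · rw [Matrix.neg_mul, Matrix.mul_assoc, h1]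
    simp
  · rw [schur, Matrix.neg_mul, Matrix.one_mul, sub_eq_neg_add]

/-- The identity block gives `residualMatrix M` full row rank, whatever `M` is. -/
lemma posDef_residualMatrix_mul (hV : V.PosDef) :
    (residualMatrix M * V * (residualMatrix M)ᵀ).PosDef := by
  have h := hV.conjTranspose_mul_mul_same (B := (residualMatrix M)ᵀ) (by
    intro x y hxy
    have h2 : ∀ x : Fin q → ℝ, (fun j => ((residualMatrix M)ᵀ *ᵥ x) (Sum.inr j)) = x := by
      intro x
      rw [residualMatrix, transpose_fromCols, fromRows_mulVec]
      simp
    rw [← h2 x, hxy, h2 y])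
  simpa using h

lemma schur_eq_mul (hM : M.PosDef) : residualMatrix M * M * (residualMatrix M)ᵀ = schur M := by
  rw [residualMatrix_mul hM, residualMatrix, transpose_fromCols, fromCols_mul_fromRows]
  simp

lemma posDef_schur (hM : M.PosDef) : (schur M).PosDef := by
  rw [← schur_eq_mul hM]
  exact posDef_residualMatrix_mul hM

/-- With `E = (0, 1)`, elimination reads `L = M₂₂.₁ E M⁻¹`. Substituting this in the covariance `L V
Lᵀ` links the matrix of the limiting quadratic form with the one built from the sandwich variance.
-/
lemma toBlocks₂₂_sandwich_mul_schur (hM : M.PosDef) :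
    (M⁻¹ * V * (M⁻¹)ᵀ).toBlocks₂₂ * schur M =
      (schur M)⁻¹ * (residualMatrix M * V * (residualMatrix M)ᵀ) := by
  have hS : IsUnit (schur M).det := (isUnit_iff_isUnit_det _).1 (posDef_schur hM).isUnit
  have hMu : IsUnit M.det := (isUnit_iff_isUnit_det _).1 hM.isUnit
  have hsymm : (schur M)ᵀ = schur M := by
    simpa using (posDef_schur hM).isHermitian.eq
  set E : Matrix (Fin q) (Fin p₀ ⊕ Fin q) ℝ := fromCols 0 1
  have h1 : residualMatrix M = schur M * E * M⁻¹ := by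
    have : fromCols 0 (schur M) = schur M * E := by simp [E, mul_fromCols]
    rw [← this, ← residualMatrix_mul hM, Matrix.mul_assoc, mul_nonsing_inv _ hMu, Matrix.mul_one]
  have h2 : ∀ X : Matrix (Fin p₀ ⊕ Fin q) (Fin p₀ ⊕ Fin q) ℝ, X.toBlocks₂₂ = E * X * Eᵀ := by
    intro X
    conv_rhs => rw [← fromBlocks_toBlocks X]
    simp [E, transpose_fromCols, fromCols_mul_fromBlocks, fromCols_mul_fromRows]
  rw [h2]
  have h3 : (residualMatrix M)ᵀ = (M⁻¹)ᵀ * Eᵀ * schur M := by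
    rw [h1, transpose_mul, transpose_mul, hsymm, Matrix.mul_assoc]
  rw [h3, h1]
  simp only [Matrix.mul_assoc]
  rw [nonsing_inv_mul_cancel_left _ _ hS]

/-- Simultaneous diagonalization of two positive definite matrices. -/
lemma exists_simultaneous_diagonalization {S D : Matrix (Fin q) (Fin q) ℝ} (hS : S.PosDef)
    (hD : D.PosDef) :
    ∃ (c : Fin q → ℝ) (Λ : Matrix (Fin q) (Fin q) ℝ), Antitone c ∧ (∀ i, 0 < c i) ∧
      Λᵀ * Λ = S ∧ Λ * D * Λᵀ = diagonal c ∧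
      (S * D).charpoly = ∏ i, (Polynomial.X - Polynomial.C (c i)) := by
  -- Diagonalizing `T D Tᵀ = O diag(l) Oᵀ` gives `Λ = Oᵀ T` up to a permutation `σ` that orders the
  -- eigenvalues. Cyclic invariance of the characteristic polynomial passes from `T D Tᵀ` to `Tᵀ T D
  -- = S D`.
  obtain ⟨T, hT⟩ : ∃ T : Matrix (Fin q) (Fin q) ℝ, S = Tᵀ * T := by
    refine ⟨CFC.sqrt S, ?_⟩
    have h1 : (CFC.sqrt S)ᵀ = CFC.sqrt S := by
      rw [← conjTranspose_eq_transpose_of_trivial]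
      exact (CFC.sqrt_nonneg S).isSelfAdjoint
    rw [h1, CFC.sqrt_mul_sqrt_self _ hS.posSemidef.nonneg]
  have hTu : IsUnit T := by
    have h1 := (isUnit_iff_isUnit_det _).1 hS.isUnit
    rw [hT, det_mul] at h1
    exact (isUnit_iff_isUnit_det _).2 (isUnit_of_mul_isUnit_right h1)
  have hH : (T * D * Tᵀ).PosDef := by
    have := hD.mul_mul_conjTranspose_same (B := T) (vecMul_injective_of_isUnit hTu)
    rwa [conjTranspose_eq_transpose_of_trivial] at this
  set O : Matrix (Fin q) (Fin q) ℝ := ↑hH.isHermitian.eigenvectorUnitary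
  set l := hH.isHermitian.eigenvalues
  have hOO : O * Oᵀ = 1 := by
    have := Unitary.mul_star_self_of_mem hH.isHermitian.eigenvectorUnitary.2
    rwa [star_eq_conjTranspose, conjTranspose_eq_transpose_of_trivial] at this
  have hOO' : Oᵀ * O = 1 := by
    have := Unitary.star_mul_self_of_mem hH.isHermitian.eigenvectorUnitary.2
    rwa [star_eq_conjTranspose, conjTranspose_eq_transpose_of_trivial] at this
  have hspec : Oᵀ * (T * D * Tᵀ) * O = diagonal l := by
    have h1 : T * D * Tᵀ = O * diagonal l * Oᵀ := by
      have h := hH.isHermitian.spectral_theorem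
      rw [Unitary.conjStarAlgAut_apply, star_eq_conjTranspose,
        conjTranspose_eq_transpose_of_trivial] at h
      exact h
    rw [h1]
    simp only [Matrix.mul_assoc]
    rw [hOO', Matrix.mul_one, ← Matrix.mul_assoc, hOO', Matrix.one_mul]
  set σ : Equiv.Perm (Fin q) := Tuple.sort fun i => -l i
  have hσ : Antitone (l ∘ σ) := by
    intro i j hij
    have := Tuple.monotone_sort (fun i => -l i) hij
    simpa using this
  refine ⟨l ∘ σ, (Oᵀ * T).submatrix σ id, hσ, fun i => hH.eigenvalues_pos _, ?_, ?_, ?_⟩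
  · rw [transpose_submatrix, submatrix_mul_equiv, submatrix_id_id, transpose_mul,
      transpose_transpose, Matrix.mul_assoc, ← Matrix.mul_assoc O, hOO, Matrix.one_mul, hT]
  · have h1 : (Oᵀ * T).submatrix σ id * D * ((Oᵀ * T).submatrix σ id)ᵀ =
        (Oᵀ * T * D * (Oᵀ * T)ᵀ).submatrix σ σ := by
      ext i j
      simp [Matrix.mul_apply]
    have h2 : Oᵀ * T * D * (Oᵀ * T)ᵀ = diagonal l := by
      rw [← hspec, transpose_mul, transpose_transpose]
      simp only [Matrix.mul_assoc]
    rw [h1, h2, submatrix_diagonal_equiv]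
  · have h1 : (S * D).charpoly = (T * D * Tᵀ).charpoly := by
      rw [hT, Matrix.mul_assoc, charpoly_mul_comm]
    rw [h1, hH.isHermitian.charpoly_eq]
    exact (Equiv.prod_comp σ fun i => Polynomial.X - Polynomial.C (l i)).symm

end LinearAlgebra

/-! ### Quadratic forms in Gaussian vectors -/

section GaussianQuadraticForm

open Matrix

variable {ι : Type*} [Fintype ι] [DecidableEq ι] {q : ℕ}

/-- The law of a quadratic form in a centred Gaussian vector. -/
lemma map_multivariateGaussian_eq_weightedChiSq {V : Matrix ι ι ℝ} (hV : V.PosSemidef)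
    {B : Matrix (Fin q) ι ℝ} {c : Fin q → ℝ} (hc : ∀ i, 0 ≤ c i)
    (hB : B * V * Bᵀ = diagonal c) :
    (multivariateGaussian (0 : EuclideanSpace ℝ ι) V).map
      (fun z : EuclideanSpace ℝ ι => ∑ i, (B *ᵥ (z : ι → ℝ)) i ^ 2) = weightedChiSq c := by
  set f : EuclideanSpace ℝ ι → EuclideanSpace ℝ (Fin q) := fun z => WithLp.toLp 2 (B *ᵥ (z : ι → ℝ))
  set g : EuclideanSpace ℝ (Fin q) → EuclideanSpace ℝ (Fin q) :=
    fun w => WithLp.toLp 2 fun i => √(c i) * w i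
  have hf : Measurable f := by
    refine (MeasurableEquiv.toLp 2 (Fin q → ℝ)).measurable.comp (measurable_pi_iff.2 fun i => ?_)
    simp only [mulVec, dotProduct]
    fun_prop
  have hg : Measurable g := by
    refine (MeasurableEquiv.toLp 2 (Fin q → ℝ)).measurable.comp (measurable_pi_iff.2 fun i => ?_)
    fun_prop
  -- `B z` and the vector of the `√(c i) w i` are both centred Gaussian with covariance `diag(c)`;
  -- equality of the laws is read off the characteristic functions.
  have hlaw : (multivariateGaussian (0 : EuclideanSpace ℝ ι) V).map f =
      (stdGaussian (EuclideanSpace ℝ (Fin q))).map g := by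
    have := Measure.isProbabilityMeasure_map (μ := multivariateGaussian (0 : EuclideanSpace ℝ ι) V)
      hf.aemeasurable
    have := Measure.isProbabilityMeasure_map (μ := stdGaussian (EuclideanSpace ℝ (Fin q)))
      hg.aemeasurable
    refine Measure.ext_of_charFun (funext fun t => ?_)
    have h1 : charFun ((multivariateGaussian (0 : EuclideanSpace ℝ ι) V).map f) t =
        charFun (multivariateGaussian (0 : EuclideanSpace ℝ ι) V)
          (WithLp.toLp 2 (Bᵀ *ᵥ (t : Fin q → ℝ))) := by
      rw [charFun_apply, charFun_apply, integral_map hf.aemeasurable (by fun_prop)]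
      congr 1
      ext z
      congr 3
      simp only [f, EuclideanSpace.inner_eq_star_dotProduct, star_trivial, mulVec_transpose]
      rw [dotProduct_mulVec]
    have h2 : charFun ((stdGaussian (EuclideanSpace ℝ (Fin q))).map g) t =
        charFun (stdGaussian (EuclideanSpace ℝ (Fin q))) (g t) := by
      rw [charFun_apply, charFun_apply, integral_map hg.aemeasurable (by fun_prop)]
      congr 1
      ext z
      congr 3
      simp only [g, PiLp.inner_apply]
      refine Finset.sum_congr rfl fun i _ => ?_
      simp
      ring
    have h3 : (Bᵀ *ᵥ (t : Fin q → ℝ)) ⬝ᵥ V *ᵥ (Bᵀ *ᵥ (t : Fin q → ℝ)) = ‖g t‖ ^ 2 := by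
      rw [EuclideanSpace.norm_sq_eq, mulVec_mulVec, mulVec_transpose, ← dotProduct_mulVec,
        mulVec_mulVec, ← Matrix.mul_assoc, hB]
      simp only [g, dotProduct, mulVec_diagonal, Real.norm_eq_abs, sq_abs, mul_pow]
      refine Finset.sum_congr rfl fun i _ => ?_
      rw [Real.sq_sqrt (hc i)]
      ring
    rw [h1, h2, charFun_multivariateGaussian hV, charFun_stdGaussian]
    simp only [inner_zero_right, h3]
    congr 1
    push_cast
    ring
  have hsq : Measurable fun w : EuclideanSpace ℝ (Fin q) => ∑ i, w i ^ 2 := by fun_prop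
  have h1 : (fun z : EuclideanSpace ℝ ι => ∑ i, (B *ᵥ (z : ι → ℝ)) i ^ 2) =
      (fun w : EuclideanSpace ℝ (Fin q) => ∑ i, w i ^ 2) ∘ f := rfl
  rw [h1, ← Measure.map_map hsq hf, hlaw, Measure.map_map hsq hg, ← map_pi_eq_stdGaussian,
    Measure.map_map (hsq.comp hg) (by fun_prop), weightedChiSq]
  congr 1
  funext z
  simp only [Function.comp_apply, g]
  refine Finset.sum_congr rfl fun i _ => ?_
  rw [mul_pow, Real.sq_sqrt (hc i)]

end GaussianQuadraticForm

/-! ### The root expansion in block coordinates; continuity of the Schur complement -/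

section Blocks

open Matrix

variable {p₀ q : ℕ}

lemma toEuclideanCLM_apply_eq {ι : Type*} [Fintype ι] [DecidableEq ι] (A : Matrix ι ι ℝ)
    (x : EuclideanSpace ℝ ι) (i : ι) : toEuclideanCLM (𝕜 := ℝ) A x i = (A *ᵥ (x : ι → ℝ)) i := by
  simp

/-- The coordinate form of `exists_constrained_root_expansion`. -/
lemma exists_block_root_expansion {A : Matrix (Fin p₀ ⊕ Fin q) (Fin p₀ ⊕ Fin q) ℝ}
    (hA : A.PosDef) :
    ∃ C c₀ : ℝ, 0 < C ∧ 0 < c₀ ∧ ∀ (S S' : Param p₀ q → Param p₀ q) (θ t : Param p₀ q)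
      (r : Fin p₀ → ℝ) (δ c : ℝ), 0 ≤ c → c ≤ c₀ →
      (∀ x ∈ Metric.ball θ δ, ∀ y ∈ Metric.ball θ δ,
        ‖S x - S y + toEuclideanCLM (𝕜 := ℝ) A (x - y)‖ ≤ c * ‖x - y‖) →
      (∀ x ∈ Metric.ball θ δ, ∀ y ∈ Metric.ball θ δ,
        ‖S' x - S' y + toEuclideanCLM (𝕜 := ℝ) A (x - y)‖ ≤ c * ‖x - y‖) →
      C * (‖S θ‖ + ‖S' θ - S θ‖) < δ →
      S t = 0 → (∀ x ∈ Metric.ball θ δ, S x = 0 → x = t) →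
      (∀ j, S' (joinParam r (sndParam t)) (Sum.inl j) = 0) →
      (∀ r', joinParam r' (sndParam t) ∈ Metric.ball θ δ →
        (∀ j, S' (joinParam r' (sndParam t)) (Sum.inl j) = 0) → r' = r) →
      joinParam r (sndParam t) ∈ Metric.ball θ δ ∧
      ‖sndParam (S' (joinParam r (sndParam t))) -
        residualMatrix A *ᵥ ((S' θ - S θ : Param p₀ q) : Fin p₀ ⊕ Fin q → ℝ)‖ ≤
        C * c * (‖S θ‖ + ‖S' θ - S θ‖) := by
  -- `J` inserts the first block, `R` and `Q` extract the first and the second block, and `L` is the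
  -- residual map. The restricted parameter set is `t + J W`.
  set J : EuclideanSpace ℝ (Fin p₀) →L[ℝ] Param p₀ q := LinearMap.toContinuousLinearMap
    { toFun := fun w => joinParam w 0
      map_add' := fun x y => by ext (i | i) <;> simp [joinParam]
      map_smul' := fun a x => by ext (i | i) <;> simp [joinParam] }
  set R : Param p₀ q →L[ℝ] EuclideanSpace ℝ (Fin p₀) := LinearMap.toContinuousLinearMap
    { toFun := fun x => WithLp.toLp 2 fun j => x (Sum.inl j)
      map_add' := fun x y => by ext i; simp
      map_smul' := fun a x => by ext i; simp }
  set Q : Param p₀ q →L[ℝ] (Fin q → ℝ) := LinearMap.toContinuousLinearMap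
    { toFun := fun x => sndParam x
      map_add' := fun x y => by ext i; simp [sndParam]
      map_smul' := fun a x => by ext i; simp [sndParam] }
  set L : Param p₀ q →L[ℝ] (Fin q → ℝ) := LinearMap.toContinuousLinearMap
    { toFun := fun x => residualMatrix A *ᵥ (x : Fin p₀ ⊕ Fin q → ℝ)
      map_add' := fun x y => by simp [mulVec_add]
      map_smul' := fun a x => by simp [mulVec_smul] }
  have hJ : ∀ w, J w = joinParam w 0 := fun _ => rfl
  have hR : ∀ x j, R x j = x (Sum.inl j) := fun _ _ => rfl
  have hQ : ∀ x, Q x = sndParam x := fun _ => rfl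
  have hL : ∀ x, L x = residualMatrix A *ᵥ (x : Fin p₀ ⊕ Fin q → ℝ) := fun _ => rfl
  obtain ⟨T, hT⟩ : ∃ T : Param p₀ q ≃L[ℝ] Param p₀ q,
      ∀ x, T x = toEuclideanCLM (𝕜 := ℝ) A x := by
    obtain ⟨u, hu⟩ := hA.isUnit.map (toEuclideanCLM (𝕜 := ℝ) (n := Fin p₀ ⊕ Fin q))
    exact ⟨ContinuousLinearEquiv.ofUnit u, fun x => by rw [← hu]; rfl⟩
  obtain ⟨T₁, hT₁⟩ : ∃ T : EuclideanSpace ℝ (Fin p₀) ≃L[ℝ] EuclideanSpace ℝ (Fin p₀),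
      ∀ x, T x = toEuclideanCLM (𝕜 := ℝ) A.toBlocks₁₁ x := by
    obtain ⟨u, hu⟩ := (posDef_toBlocks₁₁ hA).isUnit.map (toEuclideanCLM (𝕜 := ℝ) (n := Fin p₀))
    exact ⟨ContinuousLinearEquiv.ofUnit u, fun x => by rw [← hu]; rfl⟩
  have hTJ : ∀ w, ((T (J w) : Param p₀ q) : Fin p₀ ⊕ Fin q → ℝ) =
      A *ᵥ Sum.elim (w : Fin p₀ → ℝ) 0 := by
    intro w
    rw [hT, hJ]
    funext i
    exact toEuclideanCLM_apply_eq _ _ _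
  obtain ⟨C, c₀, hC, hc₀, h⟩ := exists_constrained_root_expansion T J (fun w => le_of_eq (by
      rw [hJ, EuclideanSpace.norm_eq, EuclideanSpace.norm_eq]
      simp [joinParam])) R (fun x => by
      rw [EuclideanSpace.norm_eq, EuclideanSpace.norm_eq]
      refine Real.sqrt_le_sqrt ?_
      rw [Fintype.sum_sum_type]
      simp only [hR]
      exact le_add_of_nonneg_right (Finset.sum_nonneg fun _ _ => sq_nonneg _)) T₁ (fun w => by
      ext j
      rw [hT₁, toEuclideanCLM_apply_eq, hR, hTJ]
      simp [mulVec, dotProduct, toBlocks₁₁]) Q L (fun w => by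
      rw [hL, hTJ, mulVec_mulVec, residualMatrix_mul hA, fromCols_mulVec]
      simp) (fun x hx => by
      have hx1 : ∀ j, x (Sum.inl j) = 0 := fun j => by rw [← hR, hx]; rfl
      rw [hQ, hL, residualMatrix, fromCols_mulVec]
      have h1 : (x : Fin p₀ ⊕ Fin q → ℝ) ∘ Sum.inl = 0 := funext hx1
      rw [h1, mulVec_zero, zero_add, one_mulVec]
      rfl)
  refine ⟨C, c₀, hC, hc₀, fun S S' θ t r δ c h0 hc hS hS' hδ ht htu hr hru => ?_⟩
  have hjoin : ∀ r' : Fin p₀ → ℝ, t + J (WithLp.toLp 2 fun j => r' j - t (Sum.inl j)) =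
      joinParam r' (sndParam t) := by
    intro r'
    ext (i | i) <;> simp [hJ, joinParam, sndParam]
  have hjoin' : ∀ w : EuclideanSpace ℝ (Fin p₀), t + J w =
      joinParam (fun j => t (Sum.inl j) + w j) (sndParam t) := by
    intro w
    ext (i | i) <;> simp [hJ, joinParam, sndParam]
  have hfin := h S S' θ t (WithLp.toLp 2 fun j => r j - t (Sum.inl j)) δ c h0 hc
    (by simpa only [hT] using hS) (by simpa only [hT] using hS') hδ ht htu (by
      rw [hjoin]
      ext j
      exact hr j) (by
      intro w hw hRw
      rw [hjoin'] at hw hRw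
      have h1 := hru _ hw fun j => by rw [← hR, hRw]; rfl
      ext j
      rw [← h1]
      simp)
  rw [hjoin, hQ, hL] at hfin
  exact hfin

/-- Cramer's formula: the adjugate is continuous and the limiting determinant is nonzero. -/
lemma tendsto_matrix_inv {α : Type*} {F : Filter α} {ι : Type*} [Fintype ι] [DecidableEq ι]
    {B : α → Matrix ι ι ℝ} {S : Matrix ι ι ℝ} (hB : Tendsto B F (𝓝 S)) (hS : IsUnit S) :
    Tendsto (fun a => (B a)⁻¹) F (𝓝 S⁻¹) := by
  have hdet : S.det ≠ 0 := ((isUnit_iff_isUnit_det _).1 hS).ne_zero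
  simp_rw [inv_def, Ring.inverse_eq_inv']
  exact (((Continuous.matrix_det continuous_id).tendsto S).comp hB |>.inv₀ hdet).smul
    (((Continuous.matrix_adjugate continuous_id).tendsto S).comp hB)

lemma tendsto_schur_inv {α : Type*} {F : Filter α}
    {B : α → Matrix (Fin p₀ ⊕ Fin q) (Fin p₀ ⊕ Fin q) ℝ}
    {A : Matrix (Fin p₀ ⊕ Fin q) (Fin p₀ ⊕ Fin q) ℝ} (hB : ∀ j k,
      Tendsto (fun a => B a j k) F (𝓝 (A j k))) (hA : A.PosDef) :
    Tendsto (fun a => (schur (B a))⁻¹) F (𝓝 (schur A)⁻¹) := by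
  refine tendsto_matrix_inv ?_ (posDef_schur hA).isUnit
  have hpi : ∀ {m n : Type} (f : α → Matrix m n ℝ) (X : Matrix m n ℝ),
      (∀ i j, Tendsto (fun a => f a i j) F (𝓝 (X i j))) → Tendsto f F (𝓝 X) :=
    fun f X h => tendsto_pi_nhds.2 fun i => tendsto_pi_nhds.2 fun j => h i j
  have h11 := tendsto_matrix_inv (hpi (fun a => (B a).toBlocks₁₁) A.toBlocks₁₁
    fun i j => hB _ _) (posDef_toBlocks₁₁ hA).isUnit
  have h12 := hpi (fun a => (B a).toBlocks₁₂) A.toBlocks₁₂ fun i j => hB _ _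
  have h21 := hpi (fun a => (B a).toBlocks₂₁) A.toBlocks₂₁ fun i j => hB _ _
  have h22 := hpi (fun a => (B a).toBlocks₂₂) A.toBlocks₂₂ fun i j => hB _ _
  have hmul : ∀ {l m n : Type} [Fintype m] {f : α → Matrix l m ℝ} {g : α → Matrix m n ℝ}
      {X : Matrix l m ℝ} {Y : Matrix m n ℝ}, Tendsto f F (𝓝 X) → Tendsto g F (𝓝 Y) →
      Tendsto (fun a => f a * g a) F (𝓝 (X * Y)) := fun hf hg =>
    ((continuous_fst.matrix_mul continuous_snd).tendsto (_, _)).comp (hf.prodMk_nhds hg)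
  exact h22.sub (hmul (hmul h21 h11) h12)

end Blocks

/-! ### Random against expected sample size -/

section SampleSize

variable {U : Type*} [MeasurableSpace U] {P : Measure U} {π : Design U} {C₁ C₂ : ℝ}

/-- The sample size is asymptotically equivalent to its expectation. -/
lemma tendsto_card_div_size [IsProbabilityMeasure P] (hD : IsRegularDesign P π C₁ C₂) :
    Tendsto (fun x : Σ N, Outcome U N => ((sample x.2).card : ℝ) / expectedSize P π x.1)
      (sampleFilter P π) (𝓝 1) := by
  -- The function is chosen to cancel the weight: each sampled unit contributes `N / n₀`, so the
  -- weighted mean is `n / n₀`. The upper bound `C₂` is the envelope.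
  have h := tendsto_wMean_weight hD
    (h := fun N i d => N * (expectedSize P π N)⁻¹ * (π N i d : ℝ)) (H := fun _ => C₂) (c := 1)
    (fun N i => (measurable_unitInterval_coe (hD.measurable N i)).const_mul _)
    (integrable_const _)
    (fun N i d => mul_nonneg (mul_nonneg (Nat.cast_nonneg _)
      (inv_nonneg.2 (expectedSize_nonneg _ _ N))) (π N i d).2.1)
    (fun N i => (hD.bounds N i).mono fun d hd => hd.2) (by
      refine tendsto_const_nhds.congr' ?_
      filter_upwards [hD.eventually_pos] with N hN
      simp_rw [integral_const_mul]
      rw [← Finset.mul_sum]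
      change 1 = (N : ℝ)⁻¹ * (N * (expectedSize P π N)⁻¹ * expectedSize P π N)
      have h1 : (N : ℝ) ≠ 0 := by exact_mod_cast hN.1.ne'
      have h2 := hN.2.ne'
      field_simp)
  refine h.congr' ?_
  filter_upwards [eventually_sample_good hD (r := fun _ => True) (by simp)] with x hx
  have hN : (x.1 : ℝ) ≠ 0 := by exact_mod_cast hx.1.ne'
  have h1 : ∀ i ∈ sample x.2, weight π x.2 i * (x.1 * (expectedSize P π x.1)⁻¹ *
      (π x.1 i (x.2 i).1 : ℝ)) = x.1 * (expectedSize P π x.1)⁻¹ := by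
    intro i _
    have h2 := (hx.2.2.1 i).2.1.ne'
    rw [weight]
    change (inclProb π x.2 i : ℝ)⁻¹ * (_ * (inclProb π x.2 i : ℝ)) = _
    field_simp
  rw [wMean, Finset.sum_congr rfl h1, Finset.sum_const, nsmul_eq_mul]
  field_simp

end SampleSize

/-! ### The limiting quadratic form -/

section QuadraticForm

open Matrix

variable {p₀ q : ℕ}

/-- The quadratic form `(L z)ᵀ (A₂₂.₁)⁻¹ (L z)`, with `L = (-A₂₁ A₁₁⁻¹, 1)`. -/
def scoreForm (A : Matrix (Fin p₀ ⊕ Fin q) (Fin p₀ ⊕ Fin q) ℝ) (z : Param p₀ q) : ℝ :=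
  (residualMatrix A *ᵥ (z : Fin p₀ ⊕ Fin q → ℝ)) ⬝ᵥ
    ((schur A)⁻¹ *ᵥ (residualMatrix A *ᵥ (z : Fin p₀ ⊕ Fin q → ℝ)))

lemma continuous_residualMatrix_mulVec (A : Matrix (Fin p₀ ⊕ Fin q) (Fin p₀ ⊕ Fin q) ℝ) :
    Continuous fun z : Param p₀ q => residualMatrix A *ᵥ (z : Fin p₀ ⊕ Fin q → ℝ) :=
  continuous_const.matrix_mulVec (PiLp.continuous_ofLp 2 _)

lemma continuous_scoreForm (A : Matrix (Fin p₀ ⊕ Fin q) (Fin p₀ ⊕ Fin q) ℝ) :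
    Continuous (scoreForm A) :=
  (continuous_residualMatrix_mulVec A).dotProduct
    (continuous_const.matrix_mulVec (continuous_residualMatrix_mulVec A))

/-- The eigenvalues of `(A⁻¹ V A⁻ᵀ)₂₂ A₂₂.₁` are the weights of the limit law of the quadratic
form `scoreForm A` in a centred Gaussian vector with covariance matrix `V`. -/
lemma exists_weights_map_scoreForm {A V : Matrix (Fin p₀ ⊕ Fin q) (Fin p₀ ⊕ Fin q) ℝ}
    (hA : A.PosDef) (hV : V.PosDef) :
    ∃ c : Fin q → ℝ, Antitone c ∧ (∀ i, 0 < c i) ∧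
      ((A⁻¹ * V * (A⁻¹)ᵀ).toBlocks₂₂ * schur A).charpoly =
        ∏ i, (Polynomial.X - Polynomial.C (c i)) ∧
      (multivariateGaussian 0 V).map (scoreForm A) = weightedChiSq c := by
  -- Applied to the matrix `A₂₂.₁⁻¹` of the form and the covariance `L V Lᵀ` of `L z`. Then
  -- `scoreForm` is the squared length of `Λ L z`, whose covariance is diagonal.
  obtain ⟨c, Λ, hc, hc0, hΛ, hdiag, hchar⟩ := exists_simultaneous_diagonalization
    (posDef_schur hA).inv (posDef_residualMatrix_mul (M := A) hV)
  refine ⟨c, hc, hc0, by rw [toBlocks₂₂_sandwich_mul_schur hA, hchar], ?_⟩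
  rw [← map_multivariateGaussian_eq_weightedChiSq hV.posSemidef (B := Λ * residualMatrix A)
    (fun i => (hc0 i).le) (by
      rw [← hdiag, transpose_mul]
      simp only [Matrix.mul_assoc])]
  congr 1
  funext z
  rw [scoreForm, ← hΛ, ← mulVec_mulVec, mulVec_transpose, dotProduct_comm,
    ← dotProduct_mulVec, ← mulVec_mulVec]
  exact Finset.sum_congr rfl fun i _ => (pow_two _).symm

end QuadraticForm

/-! ### Limit of the bootstrap statistic -/

section Limit

variable {U X : Type*} [MeasurableSpace U] {p₀ q : ℕ} {M : Model U X p₀ q}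
  {π : Design U} {θ : Param p₀ q} {C₁ C₂ : ℝ}

open Model

/-- The structure of the problem that matters for the limit of the bootstrap statistic. -/
structure IsBootstrapSetting (M : Model U X p₀ q) (π : Design U) (θ : Param p₀ q)
    (A V : Matrix (Fin p₀ ⊕ Fin q) (Fin p₀ ⊕ Fin q) ℝ) (C₁ C₂ : ℝ)
    (θhat : ∀ N, Outcome U N → Param p₀ q)
    (θstar : ∀ N, Outcome U N → (Fin N → ℕ) → (Fin p₀ → ℝ)) : Prop where
  design : IsRegularDesign M.P π C₁ C₂
  score : IsCenteredScore M.P π (M.score θ) V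
  posDef_info : A.PosDef
  posDef_cov : V.PosDef
  linearization : ∀ ε : ℝ, 0 < ε → ∃ δ : ℝ, 0 < δ ∧ Metric.ball θ δ ⊆ M.Θ ∧
    (∀ᶠ x in sampleFilter M.P π,
      (∀ t ∈ Metric.ball θ δ, ∀ j k, |M.wInfo x.2 (weight π x.2) t j k - A j k| ≤ ε) ∧
      ∀ t ∈ Metric.ball θ δ, ∀ t' ∈ Metric.ball θ δ,
        ‖M.wScore x.2 (weight π x.2) t - M.wScore x.2 (weight π x.2) t' +
          Matrix.toEuclideanCLM (𝕜 := ℝ) A (t - t')‖ ≤ ε * ‖t - t'‖) ∧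
    (∀ᶠ z in bootFilter M.P π,
      (∀ t ∈ Metric.ball θ δ, ∀ j k,
        |M.wInfo z.1.2 (bootWeight π z.1.2 z.2) t j k - A j k| ≤ ε) ∧
      ∀ t ∈ Metric.ball θ δ, ∀ t' ∈ Metric.ball θ δ,
        ‖M.wScore z.1.2 (bootWeight π z.1.2 z.2) t - M.wScore z.1.2 (bootWeight π z.1.2 z.2) t' +
          Matrix.toEuclideanCLM (𝕜 := ℝ) A (t - t')‖ ≤ ε * ‖t - t'‖)
  isSolution : ∀ᶠ x in sampleFilter M.P π, M.IsSolution π x.2 (θhat x.1 x.2)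
  isBootSolution : ∀ᶠ z in bootFilter M.P π,
    M.IsBootSolution π z.1.2 z.2 (sndParam (θhat z.1.1 z.1.2)) (θstar z.1.1 z.1.2 z.2)

namespace IsBootstrapSetting

variable {A V : Matrix (Fin p₀ ⊕ Fin q) (Fin p₀ ⊕ Fin q) ℝ}
  {θhat : ∀ N, Outcome U N → Param p₀ q}
  {θstar : ∀ N, Outcome U N → (Fin N → ℕ) → (Fin p₀ → ℝ)}

/-- On the events where the scaled scores are bounded, the restricted bootstrap estimator is close
to `θ`, and the second component of the bootstrap score at this estimator is approximately
linear. -/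
lemma eventually_expansion [IsProbabilityMeasure M.P]
    (h : IsBootstrapSetting M π θ A V C₁ C₂ θhat θstar)
    {F : Filter (Σ x : (Σ N, Outcome U N), (Fin x.1 → ℕ))} (hF : F ≤ bootFilter M.P π)
    (hF' : Tendsto Sigma.fst F (sampleFilter M.P π)) {K K' : ℝ}
    (hK : ∀ᶠ z in F, ‖scaledMean M.P π (M.score θ) z.1‖ ≤ K)
    (hK' : ∀ᶠ z in F, ‖scaledBoot M.P π (M.score θ) z‖ ≤ K') {η : ℝ} (hη : 0 < η) :
    ∀ᶠ z in F,
      (∀ j k, |M.wInfo z.1.2 (bootWeight π z.1.2 z.2)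
        (joinParam (θstar z.1.1 z.1.2 z.2) (sndParam (θhat z.1.1 z.1.2))) j k - A j k| ≤ η) ∧
      ‖√(expectedSize M.P π z.1.1) • sndParam (M.wScore z.1.2 (bootWeight π z.1.2 z.2)
        (joinParam (θstar z.1.1 z.1.2 z.2) (sndParam (θhat z.1.1 z.1.2)))) -
        residualMatrix A *ᵥ
          (scaledBoot M.P π (M.score θ) z : Fin p₀ ⊕ Fin q → ℝ)‖ ≤ η := by
  obtain ⟨C, c₀, hC, hc₀, hexp⟩ := exists_block_root_expansion h.posDef_info
  set κ := |K| + |K'| + 1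
  have hκ : 0 < κ := by positivity
  -- The three bounds serve the root expansion, the closeness of the information, and the error `C c
  -- κ ≤ η` after scaling by `√n₀`.
  set c := min (min c₀ η) (η / (C * κ))
  have hc : 0 < c := by positivity
  obtain ⟨δ, hδ, hδΘ, hlin, hlin'⟩ := h.linearization c hc
  have hsize : Tendsto (fun z : Σ x : (Σ N, Outcome U N), (Fin x.1 → ℕ) =>
      √(expectedSize M.P π z.1.1)) F atTop :=
    Real.tendsto_sqrt_atTop.comp
      (h.design.tendsto_size.comp (tendsto_fst_highProb.comp hF'))
  -- The last condition puts the scores, of size at most `κ / √n₀`, within reach of the fixed radius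
  -- `δ`.
  filter_upwards [hF' hlin, hF hlin', hF' h.isSolution, hF h.isBootSolution, hK, hK',
    hsize.eventually_gt_atTop (max 0 (C * κ / δ))] with z hl hl' hs hb hz hz' hn
  obtain ⟨⟨N, s⟩, m⟩ := z
  simp only [Set.mem_preimage, Set.mem_ofPred_eq] at hl hl' hs hb hz hz' hn ⊢
  set a := √(expectedSize M.P π N) with ha
  have ha0 : 0 < a := (le_max_left _ _).trans_lt hn
  have haδ : C * κ / δ < a := (le_max_right _ _).trans_lt hn
  rw [div_lt_iff₀ hδ] at haδ
  set S := M.wScore s (weight π s)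
  set S' := M.wScore s (bootWeight π s m)
  have hz1 : a * ‖S θ‖ ≤ K := by
    rw [scaledMean, norm_smul, Real.norm_of_nonneg ha0.le] at hz
    exact hz
  have hzb : scaledBoot M.P π (M.score θ) ⟨⟨N, s⟩, m⟩ = a • (S' θ - S θ) := rfl
  have hz2 : a * ‖S' θ - S θ‖ ≤ K' := by
    rw [hzb, norm_smul, Real.norm_of_nonneg ha0.le] at hz'
    exact hz'
  have hsum : a * (‖S θ‖ + ‖S' θ - S θ‖) ≤ κ := by
    have := le_abs_self K
    have := le_abs_self K'
    simp only [κ]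
    linarith
  obtain ⟨hball, herr⟩ := hexp S S' θ (θhat N s) (θstar N s m) δ c hc.le
    ((min_le_left _ _).trans (min_le_left _ _)) hl.2 hl'.2 (by
      rw [← mul_lt_mul_iff_right₀ ha0]
      calc a * (C * (‖S θ‖ + ‖S' θ - S θ‖)) = C * (a * (‖S θ‖ + ‖S' θ - S θ‖)) := by ring
        _ ≤ C * κ := by gcongr
        _ < a * δ := haδ) hs.2.1 (fun x hx => hs.2.2 x (hδΘ hx)) hb.2.1
    (fun r' hr' => hb.2.2 r' (hδΘ hr'))
  refine ⟨fun j k => (hl'.1 _ hball j k).trans ((min_le_left _ _).trans (min_le_right _ _)), ?_⟩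
  have hdiff : a • sndParam (S' (joinParam (θstar N s m) (sndParam (θhat N s)))) -
      residualMatrix A *ᵥ ((a • (S' θ - S θ) : Param p₀ q) : Fin p₀ ⊕ Fin q → ℝ) =
      a • (sndParam (S' (joinParam (θstar N s m) (sndParam (θhat N s)))) -
        residualMatrix A *ᵥ ((S' θ - S θ : Param p₀ q) : Fin p₀ ⊕ Fin q → ℝ)) := by
    rw [WithLp.ofLp_smul, Matrix.mulVec_smul, smul_sub]
  rw [hzb, hdiff, norm_smul, Real.norm_of_nonneg ha0.le]
  have hcη : c * (C * κ) ≤ η := by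
    rw [← le_div_iff₀ (by positivity)]
    exact min_le_right _ _
  calc a * _ ≤ a * (C * c * (‖S θ‖ + ‖S' θ - S θ‖)) := by gcongr
    _ = C * c * (a * (‖S θ‖ + ‖S' θ - S θ‖)) := by ring
    _ ≤ C * c * κ := by gcongr
    _ = c * (C * κ) := by ring
    _ ≤ η := hcη

/-- The bootstrap statistic, multiplied by the sample size. -/
def bootStat (M : Model U X p₀ q) (π : Design U) (θhat : ∀ N, Outcome U N → Param p₀ q)
    (θstar : ∀ N, Outcome U N → (Fin N → ℕ) → (Fin p₀ → ℝ))
    (z : Σ x : (Σ N, Outcome U N), (Fin x.1 → ℕ)) : ℝ :=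
  ((sample z.1.2).card : ℝ) * M.quasiScoreStat z.1.2 (bootWeight π z.1.2 z.2)
    (joinParam (θstar z.1.1 z.1.2 z.2) (sndParam (θhat z.1.1 z.1.2)))

/-- Compactness replaces uniform continuity of `f`: along an ultrafilter the bounded scaled score
has a limit `z₀`, and both the statistic and the quadratic form then tend to `scoreForm A z₀`. -/
lemma tendsto_bootStat_sub [IsProbabilityMeasure M.P]
    (h : IsBootstrapSetting M π θ A V C₁ C₂ θhat θstar)
    {F : Filter (Σ x : (Σ N, Outcome U N), (Fin x.1 → ℕ))} (hF : F ≤ bootFilter M.P π)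
    (hF' : Tendsto Sigma.fst F (sampleFilter M.P π)) {K K' : ℝ}
    (hK : ∀ᶠ z in F, ‖scaledMean M.P π (M.score θ) z.1‖ ≤ K)
    (hK' : ∀ᶠ z in F, ‖scaledBoot M.P π (M.score θ) z‖ ≤ K') (f : ℝ →ᵇ ℝ) :
    Tendsto (fun z => f (bootStat M π θhat θstar z) -
      f (scoreForm A (scaledBoot M.P π (M.score θ) z))) F (𝓝 0) := by
  refine tendsto_iff_ultrafilter _ _ _ |>.2 fun G hG => ?_
  obtain ⟨z₀, -, hz₀⟩ := (isCompact_closedBall (0 : Param p₀ q) K').ultrafilter_le_nhds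
    (G.map (scaledBoot M.P π (M.score θ))) (by
      rw [le_principal_iff]
      exact hG (hK'.mono fun z hz => mem_closedBall_zero_iff.2 hz))
  have hZ : Tendsto (scaledBoot M.P π (M.score θ)) G (𝓝 z₀) := hz₀
  have hexp := fun η (hη : 0 < η) => hG (h.eventually_expansion hF hF' hK hK' hη)
  set I := fun z : Σ x : (Σ N, Outcome U N), (Fin x.1 → ℕ) =>
    M.wInfo z.1.2 (bootWeight π z.1.2 z.2)
      (joinParam (θstar z.1.1 z.1.2 z.2) (sndParam (θhat z.1.1 z.1.2))) with hI
  set y := fun z : Σ x : (Σ N, Outcome U N), (Fin x.1 → ℕ) =>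
    √(expectedSize M.P π z.1.1) • sndParam (M.wScore z.1.2 (bootWeight π z.1.2 z.2)
      (joinParam (θstar z.1.1 z.1.2 z.2) (sndParam (θhat z.1.1 z.1.2)))) with hy
  have hinfo : Tendsto (fun z => (schur (I z))⁻¹) G (𝓝 (schur A)⁻¹) := by
    refine tendsto_schur_inv (fun j k => Metric.tendsto_nhds.2 fun η hη => ?_) h.posDef_info
    filter_upwards [hexp (η / 2) (half_pos hη)] with z hz
    rw [Real.dist_eq]
    exact (hz.1 j k).trans_lt (half_lt_self hη)
  have hLZ := ((continuous_residualMatrix_mulVec A).tendsto z₀).comp hZ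
  have hy0 : Tendsto (fun z => y z - residualMatrix A *ᵥ
      (scaledBoot M.P π (M.score θ) z : Fin p₀ ⊕ Fin q → ℝ)) G (𝓝 0) := by
    refine Metric.tendsto_nhds.2 fun η hη => ?_
    filter_upwards [hexp (η / 2) (half_pos hη)] with z hz
    rw [dist_zero_right]
    exact hz.2.trans_lt (half_lt_self hη)
  have hyl : Tendsto y G (𝓝 (residualMatrix A *ᵥ (z₀ : Fin p₀ ⊕ Fin q → ℝ))) := by
    have := hy0.add hLZ
    rw [zero_add] at this
    refine this.congr fun z => ?_
    simp
  have hform : Tendsto (fun z => y z ⬝ᵥ ((schur (I z))⁻¹ *ᵥ y z)) G (𝓝 (scoreForm A z₀)) := by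
    have hc : Continuous fun p : (Fin q → ℝ) × Matrix (Fin q) (Fin q) ℝ => p.1 ⬝ᵥ (p.2 *ᵥ p.1) :=
      continuous_fst.dotProduct (continuous_snd.matrix_mulVec continuous_fst)
    exact (hc.tendsto (_, _)).comp (hyl.prodMk_nhds hinfo)
  have hcard := ((tendsto_card_div_size h.design).comp hF').mono_left hG
  have hprod := hcard.mul hform
  rw [one_mul] at hprod
  have hstat : Tendsto (bootStat M π θhat θstar) G (𝓝 (scoreForm A z₀)) := by
    refine hprod.congr' ?_
    have hpos : ∀ᶠ z in (G : Filter (Σ x : (Σ N, Outcome U N), (Fin x.1 → ℕ))),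
        0 < expectedSize M.P π z.1.1 :=
      (h.design.tendsto_size.comp
        (tendsto_fst_highProb.comp (hF'.mono_left hG))).eventually_gt_atTop 0
    filter_upwards [hpos] with z hz
    have hsq := Real.mul_self_sqrt hz.le
    simp only [hy, hI, bootStat, quasiScoreStat, Function.comp_apply, Matrix.mulVec_smul,
      smul_dotProduct, dotProduct_smul, smul_eq_mul]
    -- The form is quadratic, so the two factors `√n₀` give `n₀`, which the ratio `n / n₀` turns
    -- into `n`.
    rw [← mul_assoc (√_), hsq]
    field_simp
  have h1 := (f.continuous.tendsto _).comp hstat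
  have h2 := (f.continuous.tendsto _).comp (((continuous_scoreForm A).tendsto z₀).comp hZ)
  have h3 := h1.sub h2
  rw [sub_self] at h3
  exact h3

/-- The conditional law of the bootstrap statistic converges to the law of a quadratic form in a
Gaussian vector. -/
theorem tendsto_integral_bootStat [IsProbabilityMeasure M.P]
    (h : IsBootstrapSetting M π θ A V C₁ C₂ θhat θstar) (f : ℝ →ᵇ ℝ) :
    Tendsto (fun x : Σ N, Outcome U N => ∫ m, f (bootStat M π θhat θstar ⟨x, m⟩) ∂bootLaw π x.2)
      (sampleFilter M.P π) (𝓝 (∫ r, f r ∂(multivariateGaussian 0 V).map (scoreForm A))) := by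
  have hdiff : Tendsto (fun x : Σ N, Outcome U N =>
      ∫ m, (f (bootStat M π θhat θstar ⟨x, m⟩) -
        f (scoreForm A (scaledBoot M.P π (M.score θ) ⟨x, m⟩))) ∂bootLaw π x.2)
      (sampleFilter M.P π) (𝓝 0) := by
    -- Tightness is used on both levels: first to restrict to samples with bounded scaled score,
    -- then, given such samples, to bounded bootstrap fluctuations.
    refine tendsto_highProb_of_tight (Y := scaledMean M.P π (M.score θ))
      (h.score.tight_scaledMean h.design) fun K => ?_
    have hle : highProb atTop (samplingLaw M.P π) ⊓
        𝓟 {x | ‖scaledMean M.P π (M.score θ) x‖ ≤ K} ≤ sampleFilter M.P π := inf_le_left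
    refine tendsto_integral_of_highProb (C := 2 * ‖f‖) (X := fun z =>
      f (bootStat M π θhat θstar z) - f (scoreForm A (scaledBoot M.P π (M.score θ) z)))
      (fun z => ?_) (hle (eventually_isProbabilityMeasure_bootLaw h.design))
      (Eventually.of_forall fun x => (Measurable.of_discrete).aestronglyMeasurable) ?_
    · have h1 := f.norm_coe_le_norm (bootStat M π θhat θstar z)
      have h2 := f.norm_coe_le_norm (scoreForm A (scaledBoot M.P π (M.score θ) z))
      rw [Real.norm_eq_abs] at h1 h2
      have := abs_sub (f (bootStat M π θhat θstar z))
        (f (scoreForm A (scaledBoot M.P π (M.score θ) z)))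
      linarith
    · refine tendsto_highProb_of_tight (Y := scaledBoot M.P π (M.score θ)) (fun ε hε => ?_)
        fun K' => ?_
      · obtain ⟨K', hK'⟩ := h.score.tight_scaledBoot h.design h.posDef_cov.posSemidef ε hε
        exact ⟨K', hle hK'⟩
      · have hfst := (tendsto_fst_highProb (l := highProb atTop (samplingLaw M.P π) ⊓
          𝓟 {x | ‖scaledMean M.P π (M.score θ) x‖ ≤ K})
          (ν := fun x : Σ N, Outcome U N => bootLaw π x.2)).mono_left
          (inf_le_left (b := 𝓟 {z | ‖scaledBoot M.P π (M.score θ) z‖ ≤ K'}))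
        exact h.tendsto_bootStat_sub (K := K) (K' := K') (inf_le_left.trans (highProb_mono hle))
          (hfst.mono_right hle) (hfst (mem_inf_of_right (mem_principal_self _)))
          (mem_inf_of_right (mem_principal_self _)) f
  have hmain := h.score.tendsto_integral_scaledBoot h.design h.posDef_cov.posSemidef
    (f.compContinuous ⟨scoreForm A, continuous_scoreForm A⟩)
  have hsum := hdiff.add hmain
  rw [zero_add] at hsum
  rw [integral_map (continuous_scoreForm A).aemeasurable
    f.continuous.aestronglyMeasurable]
  refine hsum.congr' ?_
  filter_upwards [eventually_isProbabilityMeasure_bootLaw h.design] with x hx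
  have hint : ∀ g : (Fin x.1 → ℕ) → ℝ, Integrable (fun m => f (g m)) (bootLaw π x.2) := fun g =>
    Integrable.of_bound (C := ‖f‖) (Measurable.of_discrete).aestronglyMeasurable
      (Eventually.of_forall fun m => f.norm_coe_le_norm _)
  rw [integral_sub (hint _) (hint _)]
  simp

end IsBootstrapSetting

end Limit

end SurveyBootstrap

end

/-! ### Assembly of the theorem -/

open SurveyBootstrap in
theorem theorem5 {U X : Type*} [MeasurableSpace U] [MeasurableSpace X] {p₀ q : ℕ}
    -- super-population model, sampling design, true parameter
    (M : Model U X p₀ q) [IsProbabilityMeasure M.P] (π : Design U) (θ₀ : Param p₀ q)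
    (hx : Measurable M.x) (hy : Measurable M.y) (hμ : ∀ t, Measurable fun a => M.μ a t)
    (hπ : ∀ N i, Measurable (π N i))
    (hΘ : IsOpen M.Θ) (hθ₀ : θ₀ ∈ M.Θ)
    -- mean model `E(Y | x) = μ(x; θ₀)`
    (hYint : Integrable M.y M.P)
    (hmean : M.P[M.y | MeasurableSpace.comap M.x inferInstance] =ᵐ[M.P]
      fun d => M.μ (M.x d) θ₀)
    -- smoothness of the mean function and of the (positive) working variance function
    (hμC2 : ∀ a, ContDiffOn ℝ 2 (M.μ a) M.Θ)
    (hV₀pos : ∀ a, ∀ t ∈ M.Θ, 0 < M.V₀ (M.μ a t))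
    (hV₀C1 : ∀ a, ∀ t ∈ M.Θ, ContDiffAt ℝ 1 M.V₀ (M.μ a t))
    -- the neighbourhood of `θ₀` of the regularity conditions
    (B : Set (Param p₀ q)) (hB : B ∈ 𝓝 θ₀) (hBΘ : B ⊆ M.Θ)
    -- bounded sixth moments of the quasi-score
    (K : ℝ) (hmom : ∀ t ∈ B, Integrable (fun d => ‖M.score t d‖ ^ 6) M.P ∧
      ∫ d, ‖M.score t d‖ ^ 6 ∂M.P ≤ K)
    -- `n₀ var{Ŝ_w(θ)}` converges to a positive definite matrix
    (VS : Param p₀ q → Matrix (Fin p₀ ⊕ Fin q) (Fin p₀ ⊕ Fin q) ℝ)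
    (hVpd : ∀ t ∈ B, (VS t).PosDef)
    (hV : ∀ t ∈ B, ∀ j k, Tendsto (fun N => expectedSize M.P π N *
      covariance (fun s : Outcome U N => M.wScore s (weight π s) t j)
        (fun s : Outcome U N => M.wScore s (weight π s) t k) (samplingLaw M.P π N))
      atTop (𝓝 (VS t j k)))
    -- local domination of `I(θ; Y)`, and invertibility of `𝓘(θ₀)`
    (H : U → ℝ) (hHint : Integrable H M.P)
    (hdom : ∀ᵐ d ∂M.P, ∀ t ∈ B, ∀ j k, |M.info t d j k| ≤ H d)
    (hinfo : IsUnit (M.expInfo θ₀))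
    -- Poisson sampling: `n₀ → ∞`, `n₀ / N → 0`, `C₁ ≤ N n₀⁻¹ π_i ≤ C₂`
    (hn₀ : Tendsto (expectedSize M.P π) atTop atTop)
    (hn₀N : Tendsto (fun N => expectedSize M.P π N / N) atTop (𝓝 0))
    (C₁ C₂ : ℝ) (hC₁ : 0 < C₁)
    (hC : ∀ N i, ∀ᵐ d ∂M.P, C₁ ≤ N * (expectedSize M.P π N)⁻¹ * (π N i d : ℝ) ∧
      N * (expectedSize M.P π N)⁻¹ * (π N i d : ℝ) ≤ C₂)
    -- `θhat` is, with probability tending to one, the solution of `Ŝ_w(θ) = 0`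
    (θhat : ∀ N, Outcome U N → Param p₀ q)
    (hθhat : Tendsto (fun N => samplingLaw M.P π N {s | ¬ M.IsSolution π s (θhat N s)})
      atTop (𝓝 0))
    -- `θstar` is, with conditional probability tending to one in probability,
    -- the solution of `Ŝ_{w1}*(θ₁, θhat₂) = 0`
    (θstar : ∀ N, Outcome U N → (Fin N → ℕ) → (Fin p₀ → ℝ))
    (hθstar : ∀ ε : ENNReal, 0 < ε → Tendsto (fun N => samplingLaw M.P π N
      {s | ε ≤ bootLaw π s {m |
        ¬ M.IsBootSolution π s m (sndParam (θhat N s)) (θstar N s m)}}) atTop (𝓝 0)) :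
    -- `c_1 ≥ ... ≥ c_q > 0` are the eigenvalues of `Σ_{θ,22} 𝓘_{22.1}(θ₀)`, where
    -- `Σ_θ = 𝓘(θ₀)⁻¹ Σ_S(θ₀) {𝓘(θ₀)⁻¹}ᵀ` is the asymptotic variance of `√n (θhat - θ₀)`
    ∃ c : Fin q → ℝ, Antitone c ∧ (∀ i, 0 < c i) ∧
      (((M.expInfo θ₀)⁻¹ * VS θ₀ * ((M.expInfo θ₀)⁻¹)ᵀ).toBlocks₂₂ *
        schur (M.expInfo θ₀)).charpoly = ∏ i, (Polynomial.X - Polynomial.C (c i)) ∧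
      -- `n X*²_QS(θhat₂)` converges to `∑ c_i Z_i²` in distribution, given the sample
      TendstoInDistributionGiven (fun N => samplingLaw M.P π N)
        (fun N (s : Outcome U N) => bootLaw π s)
        (fun N (s : Outcome U N) m => ((sample s).card : ℝ) *
          M.quasiScoreStat s (bootWeight π s m)
            (joinParam (θstar N s m) (sndParam (θhat N s))))
        (weightedChiSq c) := by
  have hD : IsRegularDesign M.P π C₁ C₂ := ⟨hπ, hn₀, hn₀N, hC₁, hC⟩
  have hM : M.IsSmooth := ⟨hx, hy, hμ, hΘ, hμC2, hV₀pos, hV₀C1⟩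
  have hθB : θ₀ ∈ B := mem_of_mem_nhds hB
  have hLp : MemLp (M.score θ₀) 3 M.P := by
    have h6 : MemLp (M.score θ₀) ((6 : ℕ) : ENNReal) M.P := by
      rw [← integrable_norm_rpow_iff (hM.measurable_score hθ₀).aestronglyMeasurable (by norm_num)
        (by norm_num)]
      simp_rw [ENNReal.toReal_natCast, Real.rpow_natCast]
      exact (hmom θ₀ hθB).1
    exact h6.mono_exponent (by norm_num)
  have hinfoint : ∀ j k, Integrable (fun d => M.info θ₀ d j k) M.P := fun j k =>
    hHint.mono' (hM.measurable_info hθ₀ j k).aestronglyMeasurable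
      (hdom.mono fun d hd => hd θ₀ hθB j k)
  -- Positive semidefiniteness comes from the mean model; invertibility upgrades it.
  have hA : (M.expInfo θ₀).PosDef :=
    ((hM.posSemidef_expInfo hθ₀ hYint hmean hinfoint).posDef_iff_isUnit).2 hinfo
  have hscore : IsCenteredScore M.P π (M.score θ₀) (VS θ₀) :=
    ⟨hM.measurable_score hθ₀, hLp, fun j => hM.integral_score_eq_zero hθ₀ hYint hmean
      (hLp.integrable (by norm_num)) j, fun j k => by
        simpa only [Model.wScore_apply] using hV θ₀ hθB j k⟩
  have hset : IsBootstrapSetting M π θ₀ (M.expInfo θ₀) (VS θ₀) C₁ C₂ θhat θstar := by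
    refine ⟨hD, hscore, hA, hVpd θ₀ hθB, fun ε hε => ?_, hθhat, ?_⟩
    -- One `ε'` serves the entrywise bound and, with the dimensional factor of `norm_wScore_sub_le`,
    -- the linearization bound.
    · obtain ⟨ε', hε'0, hε'ε, hε'⟩ : ∃ ε' : ℝ, 0 < ε' ∧ ε' ≤ ε ∧ (p₀ + q) ^ 2 * ε' ≤ ε := by
        refine ⟨ε / ((p₀ + q) ^ 2 + 1), by positivity, div_le_self hε.le (by
          have : (0 : ℝ) ≤ (p₀ + q) ^ 2 := by positivity
          linarith), ?_⟩
        rw [mul_div_assoc', div_le_iff₀ (by positivity)]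
        nlinarith
      obtain ⟨δ, hδ, hδΘ, hclose⟩ := hM.eventually_wInfo_close hB hBΘ hHint hdom hε'0
      have hae : ∀ r : U → Prop, (∀ᵐ d ∂M.P, r d) →
          ∀ᶠ x : Σ N, Outcome U N in sampleFilter M.P π, ∀ i, r (x.2 i).1 := fun r hr =>
        (eventually_sample_good hD hr).mono fun x hx i => (hx.2.2.1 i).2.2
      have h1 := hclose (sampleFilter M.P π) (fun x => x.1) (fun x => x.2)
        (fun x => weight π x.2) (fun x => weight_nonneg π x.2)
        (fun h hm hi => tendsto_wMean_weight_of_integrable hD hm hi) hae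
      have h2 := hclose (bootFilter M.P π) (fun z => z.1.1) (fun z => z.1.2)
        (fun z => bootWeight π z.1.2 z.2)
        (fun z i => mul_nonneg (weight_nonneg π z.1.2 i) (Nat.cast_nonneg _))
        (fun h hm hi => tendsto_wMean_bootWeight_of_integrable hD hm hi)
        (fun r hr => tendsto_fst_highProb (hae r hr))
      refine ⟨δ, hδ, hδΘ, ?_, ?_⟩
      · filter_upwards [h1] with x hx
        exact ⟨fun t ht j k => (hx t ht j k).trans hε'ε, fun t ht t' ht' =>
          (hM.norm_wScore_sub_le hδΘ hx ht ht').trans (by gcongr)⟩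
      · filter_upwards [h2] with z hz
        exact ⟨fun t ht j k => (hz t ht j k).trans hε'ε, fun t ht t' ht' =>
          (hM.norm_wScore_sub_le hδΘ hz ht ht').trans (by gcongr)⟩
    -- Unfolding the iterated filter gives convergence in probability of the conditional failure
    -- probability, with `> ε` where the hypothesis has `≥ ε`.
    · rw [bootFilter, eventually_highProb, ENNReal.tendsto_nhds_zero]
      intro ε hε
      rw [sampleFilter, eventually_highProb]
      refine tendsto_of_tendsto_of_tendsto_of_le_of_le tendsto_const_nhds (hθstar ε hε)
        (fun _ => zero_le) fun N => measure_mono fun s hs => ?_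
      exact (not_le.1 (show ¬ _ from hs)).le
  obtain ⟨c, hc, hc0, hchar, hlaw⟩ := exists_weights_map_scoreForm hA (hVpd θ₀ hθB)
  refine ⟨c, hc, hc0, hchar, fun f ε hε => ?_⟩
  have hlim := Metric.tendsto_nhds.1 (hset.tendsto_integral_bootStat f) ε hε
  rw [hlaw, sampleFilter, eventually_highProb] at hlim
  refine hlim.congr fun N => ?_
  congr 1
  ext s
  simp only [Set.mem_ofPred_eq, Real.dist_eq, not_lt]
  rfl
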